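/- **Theorem (curvature of the reduced Bismut connection).** Let $(M,g)$ be a smooth Riemannian manifold with a closed 3-form $H$. For a metric $g$ and 3-form $H$, the $\pm$-Bismut connections are $\nabla^\pm=\nabla\pm\tfrac12 g^{-1}H$, i.e. $\nabla^\pm_XY=\nabla_XY\pm\tfrac12 g^{-1}H(X,Y,\cdot)$ with $\nabla$ the Levi-Civita connection. Curvature is $R(X,Y)Z=\nabla_X\nabla_YZ-\nabla_Y\nabla_XZ-\nabla_{[X,Y]}Z$ for the respective connection, and $R^-$ is the curvature of $\nabla^-$. Write $(\cdot,\cdot)=g$. Let a compact connected Lie group $G$ act smoothly, freely and properly on $M$, preserving $g$ and $H$. Let $e_a$ be a basis of $\mathfrak g$ and $V_a$ the fundamental vector fields. Let $\xi:\mathfrak g\to\Omega^1(M)$ be an equivariant linear map, $\xi_a=\xi(e_a)$, such that $H+\phi^a\xi_a$ is closed for the equivariant differential $d_\phi=d-\phi^a\iota_{V_a}$; that is, $dH=0$, $d\xi_a=\iota_{V_a}H$ and $\xi_a(V_b)+\xi_b(V_a)=0$. Put $$V_a^\pm=V_a\pm g^{-1}\xi_a,\quad \xi_a^\pm=g(V_a^\pm,\cdot),\quad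 K_{ab}=g(V_a,V_b)-\xi_a(V_b),\quad T_{ab}=g(V_a^-,V_b^-),$$ let $K^{ab}$, $T^{ab}$ be the entries of the inverse matrices, and let $$\tau_\pm=\{Y\in TM : g(Y,V_a)\pm\xi_a(Y)=0\ \text{for all }a\}.$$ Give $M/G$ the smooth structure for which $\pi:M\to M/G$ is a submersion. For a vector field $X$ on $M/G$ let $X^\pm$ be its lift to a section of $\tau_\pm$. The reduced metric $\tilde g$ on $M/G$ is given by $\tilde g(X,Y)\circ\pi=g(X^+,Y^+)$. The reduced flux $\tilde H$ is the curvature of the metric splitting of the reduced Courant algebroid: with $\hat X=\tfrac12(X^++g(X^+))+\tfrac12(X^--g(X^-))\in\Gamma(TM\oplus T^*M)$, $$\tilde H(X,Y,Z)\circ\pi=\langle[\hat X,\hat Y]_H,\hat Z\rangle,$$ where $[X+\alpha,Y+\beta]_H=[X,Y]+L_X\beta-\iota_Yd\alpha+\iota_Y\iota_XH$ and $\langle X+\alpha,Y+\beta\rangle=\alpha(Y)+\beta(X)$. Let $\tilde\nabla=\nabla^{\tilde g}-\tfrac12\tilde g^{-1}\tilde H$, with $\nabla^{\tilde g}$ the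 Levi-Civita connection of $\tilde g$, be the $-$-Bismut connection of $(M/G,\tilde g,\tilde H)$ and $\tilde R$ its curvature. Then for all smooth vector fields $X,Y,Z,W$ on $M/G$, at every point of $M$ (with summation over repeated indices), $$\begin{aligned}\tilde g(\tilde R(X,Y)Z,W)\circ\pi={}&(R^-(X^+,Y^+)Z^-,W^-)-\tfrac12K^{ab}\,d\xi_a^+(X^+,Y^+)\,d\xi_b^-(Z^-,W^-)\\&+T^{ab}\big[(Z^-,\nabla^-_{Y^+}V_a^-)(W^-,\nabla^-_{X^+}V_b^-)-(Z^-,\nabla^-_{X^+}V_a^-)(W^-,\nabla^-_{Y^+}V_b^-)\big].\end{aligned}$$ -/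

import Mathlib

open scoped Manifold ContDiff Bundle

noncomputable section

namespace BismutReduction

/-! ### Vector fields, metric duals and the Bismut connections -/

section Geometry

variable {E : Type*} [NormedAddCommGroup E] [NormedSpace ℝ E]
  {M : Type*} [TopologicalSpace M] [ChartedSpace E M]

/-- Vector fields on `M` (no smoothness built in). -/
abbrev VectorFields (E : Type*) [NormedAddCommGroup E] [NormedSpace ℝ E]
    (M : Type*) [TopologicalSpace M] [ChartedSpace E M] : Type _ :=
  (x : M) → TangentSpace 𝓘(ℝ, E) x

/-- Smoothness of a vector field, as a section of the tangent bundle. -/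
def IsSmoothField [IsManifold 𝓘(ℝ, E) ∞ M] (X : VectorFields E M) : Prop :=
  ContMDiff 𝓘(ℝ, E) (𝓘(ℝ, E).prod 𝓘(ℝ, E)) ∞
    (fun x : M => Bundle.TotalSpace.mk' E (E := (TangentSpace 𝓘(ℝ, E) : M → Type _)) x (X x))

/-- Smoothness of a vector field at a point. -/
def IsSmoothFieldAt [IsManifold 𝓘(ℝ, E) ∞ M] (X : VectorFields E M) (x : M) : Prop :=
  ContMDiffAt 𝓘(ℝ, E) (𝓘(ℝ, E).prod 𝓘(ℝ, E)) ∞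
    (fun y : M => Bundle.TotalSpace.mk' E (E := (TangentSpace 𝓘(ℝ, E) : M → Type _)) y (X y)) x

/-- An extension of a tangent vector `u` at `x` to a vector field that is smooth near `x`. The
expressions below that use it depend on the extension only through its value at `x`. -/
def ext [IsManifold 𝓘(ℝ, E) 1 M] {x : M} (u : TangentSpace 𝓘(ℝ, E) x) : VectorFields E M :=
  FiberBundle.extend E (E := (TangentSpace 𝓘(ℝ, E) : M → Type _)) u

/-- The metric dual `g⁻¹ α` of a covector `α`: the vector `u` with `g(u, w) = α(w)` for all `w`. -/
def sharp {x : M} (h : TangentSpace 𝓘(ℝ, E) x → TangentSpace 𝓘(ℝ, E) x → ℝ)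
    (α : TangentSpace 𝓘(ℝ, E) x → ℝ) : TangentSpace 𝓘(ℝ, E) x :=
  Classical.epsilon fun u => ∀ w, h u w = α w

/-- The right-hand side of the Koszul formula for `g(∇_X Y, Z)`, `∇` the Levi-Civita connection. -/
def koszul (h : (x : M) → TangentSpace 𝓘(ℝ, E) x → TangentSpace 𝓘(ℝ, E) x → ℝ)
    (X Y Z : VectorFields E M) (x : M) : ℝ :=
  (1 / 2) *
    (mvfderiv 𝓘(ℝ, E) (fun y => h y (Y y) (Z y)) x (X x)
      + mvfderiv 𝓘(ℝ, E) (fun y => h y (X y) (Z y)) x (Y x)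
      - mvfderiv 𝓘(ℝ, E) (fun y => h y (X y) (Y y)) x (Z x)
      + h x (VectorField.mlieBracket 𝓘(ℝ, E) X Y x) (Z x)
      - h x (VectorField.mlieBracket 𝓘(ℝ, E) X Z x) (Y x)
      - h x (VectorField.mlieBracket 𝓘(ℝ, E) Y Z x) (X x))

/-- The Levi-Civita derivative `∇_X Y` of the metric `h`, by the Koszul formula. -/
def leviCivita [IsManifold 𝓘(ℝ, E) 1 M]
    (h : (x : M) → TangentSpace 𝓘(ℝ, E) x → TangentSpace 𝓘(ℝ, E) x → ℝ)
    (X Y : VectorFields E M) : VectorFields E M :=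
  fun x => sharp (h x) fun w => koszul h X Y (ext w) x

/-- The Bismut connections `∇^± = ∇ ± ½ g⁻¹ H` of `(h, H)`: for the sign `s = ± 1`, the vector
field `∇_X Y + (s/2) h⁻¹ H(X, Y, ·)`. -/
def bismut [IsManifold 𝓘(ℝ, E) 1 M] (s : ℝ)
    (h : (x : M) → TangentSpace 𝓘(ℝ, E) x → TangentSpace 𝓘(ℝ, E) x → ℝ)
    (H : (x : M) → TangentSpace 𝓘(ℝ, E) x → TangentSpace 𝓘(ℝ, E) x → TangentSpace 𝓘(ℝ, E) x → ℝ)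
    (X Y : VectorFields E M) : VectorFields E M :=
  fun x => leviCivita h X Y x + (s / 2) • sharp (h x) fun w => H x (X x) (Y x) w

/-- The curvature `R(X, Y)Z = D_X D_Y Z - D_Y D_X Z - D_{[X,Y]} Z` of a connection `D`. -/
def curvature (D : VectorFields E M → VectorFields E M → VectorFields E M)
    (X Y Z : VectorFields E M) : VectorFields E M :=
  fun x => D X (D Y Z) x - D Y (D X Z) x - D (VectorField.mlieBracket 𝓘(ℝ, E) X Y) Z x

/-! ### Differential forms -/

/-- Exterior derivative of a one-form, `dα(X,Y) = X α(Y) - Y α(X) - α([X,Y])`. -/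
def extD1 [IsManifold 𝓘(ℝ, E) 1 M] (α : (x : M) → TangentSpace 𝓘(ℝ, E) x → ℝ) (x : M)
    (u v : TangentSpace 𝓘(ℝ, E) x) : ℝ :=
  mvfderiv 𝓘(ℝ, E) (fun y => α y (ext v y)) x u
    - mvfderiv 𝓘(ℝ, E) (fun y => α y (ext u y)) x v
    - α x (VectorField.mlieBracket 𝓘(ℝ, E) (ext u) (ext v) x)

/-- Exterior derivative of a three-form,
`dη(X₀,…,X₃) = ∑ᵢ (-1)ⁱ Xᵢ η(…,X̂ᵢ,…) + ∑_{i<j} (-1)^{i+j} η([Xᵢ,Xⱼ],…,X̂ᵢ,…,X̂ⱼ,…)`. -/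
def extD3 [IsManifold 𝓘(ℝ, E) 1 M]
    (η : (x : M) → TangentSpace 𝓘(ℝ, E) x → TangentSpace 𝓘(ℝ, E) x → TangentSpace 𝓘(ℝ, E) x → ℝ)
    (x : M) (u₀ u₁ u₂ u₃ : TangentSpace 𝓘(ℝ, E) x) : ℝ :=
  mvfderiv 𝓘(ℝ, E) (fun y => η y (ext u₁ y) (ext u₂ y) (ext u₃ y)) x u₀
    - mvfderiv 𝓘(ℝ, E) (fun y => η y (ext u₀ y) (ext u₂ y) (ext u₃ y)) x u₁
    + mvfderiv 𝓘(ℝ, E) (fun y => η y (ext u₀ y) (ext u₁ y) (ext u₃ y)) x u₂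
    - mvfderiv 𝓘(ℝ, E) (fun y => η y (ext u₀ y) (ext u₁ y) (ext u₂ y)) x u₃
    - η x (VectorField.mlieBracket 𝓘(ℝ, E) (ext u₀) (ext u₁) x) u₂ u₃
    + η x (VectorField.mlieBracket 𝓘(ℝ, E) (ext u₀) (ext u₂) x) u₁ u₃
    - η x (VectorField.mlieBracket 𝓘(ℝ, E) (ext u₀) (ext u₃) x) u₁ u₂
    - η x (VectorField.mlieBracket 𝓘(ℝ, E) (ext u₁) (ext u₂) x) u₀ u₃
    + η x (VectorField.mlieBracket 𝓘(ℝ, E) (ext u₁) (ext u₃) x) u₀ u₂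
    - η x (VectorField.mlieBracket 𝓘(ℝ, E) (ext u₂) (ext u₃) x) u₀ u₁

/-- Smooth differential three-forms on `M`: skew-symmetric trilinear forms on the tangent spaces
whose values on (locally defined) smooth vector fields are smooth functions. -/
structure ThreeForm (E : Type*) [NormedAddCommGroup E] [NormedSpace ℝ E]
    (M : Type*) [TopologicalSpace M] [ChartedSpace E M] [IsManifold 𝓘(ℝ, E) ∞ M] where
  /-- the trilinear form on each tangent space -/
  toFun (x : M) : TangentSpace 𝓘(ℝ, E) x →L[ℝ] TangentSpace 𝓘(ℝ, E) x →L[ℝ]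
    TangentSpace 𝓘(ℝ, E) x →L[ℝ] ℝ
  skew_left (x : M) (u v w : TangentSpace 𝓘(ℝ, E) x) : toFun x u v w = - toFun x v u w
  skew_right (x : M) (u v w : TangentSpace 𝓘(ℝ, E) x) : toFun x u v w = - toFun x u w v
  smooth (x : M) (U V W : VectorFields E M) (hU : IsSmoothFieldAt U x) (hV : IsSmoothFieldAt V x)
    (hW : IsSmoothFieldAt W x) :
    ContMDiffAt 𝓘(ℝ, E) 𝓘(ℝ, ℝ) ∞ (fun y : M => toFun y (U y) (V y) (W y)) x

/-- A three-form as a function of three tangent vectors. -/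
def ThreeForm.eval [IsManifold 𝓘(ℝ, E) ∞ M] (H : ThreeForm E M) (x : M)
    (u v w : TangentSpace 𝓘(ℝ, E) x) : ℝ := H.toFun x u v w

/-- Smooth Riemannian metrics on `M`. -/
abbrev Metric (E : Type*) [NormedAddCommGroup E] [NormedSpace ℝ E]
    (M : Type*) [TopologicalSpace M] [ChartedSpace E M] [IsManifold 𝓘(ℝ, E) ∞ M] : Type _ :=
  Bundle.ContMDiffRiemannianMetric 𝓘(ℝ, E) ∞ E (TangentSpace 𝓘(ℝ, E) : M → Type _)

/-- A metric as a function of two tangent vectors. -/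
def pair [IsManifold 𝓘(ℝ, E) ∞ M] (g : Metric E M) (x : M) (u v : TangentSpace 𝓘(ℝ, E) x) : ℝ :=
  g.inner x u v

/-! ### The generalized tangent bundle -/

/-- Sections `X + α` of `TM ⊕ T*M`. -/
abbrev GenSection (E : Type*) [NormedAddCommGroup E] [NormedSpace ℝ E]
    (M : Type*) [TopologicalSpace M] [ChartedSpace E M] : Type _ :=
  VectorFields E M × ((x : M) → TangentSpace 𝓘(ℝ, E) x → ℝ)

/-- The natural pairing `⟨X + α, Y + β⟩ = α(Y) + β(X)`. -/
def genPairing (A B : GenSection E M) (x : M) : ℝ := A.2 x (B.1 x) + B.2 x (A.1 x)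

/-- The Lie derivative of a one-form, `(L_X β)(Z) = X (β(Z)) - β([X, Z])`. -/
def lieD1 [IsManifold 𝓘(ℝ, E) 1 M] (X : VectorFields E M)
    (β : (x : M) → TangentSpace 𝓘(ℝ, E) x → ℝ) (x : M) (w : TangentSpace 𝓘(ℝ, E) x) : ℝ :=
  mvfderiv 𝓘(ℝ, E) (fun y => β y (ext w y)) x (X x)
    - β x (VectorField.mlieBracket 𝓘(ℝ, E) X (ext w) x)

/-- The `H`-twisted Courant bracket
`[X + α, Y + β]_H = [X, Y] + L_X β - ι_Y dα + ι_Y ι_X H`. -/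
def courant [IsManifold 𝓘(ℝ, E) 1 M]
    (H : (x : M) → TangentSpace 𝓘(ℝ, E) x → TangentSpace 𝓘(ℝ, E) x → TangentSpace 𝓘(ℝ, E) x → ℝ)
    (A B : GenSection E M) : GenSection E M :=
  (VectorField.mlieBracket 𝓘(ℝ, E) A.1 B.1,
    fun x w => lieD1 A.1 B.2 x w - extD1 A.2 x (B.1 x) w + H x (A.1 x) (B.1 x) w)

end Geometry

/-! ### Group actions, equivariant forms and horizontal distributions -/

section Action

variable {EG : Type*} [NormedAddCommGroup EG] [NormedSpace ℝ EG]
  {G : Type*} [TopologicalSpace G] [ChartedSpace EG G] [Group G]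
  {E : Type*} [NormedAddCommGroup E] [NormedSpace ℝ E]
  {M : Type*} [TopologicalSpace M] [ChartedSpace E M] [MulAction G M]

/-- The differential at `x` of the action of `a` on `M`. -/
def actD (a : G) (x : M) : TangentSpace 𝓘(ℝ, E) x →L[ℝ] TangentSpace 𝓘(ℝ, E) (a • x) :=
  mfderiv 𝓘(ℝ, E) 𝓘(ℝ, E) (fun y : M => a • y) x

/-- The fundamental vector field of `v ∈ 𝔤`: the derivative at `1` of `a ↦ a • x`, applied to
`v`. -/
def fund (v : GroupLieAlgebra 𝓘(ℝ, EG) G) : VectorFields E M :=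
  fun x => (mfderiv 𝓘(ℝ, EG) 𝓘(ℝ, E) (fun a : G => a • x) (1 : G) v : E)

/-- The adjoint representation: the derivative at `1` of `b ↦ a b a⁻¹`. -/
def adj (a : G) (v : GroupLieAlgebra 𝓘(ℝ, EG) G) : GroupLieAlgebra 𝓘(ℝ, EG) G :=
  (mfderiv 𝓘(ℝ, EG) 𝓘(ℝ, EG) (fun b : G => a * b * a⁻¹) (1 : G) v : EG)

variable [IsManifold 𝓘(ℝ, E) ∞ M]

/-- Invariance of a metric. -/
def InvariantMetric (G : Type*) [Group G] [MulAction G M] (g : Metric E M) : Prop :=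
  ∀ (a : G) (x : M) (u v : TangentSpace 𝓘(ℝ, E) x),
    pair g (a • x) (actD a x u) (actD a x v) = pair g x u v

/-- Invariance of a three-form. -/
def InvariantThreeForm (G : Type*) [Group G] [MulAction G M] (H : ThreeForm E M) : Prop :=
  ∀ (a : G) (x : M) (u v w : TangentSpace 𝓘(ℝ, E) x),
    H.eval (a • x) (actD a x u) (actD a x v) (actD a x w) = H.eval x u v w

/-- Equivariant one-forms `ξ : 𝔤 → Ω¹(M)`: linear maps into the smooth one-forms which intertwine
the adjoint action and the push-forward of forms. -/
structure EquivariantOneForm (EG : Type*) [NormedAddCommGroup EG] [NormedSpace ℝ EG]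
    (G : Type*) [TopologicalSpace G] [ChartedSpace EG G] [Group G]
    (E : Type*) [NormedAddCommGroup E] [NormedSpace ℝ E]
    (M : Type*) [TopologicalSpace M] [ChartedSpace E M] [MulAction G M]
    [IsManifold 𝓘(ℝ, E) ∞ M] where
  /-- the linear map `v ↦ ξ_v` -/
  toLin : GroupLieAlgebra 𝓘(ℝ, EG) G →ₗ[ℝ] ((x : M) → TangentSpace 𝓘(ℝ, E) x →L[ℝ] ℝ)
  smooth (v : GroupLieAlgebra 𝓘(ℝ, EG) G) (x : M) (U : VectorFields E M)
    (hU : IsSmoothFieldAt U x) :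
    ContMDiffAt 𝓘(ℝ, E) 𝓘(ℝ, ℝ) ∞ (fun y : M => toLin v y (U y)) x
  equivariant (a : G) (v : GroupLieAlgebra 𝓘(ℝ, EG) G) (x : M) (u : TangentSpace 𝓘(ℝ, E) x) :
    toLin (adj a v) (a • x) (actD a x u) = toLin v x u

/-- The value `ξ_v(u)`. -/
def EquivariantOneForm.eval (ξ : EquivariantOneForm EG G E M) (v : GroupLieAlgebra 𝓘(ℝ, EG) G)
    (x : M) (u : TangentSpace 𝓘(ℝ, E) x) : ℝ := ξ.toLin v x u

/-- `H + φ^a ξ_a` is equivariantly closed. In the Cartan model it is the polynomial map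
`v ↦ H + ξ_v` on `𝔤`, the differential is `(d_φ α)(v) = d(α(v)) - ι_{V_v} α(v)`, and
the three fields are the components of degrees 4, 2 and 0 of `d_φ(H + φ^a ξ_a) = 0`. After
polarization the last one says that `ξ_a(V_b) + ξ_b(V_a) = 0`, i.e. that the action extended
by `V_a + ξ_a` is isotropic. -/
structure EquivariantlyClosed (H : ThreeForm E M) (ξ : EquivariantOneForm EG G E M) : Prop where
  closed (x : M) (u₀ u₁ u₂ u₃ : TangentSpace 𝓘(ℝ, E) x) : extD3 H.eval x u₀ u₁ u₂ u₃ = 0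
  moment (v : GroupLieAlgebra 𝓘(ℝ, EG) G) (x : M) (u w : TangentSpace 𝓘(ℝ, E) x) :
    extD1 (ξ.eval v) x u w = H.eval x (fund v x) u w
  isotropic (v : GroupLieAlgebra 𝓘(ℝ, EG) G) (x : M) : ξ.eval v x (fund v x) = 0

/-- The vector fields `V_v^± = V_v ± g⁻¹ ξ_v`, for `s = ± 1`. -/
def fundPM (s : ℝ) (g : Metric E M) (ξ : EquivariantOneForm EG G E M)
    (v : GroupLieAlgebra 𝓘(ℝ, EG) G) : VectorFields E M :=
  fun x => fund v x + s • sharp (pair g x) (ξ.eval v x)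

/-- The one-forms `ξ_v^± = g(V_v^±)`. -/
def xiPM (s : ℝ) (g : Metric E M) (ξ : EquivariantOneForm EG G E M)
    (v : GroupLieAlgebra 𝓘(ℝ, EG) G) (x : M) (w : TangentSpace 𝓘(ℝ, E) x) : ℝ :=
  pair g x (fundPM s g ξ v x) w

/-- The distributions `τ_± = {Y | g(Y, V_v) ± ξ_v(Y) = 0 for all v ∈ 𝔤}`, for `s = ± 1`. -/
def tau (s : ℝ) (g : Metric E M) (ξ : EquivariantOneForm EG G E M) (x : M) :
    Set (TangentSpace 𝓘(ℝ, E) x) :=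
  {w | ∀ v : GroupLieAlgebra 𝓘(ℝ, EG) G, pair g x w (fund v x) + s * ξ.eval v x w = 0}

/-- `K_{ab} = g(V_a, V_b) - ξ_a(V_b)`. -/
def matK {ι : Type*} (g : Metric E M) (ξ : EquivariantOneForm EG G E M)
    (e : ι → GroupLieAlgebra 𝓘(ℝ, EG) G) (x : M) : Matrix ι ι ℝ :=
  Matrix.of fun a b => pair g x (fund (e a) x) (fund (e b) x) - ξ.eval (e a) x (fund (e b) x)

/-- `T_{ab} = g(V_a^-, V_b^-)`. -/
def matT {ι : Type*} (g : Metric E M) (ξ : EquivariantOneForm EG G E M)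
    (e : ι → GroupLieAlgebra 𝓘(ℝ, EG) G) (x : M) : Matrix ι ι ℝ :=
  Matrix.of fun a b => pair g x (fundPM (-1) g ξ (e a) x) (fundPM (-1) g ξ (e b) x)

/-! ### Reduction to the orbit space -/

variable {F : Type*} [NormedAddCommGroup F] [NormedSpace ℝ F]

/-- The orbit space `M/G`. -/
abbrev Orb (G M : Type*) [Group G] [MulAction G M] : Type _ := MulAction.orbitRel.Quotient G M

/-- The projection `M → M/G`. -/
def proj (G : Type*) {M : Type*} [Group G] [MulAction G M] (x : M) : Orb G M :=
  Quotient.mk (MulAction.orbitRel G M) x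

variable [ChartedSpace F (Orb G M)]

/-- The horizontal lift in `τ_±` of a vector field on `M/G`, for `s = ± 1`: its value at `x` is the
vector in `τ_±` that projects to the given one at the orbit of `x`. -/
def hlift (s : ℝ) (g : Metric E M) (ξ : EquivariantOneForm EG G E M)
    (X : VectorFields F (Orb G M)) : VectorFields E M :=
  fun x => Classical.epsilon fun w : TangentSpace 𝓘(ℝ, E) x =>
    w ∈ tau s g ξ x ∧ mfderiv 𝓘(ℝ, E) 𝓘(ℝ, F) (proj G : M → Orb G M) x w = X (proj G x)

variable [IsManifold 𝓘(ℝ, F) ∞ (Orb G M)]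

/-- The reduced metric: the restriction of `g` to `τ_+`, read at a point of the orbit. -/
def redMetric (g : Metric E M) (ξ : EquivariantOneForm EG G E M) (b : Orb G M)
    (u v : TangentSpace 𝓘(ℝ, F) b) : ℝ :=
  pair g b.out (hlift 1 g ξ (ext u) b.out) (hlift 1 g ξ (ext v) b.out)

/-- Let `K ⊂ TM ⊕ T*M` be spanned by the `V_v + ξ_v`. The sections of `K^⊥/K` over `M/G` are
identified with the invariant sections of `K^𝒢 ⊂ K^⊥`, the orthogonal complement of `K` in `K^⊥`
with respect to the generalized metric. There the `± 1` eigensections over `X` are `X⁺ + g(X⁺)`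
and `X⁻ - g(X⁻)`, with `X^±` the lift to `τ_±`. The metric splitting maps `X` to half their sum. -/
def redSplitting (g : Metric E M) (ξ : EquivariantOneForm EG G E M)
    (X : VectorFields F (Orb G M)) : GenSection E M :=
  (fun x => (1 / 2 : ℝ) • (hlift 1 g ξ X x + hlift (-1) g ξ X x),
    fun x w => (1 / 2) * (pair g x (hlift 1 g ξ X x) w - pair g x (hlift (-1) g ξ X x) w))

/-- The reduced flux `H̃(X, Y, Z) = ⟨[s X, s Y], s Z⟩`: the curvature of the metric splitting `s`
of the reduced Courant algebroid, whose bracket and pairing are computed with invariant lifts to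
`TM ⊕ T*M`, read at a point of the orbit. -/
def redFlux (g : Metric E M) (H : ThreeForm E M) (ξ : EquivariantOneForm EG G E M) (b : Orb G M)
    (u v w : TangentSpace 𝓘(ℝ, F) b) : ℝ :=
  genPairing (courant H.eval (redSplitting g ξ (ext u)) (redSplitting g ξ (ext v)))
    (redSplitting g ξ (ext w)) b.out

/-- The `-`-Bismut connection of the reduced metric and flux on `M/G`. -/
def redBismut (g : Metric E M) (H : ThreeForm E M) (ξ : EquivariantOneForm EG G E M)
    (X Y : VectorFields F (Orb G M)) : VectorFields F (Orb G M) :=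
  bismut (-1) (redMetric g ξ) (redFlux g H ξ) X Y

end Action

end BismutReduction

end

set_option linter.unusedSectionVars false

/-! The reduced connection is a compression of the connection upstairs: `g̃(∇̃_X Y, Z) ∘ π =
(∇⁻_{X⁺} Y⁻, Z⁻)` (`redMetric_redBismut`). Directions are lifted to `τ_+`, and the differentiated
fields are lifted to `τ_-`. The curvature formula then follows from a submersion computation in the
style of O'Neill.

The identity comes from the function `⟨[A, B]_H, C⟩` (`courantForm`). On `X⁺ + g(X⁺)`, `Y⁻ - g(Y⁻)`,
`Z⁻ - g(Z⁻)` the Koszul formula gives `-2 (∇⁻_{X⁺} Y⁻, Z⁻)` (`courantForm_genLift`). Modulo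
combinations of the `V_a + ξ_a` these sections are `X̂ + π*g̃(X)`, `Ŷ - π*g̃(Y)`, `Ẑ - π*g̃(Z)`
(`genLift_one_eq`, `genLift_neg_one_eq`). Such combinations do not matter for invariant sections
orthogonal to the `V_a + ξ_a`, because `dξ_a = ι_{V_a} H` (`courantForm_add_vertical`). On the
latter triple the function equals `H̃` minus twice the Koszul expression of `g̃`, that is `-2
g̃(∇̃_X Y, Z)` (`courantForm_redSplitting`).

In the curvature, `(∇̃_Y Z)⁻` is the orthogonal projection to `τ_-` of `∇⁻_{Y⁺} Z⁻`. The discarded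
part is a combination of the `V_a⁻`, and metric compatibility, used twice, moves the derivatives
onto `V_a⁻` and `V_b⁻`; this gives the `T` terms (`pair_bismut_hlift_redBismut`). The lift of `[X,
Y]` differs from `[X⁺, Y⁺]` by a vertical vector, whose coordinates are found by inverting `K`.
Along a fundamental field, `∇⁻` of a lift `Z⁻`, paired with `W⁻`, is half of `dξ⁻(Z⁻, W⁻)`; this
gives the `K` term (`pair_bismut_hlift_mlieBracket`).

All of this rests on the splitting of `TM` into `τ_±` and the vertical bundle, with smooth invariant
lifts. The kernel of `dπ` is vertical by a dimension count: a free action is infinitesimally free,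
and the fibres of `π` have at most the dimension of `G`. Isotropy gives `g(V_v^±, V_v) = |V_v|²`,
which is the source of every nondegeneracy statement. -/

namespace BismutReduction

/-! ### Derivations, charts and the Lie bracket. -/

section Calculus

open VectorField Topology Filter

variable {E : Type*} [NormedAddCommGroup E] [NormedSpace ℝ E]
  {M : Type*} [TopologicalSpace M] [ChartedSpace E M]
  {V : Type*} [NormedAddCommGroup V] [NormedSpace ℝ V]

/-- Differentiating along a Lie bracket, in a vector space. -/
lemma fderiv_lieBracket {f : E → V} {X Y : E → E} {z : E} (hf : ContDiffAt ℝ 2 f z)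
    (hX : DifferentiableAt ℝ X z) (hY : DifferentiableAt ℝ Y z) :
    fderiv ℝ f z (lieBracket ℝ X Y z)
      = fderiv ℝ (fun y => fderiv ℝ f y (Y y)) z (X z)
        - fderiv ℝ (fun y => fderiv ℝ f y (X y)) z (Y z) := by
  have h1 : DifferentiableAt ℝ (fderiv ℝ f) z :=
    (hf.fderiv_right (m := 1) (by norm_num)).differentiableAt (by norm_num)
  have hs : IsSymmSndFDerivAt ℝ f z := hf.isSymmSndFDerivAt (by simp)
  rw [fderiv_clm_apply h1 hY, fderiv_clm_apply h1 hX]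
  simp only [lieBracket, map_sub, add_apply, ContinuousLinearMap.comp_apply,
    ContinuousLinearMap.flip_apply]
  rw [hs.eq (X z) (Y z)]
  abel

lemma mvfderiv_congr {f f' : M → V} {x : M} (h : f =ᶠ[𝓝 x] f') :
    mvfderiv 𝓘(ℝ, E) f x = mvfderiv 𝓘(ℝ, E) f' x := by
  ext u
  change (mfderiv 𝓘(ℝ, E) 𝓘(ℝ, V) f x u : V) = mfderiv 𝓘(ℝ, E) 𝓘(ℝ, V) f' x u
  rw [h.mfderiv_eq]
  rfl

/-- The chain rule for `mvfderiv`, for maps between manifolds. -/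
lemma mvfderiv_comp_vector {E' : Type*} [NormedAddCommGroup E'] [NormedSpace ℝ E']
    {N : Type*} [TopologicalSpace N] [ChartedSpace E' N] {f : M → N} {q : N → V} {x : M}
    (hq : MDifferentiableAt 𝓘(ℝ, E') 𝓘(ℝ, V) q (f x))
    (hf : MDifferentiableAt 𝓘(ℝ, E) 𝓘(ℝ, E') f x) (u : TangentSpace 𝓘(ℝ, E) x) :
    mvfderiv 𝓘(ℝ, E) (fun y => q (f y)) x u
      = mvfderiv 𝓘(ℝ, E') q (f x) (mfderiv 𝓘(ℝ, E) 𝓘(ℝ, E') f x u) :=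
  mfderiv_comp_apply x hq hf u

lemma mvfderiv_comp_fderiv {E' : Type*} [NormedAddCommGroup E'] [NormedSpace ℝ E']
    {f : M → E'} {q : E' → V} {x : M}
    (hq : DifferentiableAt ℝ q (f x))
    (hf : MDifferentiableAt 𝓘(ℝ, E) 𝓘(ℝ, E') f x) (u : TangentSpace 𝓘(ℝ, E) x) :
    mvfderiv 𝓘(ℝ, E) (fun y => q (f y)) x u
      = fderiv ℝ q (f x) (mvfderiv 𝓘(ℝ, E) f x u) := by
  rw [mvfderiv_comp_vector (E' := E') (q := q) hq.mdifferentiableAt hf]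
  change (mfderiv 𝓘(ℝ, E') 𝓘(ℝ, V) q (f x) _ : V) = _
  rw [mfderiv_eq_fderiv]
  rfl

/-- A vector field read in the chart at `x`. -/
noncomputable def chartField (X : VectorFields E M) (x : M) : E → E := fun z =>
  (mpullback 𝓘(ℝ, E) 𝓘(ℝ, E) (extChartAt 𝓘(ℝ, E) x).symm X z : TangentSpace 𝓘(ℝ, E) z)

lemma contDiffAt_comp_chart {n : ℕ∞} {f : M → V} {x : M} (hf : ContMDiffAt 𝓘(ℝ, E) 𝓘(ℝ, V) n f x) :
    ContDiffAt ℝ n (f ∘ (extChartAt 𝓘(ℝ, E) x).symm) (extChartAt 𝓘(ℝ, E) x x) := by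
  have := (contMDiffAt_iff.1 hf).2
  simp only [modelWithCornersSelf_coe, Set.range_id, extChartAt_model_space_eq_id] at this
  exact contDiffWithinAt_univ.1 this

variable [IsManifold 𝓘(ℝ, E) ∞ M]

/-- An equality of germs is needed, not only of values at `x`, because both sides are differentiated
once more. -/
lemma mvfderiv_field_eq_comp_chart {f : M → V} {x : M} (hf : ContMDiffAt 𝓘(ℝ, E) 𝓘(ℝ, V) 2 f x)
    (Y : VectorFields E M) :
    (fun y => mvfderiv 𝓘(ℝ, E) f y (Y y)) =ᶠ[𝓝 x] fun y =>
      fderiv ℝ (f ∘ (extChartAt 𝓘(ℝ, E) x).symm) (extChartAt 𝓘(ℝ, E) x y)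
        (chartField Y x (extChartAt 𝓘(ℝ, E) x y)) := by
  have h1 : ∀ᶠ y in 𝓝 x, MDifferentiableAt 𝓘(ℝ, E) 𝓘(ℝ, V) f y := by
    filter_upwards [(contMDiffAt_iff_contMDiffAt_nhds (by simp)).1 hf] with y hy
    exact ContMDiffAt.mdifferentiableAt hy (by simp)
  filter_upwards [h1, extChartAt_source_mem_nhds (I := 𝓘(ℝ, E)) x] with y hy hys
  rw [chartField]
  set φ := extChartAt 𝓘(ℝ, E) x
  have hyt : φ y ∈ φ.target := φ.map_source hys
  have hl : φ.symm (φ y) = y := φ.left_inv hys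
  have hinv := isInvertible_mfderivWithin_extChartAt_symm (I := 𝓘(ℝ, E)) hyt
  rw [modelWithCornersSelf_coe, Set.range_id, mfderivWithin_univ] at hinv
  have hd : MDifferentiableAt 𝓘(ℝ, E) 𝓘(ℝ, E) φ.symm (φ y) := by
    have := mdifferentiableWithinAt_extChartAt_symm (I := 𝓘(ℝ, E)) hyt
    rwa [modelWithCornersSelf_coe, Set.range_id, mdifferentiableWithinAt_univ] at this
  have hy' : MDifferentiableAt 𝓘(ℝ, E) 𝓘(ℝ, V) f (φ.symm (φ y)) := by rwa [hl]
  rw [← mfderiv_eq_fderiv, mfderiv_comp (φ y) hy' hd]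
  rw [mpullback_apply]
  -- The points `φ.symm (φ y)` and `y` agree only propositionally, so their tangent spaces are
  -- different types; generalizing the point allows the transport.
  have key : ∀ w : M, w = y → (mvfderiv 𝓘(ℝ, E) f y (Y y) : V) =
     mfderiv 𝓘(ℝ, E) 𝓘(ℝ, V) f w (Y w) := by
    rintro w rfl; rfl
  rw [key _ hl]
  obtain ⟨e, he⟩ := hinv
  change _ = mfderiv 𝓘(ℝ, E) 𝓘(ℝ, V) f (φ.symm (φ y)) (mfderiv 𝓘(ℝ, E) 𝓘(ℝ, E) φ.symm (φ y) _)
  rw [← he, ContinuousLinearMap.inverse_equiv]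
  congr 1
  exact (e.apply_symm_apply _).symm

/-- The tangent space at `x` is identified with `E` by the preferred chart at `x`, so this chart has
identity derivative at its centre. Derivation identities applied to the chart itself therefore
become identities between vectors. -/
lemma mvfderiv_chart (x : M) (u : TangentSpace 𝓘(ℝ, E) x) :
    mvfderiv 𝓘(ℝ, E) (extChartAt 𝓘(ℝ, E) x) x u = u := by
  change (mfderiv 𝓘(ℝ, E) 𝓘(ℝ, E) (extChartAt 𝓘(ℝ, E) x) x u : E) = u
  have h := mfderivWithin_extChartAt_symm_comp_mfderiv_extChartAt' (I := 𝓘(ℝ, E))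
    (mem_extChartAt_source x)
  rw [mfderivWithin_range_extChartAt_symm] at h
  exact DFunLike.congr_fun h u

lemma chartField_self (X : VectorFields E M) (x : M) :
    chartField X x (extChartAt 𝓘(ℝ, E) x x) = X x := by
  have h := mfderivWithin_range_extChartAt_symm (I := 𝓘(ℝ, E)) (x := x)
  rw [modelWithCornersSelf_coe, Set.range_id, mfderivWithin_univ] at h
  rw [chartField, mpullback_apply, h]
  refine (DFunLike.congr_fun (ContinuousLinearMap.inverse_id (R := ℝ) (M := E)) _).trans ?_
  have key : ∀ w : M, w = x → (X w : E) = X x := by rintro w rfl; rfl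
  exact key _ (extChartAt_to_inv x)

lemma chart_mlieBracket (X Y : VectorFields E M) (x : M) :
    lieBracket ℝ (chartField X x) (chartField Y x) (extChartAt 𝓘(ℝ, E) x x)
      = mlieBracket 𝓘(ℝ, E) X Y x := by
  refine Eq.trans (Eq.symm ?_) (mvfderiv_chart x (mlieBracket 𝓘(ℝ, E) X Y x))
  change (mfderiv 𝓘(ℝ, E) 𝓘(ℝ, E) (extChartAt 𝓘(ℝ, E) x) x (mlieBracket 𝓘(ℝ, E) X Y x) : E) = _
  rw [← mlieBracketWithin_univ, mlieBracketWithin_apply]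
  simp only [modelWithCornersSelf_coe, Set.range_id, Set.preimage_univ, Set.inter_univ,
    mpullbackWithin_univ]
  obtain ⟨e, he⟩ := isInvertible_mfderiv_extChartAt (I := 𝓘(ℝ, E)) (mem_extChartAt_source x)
  rw [← he, ContinuousLinearMap.inverse_equiv]
  refine (e.apply_symm_apply _).trans ?_
  exact congrFun (lieBracketWithin_univ (E := E) (V := chartField X x) (W := chartField Y x)) _

variable [CompleteSpace E]

lemma differentiableAt_chartField {Y : VectorFields E M} {x : M}
    (hY : MDifferentiableAt 𝓘(ℝ, E) (𝓘(ℝ, E).prod 𝓘(ℝ, E)) (T% Y) x) :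
    DifferentiableAt ℝ (chartField Y x) (extChartAt 𝓘(ℝ, E) x x) := by
  have := (mdifferentiableWithinAt_univ.2 hY).differentiableWithinAt_mpullbackWithin_vectorField
  simp only [modelWithCornersSelf_coe, Set.range_id, Set.preimage_univ, Set.inter_univ,
    mpullbackWithin_univ] at this
  exact differentiableWithinAt_univ.1 this

/-- The function `Y f` is differentiable, with derivative computed in a chart. -/
lemma mdifferentiableAt_mvfderiv_apply {f : M → V} {x : M}
    (hf : ContMDiffAt 𝓘(ℝ, E) 𝓘(ℝ, V) 2 f x) {Y : VectorFields E M}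
    (hY : MDifferentiableAt 𝓘(ℝ, E) (𝓘(ℝ, E).prod 𝓘(ℝ, E)) (T% Y) x) :
    MDifferentiableAt 𝓘(ℝ, E) 𝓘(ℝ, V) (fun y => mvfderiv 𝓘(ℝ, E) f y (Y y)) x ∧
    ∀ u : TangentSpace 𝓘(ℝ, E) x, mvfderiv 𝓘(ℝ, E) (fun y => mvfderiv 𝓘(ℝ, E) f y (Y y)) x u =
      fderiv ℝ (fun z => fderiv ℝ (f ∘ (extChartAt 𝓘(ℝ, E) x).symm) z
        (chartField Y x z)) (extChartAt 𝓘(ℝ, E) x x) u := by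
  have h := mvfderiv_field_eq_comp_chart hf Y
  have h1 : DifferentiableAt ℝ (fderiv ℝ (f ∘ (extChartAt 𝓘(ℝ, E) x).symm))
      (extChartAt 𝓘(ℝ, E) x x) :=
    ((contDiffAt_comp_chart (n := 2) hf).fderiv_right (m := 1) (by norm_num)).differentiableAt
      (by norm_num)
  have h2 := h1.clm_apply (differentiableAt_chartField hY)
  have h3 : MDifferentiableAt 𝓘(ℝ, E) 𝓘(ℝ, E) (extChartAt 𝓘(ℝ, E) x) x :=
    mdifferentiableAt_extChartAt (mem_chart_source E x)
  refine ⟨(h2.mdifferentiableAt.comp x h3).congr_of_eventuallyEq h, fun u => ?_⟩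
  rw [mvfderiv_congr h]
  rw [mvfderiv_comp_vector (f := extChartAt 𝓘(ℝ, E) x) h2.mdifferentiableAt h3 u]
  change (mfderiv 𝓘(ℝ, E) 𝓘(ℝ, V) _ _ (mvfderiv 𝓘(ℝ, E) (extChartAt 𝓘(ℝ, E) x) x u) : V) = _
  rw [mfderiv_eq_fderiv, mvfderiv_chart]
  rfl

/-- Vector fields act on functions as derivations, and the bracket acts by the commutator. -/
lemma mvfderiv_mlieBracket {f : M → V} {x : M} (hf : ContMDiffAt 𝓘(ℝ, E) 𝓘(ℝ, V) 2 f x)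
    {X Y : VectorFields E M}
    (hX : MDifferentiableAt 𝓘(ℝ, E) (𝓘(ℝ, E).prod 𝓘(ℝ, E)) (T% X) x)
    (hY : MDifferentiableAt 𝓘(ℝ, E) (𝓘(ℝ, E).prod 𝓘(ℝ, E)) (T% Y) x) :
    mvfderiv 𝓘(ℝ, E) f x (mlieBracket 𝓘(ℝ, E) X Y x)
      = mvfderiv 𝓘(ℝ, E) (fun y => mvfderiv 𝓘(ℝ, E) f y (Y y)) x (X x)
        - mvfderiv 𝓘(ℝ, E) (fun y => mvfderiv 𝓘(ℝ, E) f y (X y)) x (Y x) := by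
  rw [(mdifferentiableAt_mvfderiv_apply hf hY).2, (mdifferentiableAt_mvfderiv_apply hf hX).2]
  have := fderiv_lieBracket (contDiffAt_comp_chart (n := 2) hf)
    (differentiableAt_chartField hX) (differentiableAt_chartField hY)
  rw [chartField_self, chartField_self, chart_mlieBracket] at this
  refine Eq.trans ?_ this
  have h0 := (mvfderiv_field_eq_comp_chart hf (mlieBracket 𝓘(ℝ, E) X Y)).self_of_nhds
  refine h0.trans ?_
  simp only [chartField_self]

end Calculus


/-! ### Smooth fields, linear systems with smooth coefficients, related fields, mixed partials. -/

section Fields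

open VectorField Topology Filter

variable {E : Type*} [NormedAddCommGroup E] [NormedSpace ℝ E]
  {M : Type*} [TopologicalSpace M] [ChartedSpace E M] [IsManifold 𝓘(ℝ, E) ∞ M]
  {V : Type*} [NormedAddCommGroup V] [NormedSpace ℝ V]

/-- Differentiability of a vector field at a point. -/
abbrev DiffFieldAt (X : VectorFields E M) (x : M) : Prop :=
  MDifferentiableAt 𝓘(ℝ, E) (𝓘(ℝ, E).prod 𝓘(ℝ, E)) (T% X) x

lemma IsSmoothFieldAt.diff {X : VectorFields E M} {x : M} (h : IsSmoothFieldAt X x) :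
    DiffFieldAt X x :=
  ContMDiffAt.mdifferentiableAt h (by simp)

lemma IsSmoothField.at {X : VectorFields E M} (h : IsSmoothField X) (x : M) :
    IsSmoothFieldAt X x := h x

lemma isSmoothFieldAt_ext {x : M} (u : TangentSpace 𝓘(ℝ, E) x) : IsSmoothFieldAt (ext u) x :=
  FiberBundle.contMDiffAt_extend 𝓘(ℝ, E) E u

lemma eventually_isSmoothFieldAt_ext {x : M} (u : TangentSpace 𝓘(ℝ, E) x) :
    ∀ᶠ y in 𝓝 x, IsSmoothFieldAt (ext u) y := by
  obtain ⟨s, hs, h⟩ := FiberBundle.exists_contMDiffOn_extend (k := ∞) 𝓘(ℝ, E) E u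
  filter_upwards [eventually_mem_nhds_iff.2 hs] with y hy
  exact h.contMDiffAt hy

@[simp] lemma ext_self {x : M} (u : TangentSpace 𝓘(ℝ, E) x) : ext u x = u :=
  FiberBundle.extend_apply_self E u

lemma IsSmoothFieldAt.add {X Y : VectorFields E M} {x : M} (hX : IsSmoothFieldAt X x)
    (hY : IsSmoothFieldAt Y x) : IsSmoothFieldAt (X + Y) x := ContMDiffAt.add_section hX hY

lemma IsSmoothFieldAt.smul {f : M → ℝ} {Y : VectorFields E M} {x : M}
    (hf : ContMDiffAt 𝓘(ℝ, E) 𝓘(ℝ, ℝ) ∞ f x)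
    (hY : IsSmoothFieldAt Y x) : IsSmoothFieldAt (f • Y) x := ContMDiffAt.smul_section hf hY

lemma IsSmoothFieldAt.const_smul (c : ℝ) {Y : VectorFields E M} {x : M}
    (hY : IsSmoothFieldAt Y x) : IsSmoothFieldAt (c • Y) x :=
  ContMDiffAt.smul_section (f := fun _ => c) contMDiffAt_const hY

lemma IsSmoothFieldAt.sum {ι : Type*} {s : Finset ι} {X : ι → VectorFields E M} {x : M}
    (hX : ∀ i ∈ s, IsSmoothFieldAt (X i) x) : IsSmoothFieldAt (fun y => ∑ i ∈ s, X i y) x :=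
  ContMDiffAt.sum_section hX

/-- The derivative of a smooth function along a smooth field is smooth. -/
lemma contMDiffAt_mvfderiv_apply {f : M → V} {x : M} (hf : ContMDiffAt 𝓘(ℝ, E) 𝓘(ℝ, V) ∞ f x)
    {X : VectorFields E M} (hX : IsSmoothFieldAt X x) :
    ContMDiffAt 𝓘(ℝ, E) 𝓘(ℝ, V) ∞ (fun y => mvfderiv 𝓘(ℝ, E) f y (X y)) x := by
  have h1 := ContMDiffAt.mfderiv_const (m := ∞) hf le_rfl
  have h2 := (Bundle.contMDiffAt_section x).1 hX
  refine (h1.clm_apply h2).congr_of_eventuallyEq ?_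
  have hb : ∀ᶠ y in 𝓝 x, y ∈ (trivializationAt E (TangentSpace 𝓘(ℝ, E)) x).baseSet :=
    (trivializationAt E (TangentSpace 𝓘(ℝ, E)) x).open_baseSet.mem_nhds
      (FiberBundle.mem_baseSet_trivializationAt' x)
  filter_upwards [hb] with y hy
  change _ = (trivializationAt V (TangentSpace 𝓘(ℝ, V)) (f x)).continuousLinearMapAt ℝ (f y)
    (mfderiv 𝓘(ℝ, E) 𝓘(ℝ, V) f y ((trivializationAt E (TangentSpace 𝓘(ℝ, E)) x).symmL ℝ y
      (trivializationAt E (TangentSpace 𝓘(ℝ, E)) x ⟨y, X y⟩).2))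
  rw [TangentBundle.continuousLinearMapAt_model_space, Bundle.Trivialization.symmL_apply _ hy]
  rw [Bundle.Trivialization.symm_apply_apply_mk]
  · rfl
  · exact hy

variable [FiniteDimensional ℝ E]

lemma IsSmoothFieldAt.mlieBracket {X Y : VectorFields E M} {x : M} (hX : IsSmoothFieldAt X x)
    (hY : IsSmoothFieldAt Y x) : IsSmoothFieldAt (mlieBracket 𝓘(ℝ, E) X Y) x := by
  have : CompleteSpace E := FiniteDimensional.complete ℝ E
  have : IsManifold 𝓘(ℝ, E) (((⊤ : ℕ∞) : WithTop ℕ∞) + 1) M := by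
    simpa using ‹IsManifold 𝓘(ℝ, E) ∞ M›
  have : IsManifold 𝓘(ℝ, E) (minSmoothness ℝ 2) M := by
    simp only [minSmoothness_of_isRCLikeNormedField]; infer_instance
  exact ContMDiffAt.mlieBracket_vectorField (m := ⊤) (n := ⊤) hX hY (by simp)

omit [IsManifold 𝓘(ℝ, E) ∞ M] [FiniteDimensional ℝ E] in
-- Smoothness may be tested on single vectors because an operator on a finite-dimensional space is a
-- finite sum of its values on a basis times fixed coordinate forms.
lemma contMDiffAt_clm {W V' : Type*} [NormedAddCommGroup W] [NormedSpace ℝ W]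
    [FiniteDimensional ℝ W] [NormedAddCommGroup V'] [NormedSpace ℝ V']
    {n : WithTop ℕ∞} {A : M → W →L[ℝ] V'} {x : M}
    (h : ∀ v, ContMDiffAt 𝓘(ℝ, E) 𝓘(ℝ, V') n (fun y => A y v) x) :
    ContMDiffAt 𝓘(ℝ, E) 𝓘(ℝ, W →L[ℝ] V') n A x := by
  let b := Module.finBasis ℝ W
  have hA : A = fun y => ∑ i, ContinuousLinearMap.smulRightL ℝ W V'
      (LinearMap.toContinuousLinearMap (b.coord i)) (A y (b i)) := by
    funext y
    ext v
    conv_lhs => rw [← b.sum_repr v, map_sum]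
    simp
  rw [hA]
  exact ContMDiffAt.sum fun i _ =>
    (ContinuousLinearMap.smulRightL ℝ W V' _).contDiff.contMDiff.contMDiffAt.comp x (h (b i))

omit [IsManifold 𝓘(ℝ, E) ∞ M] [FiniteDimensional ℝ E] in
/-- Solutions of regular linear equations with smooth coefficients are smooth. -/
lemma contMDiffAt_of_clm_apply {W : Type*} [NormedAddCommGroup W] [NormedSpace ℝ W]
    [FiniteDimensional ℝ W] {A : M → W →L[ℝ] W} {u r : M → W} {x : M}
    (hA : ∀ v, ContMDiffAt 𝓘(ℝ, E) 𝓘(ℝ, W) ∞ (fun y => A y v) x)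
    (hinj : Function.Injective (A x)) (hr : ContMDiffAt 𝓘(ℝ, E) 𝓘(ℝ, W) ∞ r x)
    (h : ∀ᶠ y in 𝓝 x, A y (u y) = r y) : ContMDiffAt 𝓘(ℝ, E) 𝓘(ℝ, W) ∞ u x := by
  have : CompleteSpace W := FiniteDimensional.complete ℝ W
  have hA' := contMDiffAt_clm hA
  let e : W ≃L[ℝ] W :=
    (LinearEquiv.ofInjectiveEndo (A x).toLinearMap hinj).toContinuousLinearEquiv
  have he : (e : W →L[ℝ] W) = A x := by
    ext v
    rfl
  have hAinv : ContMDiffAt 𝓘(ℝ, E) 𝓘(ℝ, W →L[ℝ] W) ∞ (fun y => (A y).inverse) x := by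
    have h := contDiffAt_map_inverse (n := ∞) e
    rw [he] at h
    exact h.contMDiffAt.comp x hA'
  have hev : ∀ᶠ y in 𝓝 x, (A y).IsInvertible := by
    have : {B : W →L[ℝ] W | B.IsInvertible} ∈ 𝓝 (A x) := by
      have := ContinuousLinearEquiv.nhds e
      rw [he] at this
      exact this
    exact hA'.continuousAt this
  -- Invertibility is an open condition, so near `x` the solution is `A⁻¹ r`, and inversion of
  -- operators is smooth.
  refine (hAinv.clm_apply hr).congr_of_eventuallyEq ?_
  filter_upwards [hev, h] with y hy hyr
  obtain ⟨e', he'⟩ := hy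
  rw [← hyr, ← he', ContinuousLinearMap.inverse_equiv]
  exact (e'.symm_apply_apply _).symm

/-- A field is smooth when its image under an injective smooth family of linear maps is. -/
lemma isSmoothFieldAt_of_injective [FiniteDimensional ℝ V] {x : M}
    (Λ : (y : M) → TangentSpace 𝓘(ℝ, E) y →ₗ[ℝ] V)
    (hΛ : ∀ w : TangentSpace 𝓘(ℝ, E) x,
      ContMDiffAt 𝓘(ℝ, E) 𝓘(ℝ, V) ∞ (fun y => Λ y (ext w y)) x)
    (hinj : Function.Injective (Λ x)) {U : VectorFields E M}
    (hU : ContMDiffAt 𝓘(ℝ, E) 𝓘(ℝ, V) ∞ (fun y => Λ y (U y)) x) : IsSmoothFieldAt U x := by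
  have : CompleteSpace E := FiniteDimensional.complete ℝ E
  -- `P` inverts `Λ` only at `x`. Composing with this fixed map gives the square family `P ∘ Λ y`,
  -- which is injective at `x`; this is enough for the linear-system lemma.
  obtain ⟨P, hP⟩ := LinearMap.exists_leftInverse_of_injective (Λ x) (LinearMap.ker_eq_bot.2 hinj)
  set t := trivializationAt E (TangentSpace 𝓘(ℝ, E) : M → Type _) x with ht
  have hxt : x ∈ t.baseSet := FiberBundle.mem_baseSet_trivializationAt' x
  let P' : V →L[ℝ] E := LinearMap.toContinuousLinearMap (P : V →ₗ[ℝ] E)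
  let A : M → E →L[ℝ] E := fun y =>
    LinearMap.toContinuousLinearMap (((P : V →ₗ[ℝ] E).comp (Λ y)).comp (t.symmₗ ℝ y))
  have hAapp : ∀ y ∈ t.baseSet, ∀ v, A y v = P (Λ y (t.symm y v)) := fun y hy v => by
    change P (Λ y (t.symmₗ ℝ y v)) = _
    rw [t.symmₗ_apply hy]
  rw [IsSmoothFieldAt, Bundle.contMDiffAt_section]
  refine contMDiffAt_of_clm_apply (A := A) (fun v => ?_) ?_
    (P'.contDiff.contMDiff.contMDiffAt.comp x hU) ?_
  · have h := P'.contDiff.contMDiff.contMDiffAt.comp x (hΛ (t.symm x v))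
    refine h.congr_of_eventuallyEq ?_
    filter_upwards [t.open_baseSet.mem_nhds hxt] with y hy
    have h1 : ext (t.symm x v) y = t.symm y v := by
      simp [ext, FiberBundle.extend, ← ht, hxt]
    refine (hAapp y hy v).trans ?_
    rw [← h1]
    rfl
  · intro v v' hv
    rw [hAapp x hxt, hAapp x hxt] at hv
    have h1 := (LinearMap.congr_fun hP (t.symm x v)).symm.trans
      (hv.trans (LinearMap.congr_fun hP (t.symm x v')))
    exact (t.continuousLinearEquivAt ℝ x hxt).symm.injective h1
  · filter_upwards [t.open_baseSet.mem_nhds hxt] with y hyt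
    rw [hAapp y hyt, t.symm_apply_apply_mk hyt]
    rfl

/-- A differentiable family of linear forms is differentiable on differentiable fields. -/
lemma mdifferentiableAt_of_linear {x : M} (Λ : (y : M) → TangentSpace 𝓘(ℝ, E) y →ₗ[ℝ] ℝ)
    (hΛ : ∀ w : TangentSpace 𝓘(ℝ, E) x,
      MDifferentiableAt 𝓘(ℝ, E) 𝓘(ℝ, ℝ) (fun y => Λ y (ext w y)) x)
    {U : VectorFields E M} (hU : DiffFieldAt U x) :
    MDifferentiableAt 𝓘(ℝ, E) 𝓘(ℝ, ℝ) (fun y => Λ y (U y)) x := by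
  set t := trivializationAt E (TangentSpace 𝓘(ℝ, E) : M → Type _) x with ht
  have hxt : x ∈ t.baseSet := FiberBundle.mem_baseSet_trivializationAt' x
  let b := Module.finBasis ℝ E
  have hU' := (mdifferentiableAt_section (IB := 𝓘(ℝ, E)) U).1 hU
  have hc : ∀ i, MDifferentiableAt 𝓘(ℝ, E) 𝓘(ℝ, ℝ) (fun y => b.coord i (t ⟨y, U y⟩).2) x :=
    fun i => (LinearMap.toContinuousLinearMap (b.coord i)).mdifferentiableAt.comp x hU'
  -- The field is expanded in the local frame extending a basis at `x`; its coordinates are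
  -- differentiable, but need not be smooth.
  have hsum : MDifferentiableAt 𝓘(ℝ, E) 𝓘(ℝ, ℝ)
      (fun y => ∑ i, b.coord i (t ⟨y, U y⟩).2 * Λ y (ext (t.symm x (b i)) y)) x := by
    have := MDifferentiableAt.sum (t := Finset.univ) fun i _ => (hc i).mul (hΛ (t.symm x (b i)))
    convert! this using 1
    ext y
    simp
  refine hsum.congr_of_eventuallyEq ?_
  filter_upwards [t.open_baseSet.mem_nhds hxt] with y hy
  have h1 : ∀ v, ext (t.symm x v) y = t.symmₗ ℝ y v := fun v => by
    rw [t.symmₗ_apply hy]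
    simp [ext, FiberBundle.extend, ← ht, hxt]
  have h2 : U y = t.symmₗ ℝ y (t ⟨y, U y⟩).2 := by
    rw [t.symmₗ_apply hy, t.symm_apply_apply_mk hy]
  conv_lhs => rw [h2, ← b.sum_repr (t ⟨y, U y⟩).2, map_sum, map_sum]
  simp [h1]

/-- The Lie brackets of related vector fields are related. -/
lemma mlieBracket_related {E' : Type*} [NormedAddCommGroup E'] [NormedSpace ℝ E']
    [FiniteDimensional ℝ E'] {N : Type*} [TopologicalSpace N] [ChartedSpace E' N]
    [IsManifold 𝓘(ℝ, E') ∞ N] {f : M → N} {x : M}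
    (hf : ContMDiffAt 𝓘(ℝ, E) 𝓘(ℝ, E') 2 f x) {X Y : VectorFields E M} {X' Y' : VectorFields E' N}
    (hX : DiffFieldAt X x) (hY : DiffFieldAt Y x) (hX' : DiffFieldAt X' (f x))
    (hY' : DiffFieldAt Y' (f x))
    (hXX' : ∀ᶠ y in 𝓝 x, mfderiv 𝓘(ℝ, E) 𝓘(ℝ, E') f y (X y) = X' (f y))
    (hYY' : ∀ᶠ y in 𝓝 x, mfderiv 𝓘(ℝ, E) 𝓘(ℝ, E') f y (Y y) = Y' (f y)) :
    mfderiv 𝓘(ℝ, E) 𝓘(ℝ, E') f x (VectorField.mlieBracket 𝓘(ℝ, E) X Y x)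
      = VectorField.mlieBracket 𝓘(ℝ, E') X' Y' (f x) := by
  have : CompleteSpace E := FiniteDimensional.complete ℝ E
  have : CompleteSpace E' := FiniteDimensional.complete ℝ E'
  set ψ := extChartAt 𝓘(ℝ, E') (f x) with hψdef
  have hψ : ContMDiffAt 𝓘(ℝ, E') 𝓘(ℝ, E') 2 ψ (f x) := contMDiffAt_extChartAt
  have hψf : ContMDiffAt 𝓘(ℝ, E) 𝓘(ℝ, E') 2 (fun y => ψ (f y)) x := hψ.comp x hf
  have hfd : ∀ᶠ y in 𝓝 x, MDifferentiableAt 𝓘(ℝ, E) 𝓘(ℝ, E') f y := by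
    filter_upwards [(contMDiffAt_iff_contMDiffAt_nhds (by simp)).1 hf] with y hy
    exact ContMDiffAt.mdifferentiableAt hy (by simp)
  have hψd : ∀ᶠ y in 𝓝 x, MDifferentiableAt 𝓘(ℝ, E') 𝓘(ℝ, E') ψ (f y) := by
    have h : ∀ᶠ z in 𝓝 (f x), MDifferentiableAt 𝓘(ℝ, E') 𝓘(ℝ, E') ψ z := by
      filter_upwards [(contMDiffAt_iff_contMDiffAt_nhds (by simp)).1 hψ] with y hy
      exact ContMDiffAt.mdifferentiableAt hy (by simp)
    exact hf.continuousAt.eventually h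
  -- The brackets are tested on `ψ ∘ f` upstairs and on the chart `ψ` downstairs. Relatedness turns
  -- `Z (ψ ∘ f)` into `(Z' ψ) ∘ f`, and this can be differentiated again.
  have key : ∀ {Z : VectorFields E M} {Z' : VectorFields E' N}, DiffFieldAt Z' (f x) →
      (∀ᶠ y in 𝓝 x, mfderiv 𝓘(ℝ, E) 𝓘(ℝ, E') f y (Z y) = Z' (f y)) →
      ∀ u : TangentSpace 𝓘(ℝ, E) x,
      mvfderiv 𝓘(ℝ, E) (fun y => mvfderiv 𝓘(ℝ, E) (fun y => ψ (f y)) y (Z y)) x u =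
        mvfderiv 𝓘(ℝ, E') (fun z => mvfderiv 𝓘(ℝ, E') ψ z (Z' z)) (f x)
          (mfderiv 𝓘(ℝ, E) 𝓘(ℝ, E') f x u) := by
    intro Z Z' hZ' hZZ' u
    rw [← mvfderiv_comp_vector (mdifferentiableAt_mvfderiv_apply hψ hZ').1 hfd.self_of_nhds]
    refine DFunLike.congr_fun (mvfderiv_congr ?_) u
    filter_upwards [hfd, hψd, hZZ'] with y h1 h2 h3
    rw [mvfderiv_comp_vector h2 h1, h3]
  have h1 := mvfderiv_mlieBracket hψf hX hY
  rw [key hY' hYY', key hX' hXX', hXX'.self_of_nhds, hYY'.self_of_nhds,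
    ← mvfderiv_mlieBracket hψ hX' hY', mvfderiv_comp_vector hψd.self_of_nhds hfd.self_of_nhds,
    mvfderiv_chart, mvfderiv_chart] at h1
  exact h1

omit [FiniteDimensional ℝ E] in
lemma hasFDerivAt_fderiv_left {E' : Type*} [NormedAddCommGroup E'] [NormedSpace ℝ E']
    {Ψ : E' × E → V} {p : E'} {q : E} (hD : DifferentiableAt ℝ (fderiv ℝ Ψ) (p, q)) (v : E' × E) :
    HasFDerivAt (fun p : E' => fderiv ℝ Ψ (p, q) v)
      ((fderiv ℝ (fderiv ℝ Ψ) (p, q)).flip v ∘L ContinuousLinearMap.inl ℝ E' E) p := by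
  have := (hD.hasFDerivAt.comp p (hasFDerivAt_prodMk_left (𝕜 := ℝ) p q)).clm_apply
    (hasFDerivAt_const v p)
  convert! this using 1
  ext z
  simp

omit [FiniteDimensional ℝ E] in
lemma hasFDerivAt_fderiv_right {E' : Type*} [NormedAddCommGroup E'] [NormedSpace ℝ E']
    {Ψ : E' × E → V} {p : E'} {q : E} (hD : DifferentiableAt ℝ (fderiv ℝ Ψ) (p, q)) (v : E' × E) :
    HasFDerivAt (fun q : E => fderiv ℝ Ψ (p, q) v)
      ((fderiv ℝ (fderiv ℝ Ψ) (p, q)).flip v ∘L ContinuousLinearMap.inr ℝ E' E) q := by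
  have := (hD.hasFDerivAt.comp q (hasFDerivAt_prodMk_right (𝕜 := ℝ) p q)).clm_apply
    (hasFDerivAt_const v q)
  convert! this using 1
  ext z
  simp

omit [FiniteDimensional ℝ E] in
/-- Mixed partial derivatives commute. -/
lemma mvfderiv_mvfderiv_comm {E' : Type*} [NormedAddCommGroup E'] [NormedSpace ℝ E']
    {N : Type*} [TopologicalSpace N] [ChartedSpace E' N]
    [IsManifold 𝓘(ℝ, E') ∞ N] {Φ : N × M → V} {a : N} {x : M}
    (hΦ : ContMDiffAt (𝓘(ℝ, E').prod 𝓘(ℝ, E)) 𝓘(ℝ, V) 2 Φ (a, x))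
    (u : TangentSpace 𝓘(ℝ, E') a) (w : TangentSpace 𝓘(ℝ, E) x) :
    mvfderiv 𝓘(ℝ, E') (fun b => mvfderiv 𝓘(ℝ, E) (fun y => Φ (b, y)) x w) a u
      = mvfderiv 𝓘(ℝ, E) (fun y => mvfderiv 𝓘(ℝ, E') (fun b => Φ (b, y)) a u) x w := by
  set χ := extChartAt 𝓘(ℝ, E') a with hχdef
  set φ := extChartAt 𝓘(ℝ, E) x with hφdef
  let Ψ : E' × E → V := fun p => Φ (χ.symm p.1, φ.symm p.2)
  have hχs : ContMDiffAt 𝓘(ℝ, E') 𝓘(ℝ, E') 2 χ.symm (χ a) := by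
    have := contMDiffWithinAt_extChartAt_symm_range (I := 𝓘(ℝ, E')) (n := 2) a
      (mem_extChartAt_target a)
    rwa [modelWithCornersSelf_coe, Set.range_id, contMDiffWithinAt_univ] at this
  have hφs : ContMDiffAt 𝓘(ℝ, E) 𝓘(ℝ, E) 2 φ.symm (φ x) := by
    have := contMDiffWithinAt_extChartAt_symm_range (I := 𝓘(ℝ, E)) (n := 2) x
      (mem_extChartAt_target x)
    rwa [modelWithCornersSelf_coe, Set.range_id, contMDiffWithinAt_univ] at this
  have hΨ : ContDiffAt ℝ 2 Ψ (χ a, φ x) := by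
    rw [← contMDiffAt_iff_contDiffAt]
    have h1 : ContMDiffAt 𝓘(ℝ, E' × E) 𝓘(ℝ, E') 2 (fun p : E' × E => χ.symm p.1) (χ a, φ x) :=
      hχs.comp (χ a, φ x) contDiff_fst.contMDiff.contMDiffAt
    have h2 : ContMDiffAt 𝓘(ℝ, E' × E) 𝓘(ℝ, E) 2 (fun p : E' × E => φ.symm p.2) (χ a, φ x) :=
      hφs.comp (χ a, φ x) contDiff_snd.contMDiff.contMDiffAt
    refine ContMDiffAt.comp (χ a, φ x) ?_ (h1.prodMk h2)
    simpa [χ, φ] using hΦ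
  have hΨd : ∀ᶠ p in 𝓝 (χ a, φ x), DifferentiableAt ℝ Ψ p := by
    filter_upwards [hΨ.eventually (by simp)] with p hp
    exact hp.differentiableAt (by simp)
  have hD : DifferentiableAt ℝ (fderiv ℝ Ψ) (χ a, φ x) :=
    (hΨ.fderiv_right (m := 1) (by norm_num)).differentiableAt (by norm_num)
  have hsymm : IsSymmSndFDerivAt ℝ Ψ (χ a, φ x) := hΨ.isSymmSndFDerivAt (by simp)
  have hχd : MDifferentiableAt 𝓘(ℝ, E') 𝓘(ℝ, E') χ a :=
    mdifferentiableAt_extChartAt (mem_chart_source E' a)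
  have hφd : MDifferentiableAt 𝓘(ℝ, E) 𝓘(ℝ, E) φ x :=
    mdifferentiableAt_extChartAt (mem_chart_source E x)
  -- In product charts each inner derivative is a partial derivative of `Ψ`, so the claim reduces to
  -- the symmetry of the second derivative of `Ψ`.
  have e1 : (fun b => mvfderiv 𝓘(ℝ, E) (fun y => Φ (b, y)) x w) =ᶠ[𝓝 a]
      fun b => fderiv ℝ Ψ (χ b, φ x) (0, w) := by
    have hc : ContinuousAt (fun b => (χ b, φ x)) a := hχd.continuousAt.prodMk continuousAt_const
    filter_upwards [hc.eventually hΨd, extChartAt_source_mem_nhds (I := 𝓘(ℝ, E')) a] with b hb hbs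
    have h1 : (fun y => Φ (b, y)) =ᶠ[𝓝 x] fun y => (fun q => Ψ (χ b, q)) (φ y) := by
      filter_upwards [extChartAt_source_mem_nhds (I := 𝓘(ℝ, E)) x] with y hy
      simp only [Ψ]
      rw [χ.left_inv hbs, φ.left_inv hy]
    have hp : HasFDerivAt (fun q : E => (χ b, q)) (ContinuousLinearMap.inr ℝ E' E) (φ x) :=
      hasFDerivAt_prodMk_right _ _
    have h2 := hb.hasFDerivAt.comp (φ x) hp
    rw [mvfderiv_congr h1, mvfderiv_comp_fderiv (q := fun q => Ψ (χ b, q)) h2.differentiableAt hφd,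
      mvfderiv_chart]
    exact DFunLike.congr_fun h2.fderiv w
  have e2 : (fun y => mvfderiv 𝓘(ℝ, E') (fun b => Φ (b, y)) a u) =ᶠ[𝓝 x]
      fun y => fderiv ℝ Ψ (χ a, φ y) (u, 0) := by
    have hc : ContinuousAt (fun y => (χ a, φ y)) x := continuousAt_const.prodMk hφd.continuousAt
    filter_upwards [hc.eventually hΨd, extChartAt_source_mem_nhds (I := 𝓘(ℝ, E)) x] with y hb hys
    have h1 : (fun b => Φ (b, y)) =ᶠ[𝓝 a] fun b => (fun p => Ψ (p, φ y)) (χ b) := by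
      filter_upwards [extChartAt_source_mem_nhds (I := 𝓘(ℝ, E')) a] with b hbs
      simp only [Ψ]
      rw [χ.left_inv hbs, φ.left_inv hys]
    have hp : HasFDerivAt (fun p : E' => (p, φ y)) (ContinuousLinearMap.inl ℝ E' E) (χ a) :=
      hasFDerivAt_prodMk_left _ _
    have h2 := hb.hasFDerivAt.comp (χ a) hp
    rw [mvfderiv_congr h1, mvfderiv_comp_fderiv (q := fun p => Ψ (p, φ y)) h2.differentiableAt hχd,
      mvfderiv_chart]
    exact DFunLike.congr_fun h2.fderiv u
  rw [mvfderiv_congr e1, mvfderiv_congr e2]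
  have d1 : HasFDerivAt (fun p : E' => fderiv ℝ Ψ (p, φ x) (0, w))
      ((fderiv ℝ (fderiv ℝ Ψ) (χ a, φ x)).flip (0, w) ∘L ContinuousLinearMap.inl ℝ E' E) (χ a) :=
    hasFDerivAt_fderiv_left hD (0, w)
  have d2 : HasFDerivAt (fun q : E => fderiv ℝ Ψ (χ a, q) (u, 0))
      ((fderiv ℝ (fderiv ℝ Ψ) (χ a, φ x)).flip (u, 0) ∘L ContinuousLinearMap.inr ℝ E' E) (φ x) :=
    hasFDerivAt_fderiv_right hD (u, 0)
  rw [mvfderiv_comp_fderiv (q := fun p : E' => fderiv ℝ Ψ (p, φ x) (0, w)) d1.differentiableAt hχd,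
    mvfderiv_comp_fderiv (q := fun q : E => fderiv ℝ Ψ (χ a, q) (u, 0)) d2.differentiableAt hφd,
    mvfderiv_chart, mvfderiv_chart, d1.fderiv, d2.fderiv]
  exact hsymm.eq (u, 0) (0, w)

end Fields

/-! ### One-forms, Riemannian metrics and tensoriality of the Koszul expression. -/

section Riemannian

open VectorField Topology Filter

variable {E : Type*} [NormedAddCommGroup E] [NormedSpace ℝ E]
  {M : Type*} [TopologicalSpace M] [ChartedSpace E M] [IsManifold 𝓘(ℝ, E) ∞ M]

/-- One-forms that are smooth at a point. -/
structure IsOneFormAt (α : (x : M) → TangentSpace 𝓘(ℝ, E) x → ℝ) (x : M) : Prop where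
  add (y : M) (u v : TangentSpace 𝓘(ℝ, E) y) : α y (u + v) = α y u + α y v
  smul (y : M) (c : ℝ) (u : TangentSpace 𝓘(ℝ, E) y) : α y (c • u) = c * α y u
  smooth (U : VectorFields E M) (hU : IsSmoothFieldAt U x) :
    ContMDiffAt 𝓘(ℝ, E) 𝓘(ℝ, ℝ) ∞ (fun y => α y (U y)) x

/-- The linear form on each tangent space given by a one-form. -/
noncomputable def IsOneFormAt.toLin {α : (x : M) → TangentSpace 𝓘(ℝ, E) x → ℝ} {x : M}
    (hα : IsOneFormAt α x) (y : M) : TangentSpace 𝓘(ℝ, E) y →ₗ[ℝ] ℝ where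
  toFun := α y
  map_add' := hα.add y
  map_smul' := hα.smul y

namespace IsOneFormAt

variable {α : (x : M) → TangentSpace 𝓘(ℝ, E) x → ℝ} {x : M} (hα : IsOneFormAt α x)

include hα

lemma neg (y : M) (u : TangentSpace 𝓘(ℝ, E) y) : α y (-u) = - α y u := map_neg (hα.toLin y) u

lemma zero (y : M) : α y 0 = 0 := map_zero (hα.toLin y)

variable [FiniteDimensional ℝ E]

lemma mdiff {U : VectorFields E M} (hU : DiffFieldAt U x) :
    MDifferentiableAt 𝓘(ℝ, E) 𝓘(ℝ, ℝ) (fun y => α y (U y)) x :=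
  mdifferentiableAt_of_linear hα.toLin
    (fun w => ((hα.smooth _ (isSmoothFieldAt_ext w)).mdifferentiableAt (by simp))) hU

/-- The derivative of the coefficient coming from the Leibniz rule cancels the one coming from the
bracket. Hence the extensions used in `extD1` can be replaced by any fields with the same values. -/
lemma tensorialAt_extD1 (U : VectorFields E M) :
    TensorialAt 𝓘(ℝ, E) E (fun V : VectorFields E M =>
      mvfderiv 𝓘(ℝ, E) (fun y => α y (U y)) x (V x)
        - mvfderiv 𝓘(ℝ, E) (fun y => α y (V y)) x (U x)
        - α x (mlieBracket 𝓘(ℝ, E) V U x)) x where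
  smul {f V} hf hV := by
    have : CompleteSpace E := FiniteDimensional.complete ℝ E
    have h1 : (fun y => α y ((f • V) y)) = fun y => f y * α y (V y) :=
      funext fun y => hα.smul y _ _
    rw [h1, mvfderiv_fun_mul hf (hα.mdiff hV), mlieBracket_smul_left hf hV]
    simp only [Pi.smul_apply', map_smul, hα.add, hα.smul, hα.neg, neg_smul, smul_eq_mul,
      add_apply, smul_apply]
    ring
  add {V V'} hV hV' := by
    have : CompleteSpace E := FiniteDimensional.complete ℝ E
    have h1 : (fun y => α y ((V + V') y)) = fun y => α y (V y) + α y (V' y) :=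
      funext fun y => hα.add y _ _
    rw [h1, mvfderiv_fun_add (hα.mdiff hV) (hα.mdiff hV'), mlieBracket_add_left hV hV']
    simp only [Pi.add_apply, map_add, hα.add, add_apply]
    ring

/-- The exterior derivative of a one-form, on vector fields. -/
lemma extD1_eq {U V : VectorFields E M} (hU : DiffFieldAt U x) (hV : DiffFieldAt V x) :
    extD1 α x (U x) (V x) = mvfderiv 𝓘(ℝ, E) (fun y => α y (V y)) x (U x)
      - mvfderiv 𝓘(ℝ, E) (fun y => α y (U y)) x (V x) - α x (mlieBracket 𝓘(ℝ, E) U V x) := by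
  have hs : ∀ A B : VectorFields E M,
      α x (mlieBracket 𝓘(ℝ, E) A B x) = - α x (mlieBracket 𝓘(ℝ, E) B A x) := fun A B => by
    rw [mlieBracket_swap_apply, hα.neg]
  -- One argument is exchanged at a time; skewness brings the second one into the tensorial slot.
  have h1 := (hα.tensorialAt_extD1 V).pointwise (isSmoothFieldAt_ext (U x)).diff hU
    (ext_self (U x))
  have h2 := (hα.tensorialAt_extD1 (ext (U x))).pointwise
    (isSmoothFieldAt_ext (V x)).diff hV (ext_self (V x))
  simp only [ext_self] at h1 h2
  rw [hs (ext (V x)), hs V] at h2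
  rw [extD1]
  linarith

end IsOneFormAt

/-- Smooth Riemannian metrics, as families of functions of two tangent vectors. -/
structure IsRiem (h : (x : M) → TangentSpace 𝓘(ℝ, E) x → TangentSpace 𝓘(ℝ, E) x → ℝ) : Prop where
  add_left (x : M) (u v w : TangentSpace 𝓘(ℝ, E) x) : h x (u + v) w = h x u w + h x v w
  smul_left (x : M) (c : ℝ) (u w : TangentSpace 𝓘(ℝ, E) x) : h x (c • u) w = c * h x u w
  symm (x : M) (u v : TangentSpace 𝓘(ℝ, E) x) : h x u v = h x v u
  pos (x : M) (u : TangentSpace 𝓘(ℝ, E) x) (hu : u ≠ 0) : 0 < h x u u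
  smooth (x : M) (U V : VectorFields E M) (hU : IsSmoothFieldAt U x) (hV : IsSmoothFieldAt V x) :
    ContMDiffAt 𝓘(ℝ, E) 𝓘(ℝ, ℝ) ∞ (fun y => h y (U y) (V y)) x

namespace IsRiem

variable {h : (x : M) → TangentSpace 𝓘(ℝ, E) x → TangentSpace 𝓘(ℝ, E) x → ℝ} (hh : IsRiem h)

include hh

lemma add_right (x : M) (u v w : TangentSpace 𝓘(ℝ, E) x) :
    h x u (v + w) = h x u v + h x u w := by
  rw [hh.symm, hh.add_left, hh.symm x v, hh.symm x w]

lemma smul_right (x : M) (c : ℝ) (u w : TangentSpace 𝓘(ℝ, E) x) :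
    h x u (c • w) = c * h x u w := by
  rw [hh.symm, hh.smul_left, hh.symm]

omit hh in
/-- A metric as a bilinear map. -/
noncomputable def toLin (hh : IsRiem h) (x : M) :
    TangentSpace 𝓘(ℝ, E) x →ₗ[ℝ] TangentSpace 𝓘(ℝ, E) x →ₗ[ℝ] ℝ :=
  LinearMap.mk₂ ℝ (h x) (hh.add_left x) (hh.smul_left x) (hh.add_right x) (hh.smul_right x)

lemma neg_left (x : M) (u w : TangentSpace 𝓘(ℝ, E) x) : h x (-u) w = - h x u w :=
  LinearMap.map_neg₂ (hh.toLin x) u w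

lemma sub_left (x : M) (u v w : TangentSpace 𝓘(ℝ, E) x) : h x (u - v) w = h x u w - h x v w :=
  LinearMap.map_sub₂ (hh.toLin x) u v w

lemma zero_left (x : M) (w : TangentSpace 𝓘(ℝ, E) x) : h x 0 w = 0 :=
  LinearMap.map_zero₂ (hh.toLin x) w

lemma zero_right (x : M) (w : TangentSpace 𝓘(ℝ, E) x) : h x w 0 = 0 :=
  map_zero (hh.toLin x w)

lemma sum_left {ι : Type*} (s : Finset ι) (x : M) (u : ι → TangentSpace 𝓘(ℝ, E) x)
    (w : TangentSpace 𝓘(ℝ, E) x) : h x (∑ i ∈ s, u i) w = ∑ i ∈ s, h x (u i) w :=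
  LinearMap.map_sum₂ (hh.toLin x) s u w

lemma eq_zero_of_self {x : M} {u : TangentSpace 𝓘(ℝ, E) x} (hu : h x u u = 0) : u = 0 := by
  by_contra hne
  exact (hh.pos x u hne).ne' hu

lemma eq_of_forall {x : M} {u v : TangentSpace 𝓘(ℝ, E) x} (huv : ∀ w, h x u w = h x v w) :
    u = v := by
  rw [← sub_eq_zero]
  apply hh.eq_zero_of_self
  rw [hh.sub_left, huv, sub_self]

lemma isOneFormAt {x : M} {U : VectorFields E M} (hU : IsSmoothFieldAt U x) :
    IsOneFormAt (fun x w => h x (U x) w) x where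
  add y := hh.add_right y _
  smul y c := hh.smul_right y c _
  smooth W hW := hh.smooth x U W hU hW

variable [FiniteDimensional ℝ E]

/-- `sharp` is a choice, so existence has to be shown: definiteness makes the map from vectors to
covectors injective, and equality of dimensions makes it surjective. -/
lemma sharp_spec {x : M} (α : TangentSpace 𝓘(ℝ, E) x →ₗ[ℝ] ℝ) (w : TangentSpace 𝓘(ℝ, E) x) :
    h x (sharp (h x) α) w = α w := by
  have : FiniteDimensional ℝ (TangentSpace 𝓘(ℝ, E) x) := inferInstanceAs (FiniteDimensional ℝ E)
  have hinj : Function.Injective (hh.toLin x) := fun u v huv =>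
    hh.eq_of_forall fun w => LinearMap.congr_fun huv w
  have hdim : Module.finrank ℝ (TangentSpace 𝓘(ℝ, E) x)
      = Module.finrank ℝ (TangentSpace 𝓘(ℝ, E) x →ₗ[ℝ] ℝ) :=
    (Subspace.dual_finrank_eq).symm
  have hsurj := (LinearMap.injective_iff_surjective_of_finrank_eq_finrank hdim).1 hinj
  obtain ⟨u, hu⟩ := hsurj α
  exact Classical.epsilon_spec (p := fun u => ∀ w, h x u w = α w)
    ⟨u, fun w => LinearMap.congr_fun hu w⟩ w

lemma mdiff {x : M} {U V : VectorFields E M} (hU : DiffFieldAt U x) (hV : DiffFieldAt V x) :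
    MDifferentiableAt 𝓘(ℝ, E) 𝓘(ℝ, ℝ) (fun y => h y (U y) (V y)) x :=
  mdifferentiableAt_of_linear (fun y => (hh.toLin y).flip (V y))
    (fun w => mdifferentiableAt_of_linear (fun y => hh.toLin y (ext w y))
      (fun w' => (hh.smooth x _ _ (isSmoothFieldAt_ext w)
        (isSmoothFieldAt_ext w')).mdifferentiableAt (by simp)) hV) hU

/-- A field is smooth when its products with smooth fields are. -/
lemma isSmoothFieldAt {x : M} {U : VectorFields E M}
    (hU : ∀ w : TangentSpace 𝓘(ℝ, E) x,
      ContMDiffAt 𝓘(ℝ, E) 𝓘(ℝ, ℝ) ∞ (fun y => h y (U y) (ext w y)) x) : IsSmoothFieldAt U x := by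
  let b : Module.Basis (Fin (Module.finrank ℝ E)) ℝ (TangentSpace 𝓘(ℝ, E) x) :=
    Module.finBasis ℝ E
  refine isSmoothFieldAt_of_injective (V := Fin (Module.finrank ℝ E) → ℝ)
    (fun y => LinearMap.pi fun i => (hh.toLin y).flip (ext (b i) y)) ?_ ?_ ?_
  · intro w
    rw [contMDiffAt_pi_space]
    exact fun i => hh.smooth x _ _ (isSmoothFieldAt_ext w) (isSmoothFieldAt_ext (b i))
  · intro u v huv
    refine hh.eq_of_forall fun w => ?_
    have h1 : ∀ i, h x u (b i) = h x v (b i) := fun i => by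
      have := congrFun huv i
      simpa [toLin] using this
    exact LinearMap.congr_fun (b.ext h1 : hh.toLin x u = hh.toLin x v) w
  · rw [contMDiffAt_pi_space]
    exact fun i => hU (b i)

lemma isSmoothFieldAt_sharp {x : M} {α : (x : M) → TangentSpace 𝓘(ℝ, E) x → ℝ}
    (hα : IsOneFormAt α x) : IsSmoothFieldAt (fun y => sharp (h y) (α y)) x := by
  refine hh.isSmoothFieldAt fun w => ?_
  refine (hα.smooth _ (isSmoothFieldAt_ext w)).congr_of_eventuallyEq
    (Eventually.of_forall fun y => ?_)
  exact hh.sharp_spec (hα.toLin y) _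

/-- The derivatives of the coefficient cancel between the Leibniz terms and the brackets. So the
Koszul expression is a covector in this slot, and `sharp` can be applied to it. -/
lemma tensorialAt_koszul_right {x : M} {X Y : VectorFields E M} (hX : DiffFieldAt X x)
    (hY : DiffFieldAt Y x) : TensorialAt 𝓘(ℝ, E) E (fun Z => koszul h X Y Z x) x where
  smul {f Z} hf hZ := by
    have : CompleteSpace E := FiniteDimensional.complete ℝ E
    have h1 : ∀ X : VectorFields E M,
        (fun y => h y (X y) ((f • Z) y)) = fun y => f y * h y (X y) (Z y) :=
      fun X => funext fun y => hh.smul_right y _ _ _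
    rw [koszul, koszul, h1, h1, mvfderiv_fun_mul hf (hh.mdiff hX hZ),
      mvfderiv_fun_mul hf (hh.mdiff hY hZ), mlieBracket_smul_right hf hZ,
      mlieBracket_smul_right hf hZ]
    simp only [Pi.smul_apply', map_smul, hh.add_left, hh.smul_left, hh.smul_right, smul_eq_mul,
      add_apply, smul_apply]
    rw [hh.symm x (Z x) (X x), hh.symm x (Z x) (Y x)]
    ring
  add {Z Z'} hZ hZ' := by
    have : CompleteSpace E := FiniteDimensional.complete ℝ E
    have h1 : ∀ X : VectorFields E M,
        (fun y => h y (X y) ((Z + Z') y)) = fun y => h y (X y) (Z y) + h y (X y) (Z' y) :=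
      fun X => funext fun y => hh.add_right y _ _ _
    simp only [koszul, h1]
    rw [mvfderiv_fun_add (hh.mdiff hX hZ) (hh.mdiff hX hZ'),
      mvfderiv_fun_add (hh.mdiff hY hZ) (hh.mdiff hY hZ'), mlieBracket_add_right hZ hZ',
      mlieBracket_add_right hZ hZ']
    simp only [Pi.add_apply, map_add, hh.add_left, hh.add_right, add_apply]
    ring

/-- The same cancellation holds in the direction slot. It fails in the middle slot, where the
Leibniz rule of a connection remains. -/
lemma tensorialAt_koszul_left {x : M} {Y Z : VectorFields E M} (hY : DiffFieldAt Y x)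
    (hZ : DiffFieldAt Z x) : TensorialAt 𝓘(ℝ, E) E (fun X => koszul h X Y Z x) x where
  smul {f X} hf hX := by
    have : CompleteSpace E := FiniteDimensional.complete ℝ E
    have h1 : ∀ Z : VectorFields E M,
        (fun y => h y ((f • X) y) (Z y)) = fun y => f y * h y (X y) (Z y) :=
      fun X => funext fun y => hh.smul_left y _ _ _
    simp only [koszul, h1]
    rw [mvfderiv_fun_mul hf (hh.mdiff hX hZ),
      mvfderiv_fun_mul hf (hh.mdiff hX hY), mlieBracket_smul_left hf hX,
      mlieBracket_smul_left hf hX]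
    simp only [Pi.smul_apply', map_smul, hh.add_left, hh.smul_left, hh.smul_right, smul_eq_mul,
      add_apply, smul_apply]
    ring
  add {X X'} hX hX' := by
    have : CompleteSpace E := FiniteDimensional.complete ℝ E
    have h1 : ∀ Z : VectorFields E M,
        (fun y => h y ((X + X') y) (Z y)) = fun y => h y (X y) (Z y) + h y (X' y) (Z y) :=
      fun X => funext fun y => hh.add_left y _ _ _
    simp only [koszul, h1]
    rw [mvfderiv_fun_add (hh.mdiff hX hZ) (hh.mdiff hX' hZ),
      mvfderiv_fun_add (hh.mdiff hX hY) (hh.mdiff hX' hY), mlieBracket_add_left hX hX',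
      mlieBracket_add_left hX hX']
    simp only [Pi.add_apply, map_add, hh.add_left, hh.add_right, add_apply]
    ring

/-- The defining property of the Bismut connections. -/
lemma bismut_apply {s : ℝ}
    {H : (x : M) → TangentSpace 𝓘(ℝ, E) x → TangentSpace 𝓘(ℝ, E) x → TangentSpace 𝓘(ℝ, E) x → ℝ}
    {x : M} {X Y : VectorFields E M} (hX : DiffFieldAt X x) (hY : DiffFieldAt Y x)
    (hH : IsLinearMap ℝ (H x (X x) (Y x))) {Z : VectorFields E M} (hZ : DiffFieldAt Z x) :
    h x (bismut s h H X Y x) (Z x) = koszul h X Y Z x + s / 2 * H x (X x) (Y x) (Z x) := by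
  have ht := hh.tensorialAt_koszul_right hX hY
  have h1 := hh.sharp_spec (TensorialAt.mkHom _ x ht).toLinearMap (Z x)
  have h2 := hh.sharp_spec (IsLinearMap.mk' _ hH) (Z x)
  rw [bismut, hh.add_left, hh.smul_left]
  have h3 : h x (leviCivita h X Y x) (Z x) = koszul h X Y Z x := by
    refine h1.trans ?_
    exact TensorialAt.mkHom_apply ht hZ
  rw [h3]
  congr 2

end IsRiem

end Riemannian


/-! ### Metric compatibility, dependence on the direction and smoothness of the Bismut connections.
-/

section Bismut

open VectorField Topology Filter

variable {E : Type*} [NormedAddCommGroup E] [NormedSpace ℝ E] [FiniteDimensional ℝ E]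
  {M : Type*} [TopologicalSpace M] [ChartedSpace E M] [IsManifold 𝓘(ℝ, E) ∞ M]

omit [FiniteDimensional ℝ E] in
lemma IsSmoothFieldAt.eventually_diff {X : VectorFields E M} {x : M} (h : IsSmoothFieldAt X x) :
    ∀ᶠ y in 𝓝 x, DiffFieldAt X y := by
  have h1 : ContMDiffAt 𝓘(ℝ, E) (𝓘(ℝ, E).prod 𝓘(ℝ, E)) 1 (T% X) x := ContMDiffAt.of_le h (by simp)
  filter_upwards [(contMDiffAt_iff_contMDiffAt_nhds (by simp)).1 h1] with y hy
  exact ContMDiffAt.mdifferentiableAt hy (by simp)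

omit [FiniteDimensional ℝ E] in
lemma isRiem_pair (g : Metric E M) : IsRiem (pair g) where
  add_left x u v w := by simp [pair]
  smul_left x c u w := by simp [pair]
  symm x u v := g.symm x u v
  pos x u hu := g.pos x u hu
  smooth x U V hU hV := by
    have h := (g.contMDiff x).clm_bundle_apply₂ (F₁ := E) (F₂ := E) hU hV
    rw [Bundle.contMDiffAt_section] at h
    exact h

omit [FiniteDimensional ℝ E] in
lemma ThreeForm.isLinearMap_eval (H : ThreeForm E M) (x : M) (u v : TangentSpace 𝓘(ℝ, E) x) :
    IsLinearMap ℝ (H.eval x u v) := (H.toFun x u v).toLinearMap.isLinear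

omit [FiniteDimensional ℝ E] in
lemma ThreeForm.eval_add_left (H : ThreeForm E M) (x : M) (u u' v w : TangentSpace 𝓘(ℝ, E) x) :
    H.eval x (u + u') v w = H.eval x u v w + H.eval x u' v w :=
  DFunLike.congr_fun (DFunLike.congr_fun (map_add (H.toFun x) u u') v) w

omit [FiniteDimensional ℝ E] in
lemma ThreeForm.eval_smul_left (H : ThreeForm E M) (x : M) (c : ℝ)
    (u v w : TangentSpace 𝓘(ℝ, E) x) : H.eval x (c • u) v w = c * H.eval x u v w :=
  DFunLike.congr_fun (DFunLike.congr_fun (map_smul (H.toFun x) c u) v) w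

namespace IsRiem

variable {h : (x : M) → TangentSpace 𝓘(ℝ, E) x → TangentSpace 𝓘(ℝ, E) x → ℝ} (hh : IsRiem h)

include hh

omit [FiniteDimensional ℝ E] in
-- All terms of the Koszul expression except the first are skew in the last two fields. This is
-- metric compatibility of the Levi-Civita connection before covectors are turned into vectors.
lemma koszul_add_koszul (X Y Z : VectorFields E M) (x : M) :
    koszul h X Y Z x + koszul h X Z Y x = mvfderiv 𝓘(ℝ, E) (fun y => h y (Y y) (Z y)) x (X x) := by
  have h1 : ∀ A B : VectorFields E M, (fun y => h y (A y) (B y)) = fun y => h y (B y) (A y) :=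
    fun A B => funext fun y => hh.symm y _ _
  simp only [koszul]
  rw [h1 Z Y, mlieBracket_swap_apply (V := Z) (W := Y), hh.neg_left]
  ring

/-- The Bismut connections are metric. -/
lemma bismut_compat {s : ℝ} (H : ThreeForm E M) {x : M} {X Y Z : VectorFields E M}
    (hX : DiffFieldAt X x) (hY : DiffFieldAt Y x) (hZ : DiffFieldAt Z x) :
    h x (bismut s h H.eval X Y x) (Z x) + h x (Y x) (bismut s h H.eval X Z x)
      = mvfderiv 𝓘(ℝ, E) (fun y => h y (Y y) (Z y)) x (X x) := by
  rw [hh.symm x (Y x), hh.bismut_apply hX hY (H.isLinearMap_eval _ _ _) hZ,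
    hh.bismut_apply hX hZ (H.isLinearMap_eval _ _ _) hY, ← hh.koszul_add_koszul]
  -- The flux terms cancel for every value of `s`, by skewness in the last two arguments.
  have : H.eval x (X x) (Y x) (Z x) = - H.eval x (X x) (Z x) (Y x) := H.skew_right x _ _ _
  rw [this]
  ring

/-- The Bismut derivative depends on the direction only through its value. -/
lemma bismut_congr_left {s : ℝ} (H : ThreeForm E M) {x : M} {X X' Y : VectorFields E M}
    (hX : DiffFieldAt X x) (hX' : DiffFieldAt X' x) (hY : DiffFieldAt Y x) (hXX' : X x = X' x) :
    bismut s h H.eval X Y x = bismut s h H.eval X' Y x := by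
  refine hh.eq_of_forall fun w => ?_
  have hw := (isSmoothFieldAt_ext w).diff
  rw [← ext_self w, hh.bismut_apply hX hY (H.isLinearMap_eval _ _ _) hw,
    hh.bismut_apply hX' hY (H.isLinearMap_eval _ _ _) hw, hXX',
    (hh.tensorialAt_koszul_left hY hw).pointwise hX hX' hXX']

lemma bismut_add_left {s : ℝ} (H : ThreeForm E M) {x : M} {X X' Y : VectorFields E M}
    (hX : DiffFieldAt X x) (hX' : DiffFieldAt X' x) (hY : DiffFieldAt Y x) :
    bismut s h H.eval (X + X') Y x = bismut s h H.eval X Y x + bismut s h H.eval X' Y x := by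
  refine hh.eq_of_forall fun w => ?_
  have hw := (isSmoothFieldAt_ext w).diff
  rw [hh.add_left, ← ext_self w, hh.bismut_apply hX hY (H.isLinearMap_eval _ _ _) hw,
    hh.bismut_apply hX' hY (H.isLinearMap_eval _ _ _) hw,
    hh.bismut_apply (mdifferentiableAt_add_section hX hX') hY (H.isLinearMap_eval _ _ _) hw,
    (hh.tensorialAt_koszul_left hY hw).add hX hX']
  rw [Pi.add_apply, H.eval_add_left]
  ring

lemma contMDiffAt_koszul {x : M} {X Y Z : VectorFields E M}
    (hX : IsSmoothFieldAt X x) (hY : IsSmoothFieldAt Y x) (hZ : IsSmoothFieldAt Z x) :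
    ContMDiffAt 𝓘(ℝ, E) 𝓘(ℝ, ℝ) ∞ (koszul h X Y Z) x := by
  have h1 := contMDiffAt_mvfderiv_apply (hh.smooth x Y Z hY hZ) hX
  have h2 := contMDiffAt_mvfderiv_apply (hh.smooth x X Z hX hZ) hY
  have h3 := contMDiffAt_mvfderiv_apply (hh.smooth x X Y hX hY) hZ
  have h4 := hh.smooth x _ _ (hX.mlieBracket hY) hZ
  have h5 := hh.smooth x _ _ (hX.mlieBracket hZ) hY
  have h6 := hh.smooth x _ _ (hY.mlieBracket hZ) hX
  exact contMDiffAt_const.mul (((((h1.add h2).sub h3).add h4).sub h5).sub h6)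

lemma isSmoothFieldAt_bismut {s : ℝ} (H : ThreeForm E M) {x : M} {X Y : VectorFields E M}
    (hX : IsSmoothFieldAt X x) (hY : IsSmoothFieldAt Y x) :
    IsSmoothFieldAt (bismut s h H.eval X Y) x := by
  refine hh.isSmoothFieldAt fun w => ?_
  have hw := isSmoothFieldAt_ext w
  refine ((hh.contMDiffAt_koszul hX hY hw).add
    ((contMDiffAt_const (c := s / 2)).mul (H.smooth x _ _ _ hX hY hw))).congr_of_eventuallyEq ?_
  filter_upwards [hX.eventually_diff, hY.eventually_diff, hw.eventually_diff] with y h1 h2 h3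
  exact hh.bismut_apply h1 h2 (H.isLinearMap_eval _ _ _) h3

end IsRiem

end Bismut

/-! ### The Courant bracket on sections and its basic identities. -/

section Courant

open VectorField Topology Filter

variable {E : Type*} [NormedAddCommGroup E] [NormedSpace ℝ E]
  {M : Type*} [TopologicalSpace M] [ChartedSpace E M] [IsManifold 𝓘(ℝ, E) ∞ M]

/-- The function `⟨[A, B]_H, C⟩`, with the derivations expanded on vector fields. -/
noncomputable def courantForm
    (H : (x : M) → TangentSpace 𝓘(ℝ, E) x → TangentSpace 𝓘(ℝ, E) x → TangentSpace 𝓘(ℝ, E) x → ℝ)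
    (A B C : GenSection E M) (x : M) : ℝ :=
  mvfderiv 𝓘(ℝ, E) (fun y => B.2 y (C.1 y)) x (A.1 x)
    - mvfderiv 𝓘(ℝ, E) (fun y => A.2 y (C.1 y)) x (B.1 x)
    + mvfderiv 𝓘(ℝ, E) (fun y => A.2 y (B.1 y)) x (C.1 x)
    - B.2 x (mlieBracket 𝓘(ℝ, E) A.1 C.1 x)
    + A.2 x (mlieBracket 𝓘(ℝ, E) B.1 C.1 x)
    + C.2 x (mlieBracket 𝓘(ℝ, E) A.1 B.1 x)
    + H x (A.1 x) (B.1 x) (C.1 x)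

/-- Sections of the generalized tangent bundle that are smooth at a point. -/
structure IsGenSectionAt (A : GenSection E M) (x : M) : Prop where
  field : IsSmoothFieldAt A.1 x
  form : IsOneFormAt A.2 x

lemma IsOneFormAt.add_form {α β : (x : M) → TangentSpace 𝓘(ℝ, E) x → ℝ} {x : M}
    (hα : IsOneFormAt α x) (hβ : IsOneFormAt β x) : IsOneFormAt (α + β) x where
  add y u v := by simp only [Pi.add_apply, hα.add, hβ.add]; ring
  smul y c u := by simp only [Pi.add_apply, hα.smul, hβ.smul]; ring
  smooth U hU := (hα.smooth U hU).add (hβ.smooth U hU)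

lemma IsOneFormAt.smul_form {α : (x : M) → TangentSpace 𝓘(ℝ, E) x → ℝ} {x : M} {f : M → ℝ}
    (hf : ContMDiffAt 𝓘(ℝ, E) 𝓘(ℝ, ℝ) ∞ f x) (hα : IsOneFormAt α x) :
    IsOneFormAt (fun y u => f y * α y u) x where
  add y u v := by simp only [hα.add]; ring
  smul y c u := by simp only [hα.smul]; ring
  smooth U hU := hf.mul (hα.smooth U hU)

lemma IsOneFormAt.const_smul {α : (x : M) → TangentSpace 𝓘(ℝ, E) x → ℝ} {x : M} (c : ℝ)
    (hα : IsOneFormAt α x) : IsOneFormAt (c • α) x := hα.smul_form contMDiffAt_const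

lemma IsGenSectionAt.add {A B : GenSection E M} {x : M} (hA : IsGenSectionAt A x)
    (hB : IsGenSectionAt B x) : IsGenSectionAt (A + B) x :=
  ⟨hA.field.add hB.field, hA.form.add_form hB.form⟩

lemma IsGenSectionAt.const_smul {A : GenSection E M} {x : M} (c : ℝ) (hA : IsGenSectionAt A x) :
    IsGenSectionAt (c • A) x := ⟨hA.field.const_smul c, hA.form.const_smul c⟩

variable [FiniteDimensional ℝ E]

/-- This removes the extension built into `lieD1`: the bracket with the test field compensates for
the derivative of its coefficient. -/
lemma tensorialAt_lieD1 {β : (x : M) → TangentSpace 𝓘(ℝ, E) x → ℝ} {x : M} (hβ : IsOneFormAt β x)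
    (X : VectorFields E M) : TensorialAt 𝓘(ℝ, E) E (fun Z : VectorFields E M =>
      mvfderiv 𝓘(ℝ, E) (fun y => β y (Z y)) x (X x) - β x (mlieBracket 𝓘(ℝ, E) X Z x)) x where
  smul {f Z} hf hZ := by
    have : CompleteSpace E := FiniteDimensional.complete ℝ E
    have h1 : (fun y => β y ((f • Z) y)) = fun y => f y * β y (Z y) :=
      funext fun y => hβ.smul y _ _
    rw [h1, mvfderiv_fun_mul hf (hβ.mdiff hZ), mlieBracket_smul_right hf hZ]
    simp only [hβ.add, hβ.smul, smul_eq_mul, add_apply, smul_apply]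
    ring
  add {Z Z'} hZ hZ' := by
    have : CompleteSpace E := FiniteDimensional.complete ℝ E
    have h1 : (fun y => β y ((Z + Z') y)) = fun y => β y (Z y) + β y (Z' y) :=
      funext fun y => hβ.add y _ _
    rw [h1, mvfderiv_fun_add (hβ.mdiff hZ) (hβ.mdiff hZ'), mlieBracket_add_right hZ hZ']
    simp only [hβ.add, add_apply]
    ring

/-- Passage from covectors tested on extensions to genuine fields. In `courantForm` all three slots
are sections, so the arguments below can permute them. -/
lemma genPairing_courant
    (H : (x : M) → TangentSpace 𝓘(ℝ, E) x → TangentSpace 𝓘(ℝ, E) x → TangentSpace 𝓘(ℝ, E) x → ℝ)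
    {A B C : GenSection E M} {x : M} (hA : IsGenSectionAt A x)
    (hB : IsGenSectionAt B x) (hC : IsGenSectionAt C x) :
    genPairing (courant H A B) C x = courantForm H A B C x := by
  have h1 := hA.form.extD1_eq hB.field.diff hC.field.diff
  have h2 := (tensorialAt_lieD1 hB.form A.1).pointwise
    (isSmoothFieldAt_ext (C.1 x)).diff hC.field.diff (ext_self (C.1 x))
  simp only [genPairing, courant, lieD1, h1, h2, courantForm]
  ring

omit [IsManifold 𝓘(ℝ, E) ∞ M] [FiniteDimensional ℝ E] in
lemma mvfderiv_add_apply' {f f' : M → ℝ} {x : M}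
    (hf : MDifferentiableAt 𝓘(ℝ, E) 𝓘(ℝ, ℝ) f x) (hf' : MDifferentiableAt 𝓘(ℝ, E) 𝓘(ℝ, ℝ) f' x)
    (u : TangentSpace 𝓘(ℝ, E) x) : mvfderiv 𝓘(ℝ, E) (fun y => f y + f' y) x u
      = mvfderiv 𝓘(ℝ, E) f x u + mvfderiv 𝓘(ℝ, E) f' x u := by
  rw [mvfderiv_fun_add hf hf', add_apply]

/-- This is the Courant algebroid axiom that the bracket with `A` differentiates the pairing. The
bracket terms and the flux are skew in the last two slots, so only the derivative of the pairing
survives. -/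
lemma courantForm_swap_right (H : ThreeForm E M) {A B C : GenSection E M} {x : M}
    (hA : IsGenSectionAt A x) (hB : IsGenSectionAt B x) (hC : IsGenSectionAt C x) :
    courantForm H.eval A B C x + courantForm H.eval A C B x
      = mvfderiv 𝓘(ℝ, E) (genPairing B C) x (A.1 x) := by
  have h1 : mvfderiv 𝓘(ℝ, E) (genPairing B C) x (A.1 x)
      = mvfderiv 𝓘(ℝ, E) (fun y => B.2 y (C.1 y)) x (A.1 x)
        + mvfderiv 𝓘(ℝ, E) (fun y => C.2 y (B.1 y)) x (A.1 x) :=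
    mvfderiv_add_apply' (hB.form.mdiff hC.field.diff) (hC.form.mdiff hB.field.diff) _
  have h2 : H.eval x (A.1 x) (B.1 x) (C.1 x) = - H.eval x (A.1 x) (C.1 x) (B.1 x) :=
    H.skew_right x _ _ _
  rw [h1, courantForm, courantForm, h2, mlieBracket_swap_apply (V := C.1) (W := B.1), hA.form.neg]
  ring

/-- The failure of skew-symmetry of the bracket is the differential of the pairing. -/
lemma courantForm_swap_left (H : ThreeForm E M) {A B C : GenSection E M} {x : M}
    (hA : IsGenSectionAt A x) (hB : IsGenSectionAt B x) (hC : IsGenSectionAt C x) :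
    courantForm H.eval A B C x + courantForm H.eval B A C x
      = mvfderiv 𝓘(ℝ, E) (genPairing A B) x (C.1 x) := by
  have h1 : mvfderiv 𝓘(ℝ, E) (genPairing A B) x (C.1 x)
      = mvfderiv 𝓘(ℝ, E) (fun y => A.2 y (B.1 y)) x (C.1 x)
        + mvfderiv 𝓘(ℝ, E) (fun y => B.2 y (A.1 y)) x (C.1 x) :=
    mvfderiv_add_apply' (hA.form.mdiff hB.field.diff) (hB.form.mdiff hA.field.diff) _
  have h2 : H.eval x (A.1 x) (B.1 x) (C.1 x) = - H.eval x (B.1 x) (A.1 x) (C.1 x) :=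
    H.skew_left x _ _ _
  rw [h1, courantForm, courantForm, h2, mlieBracket_swap_apply (V := B.1) (W := A.1), hC.form.neg]
  ring

/-- Only this slot is expanded by hand; additivity in the other two is deduced from it with the two
swap identities. -/
lemma courantForm_add_left (H : ThreeForm E M) {A A' B C : GenSection E M} {x : M}
    (hA : IsGenSectionAt A x) (hA' : IsGenSectionAt A' x) (hB : IsGenSectionAt B x)
    (hC : IsGenSectionAt C x) :
    courantForm H.eval (A + A') B C x = courantForm H.eval A B C x + courantForm H.eval A' B C x := by
  have : CompleteSpace E := FiniteDimensional.complete ℝ E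
  have h1 : ∀ D, IsGenSectionAt D x → mvfderiv 𝓘(ℝ, E) (fun y => (A + A').2 y (D.1 y)) x
      = mvfderiv 𝓘(ℝ, E) (fun y => A.2 y (D.1 y)) x
        + mvfderiv 𝓘(ℝ, E) (fun y => A'.2 y (D.1 y)) x := fun D hD =>
    mvfderiv_fun_add (hA.form.mdiff hD.field.diff) (hA'.form.mdiff hD.field.diff)
  have h2 : ∀ D, IsGenSectionAt D x → mlieBracket 𝓘(ℝ, E) (A + A').1 D.1 x
      = mlieBracket 𝓘(ℝ, E) A.1 D.1 x + mlieBracket 𝓘(ℝ, E) A'.1 D.1 x := fun D hD =>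
    mlieBracket_add_left hA.field.diff hA'.field.diff
  rw [courantForm, h1 B hB, h1 C hC, h2 B hB, h2 C hC]
  simp only [courantForm, hB.form.add, hC.form.add, Prod.fst_add, Prod.snd_add, Pi.add_apply, map_add, H.eval_add_left, add_apply]
  ring

lemma courantForm_smul_left (H : ThreeForm E M) (c : ℝ) {A B C : GenSection E M} {x : M}
    (hA : IsGenSectionAt A x) (hB : IsGenSectionAt B x) (hC : IsGenSectionAt C x) :
    courantForm H.eval (c • A) B C x = c * courantForm H.eval A B C x := by
  have : CompleteSpace E := FiniteDimensional.complete ℝ E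
  have h1 : ∀ D, IsGenSectionAt D x → mvfderiv 𝓘(ℝ, E) (fun y => (c • A).2 y (D.1 y)) x
      = c • mvfderiv 𝓘(ℝ, E) (fun y => A.2 y (D.1 y)) x := fun D hD =>
by
    refine (mvfderiv_fun_mul (mdifferentiableAt_const (c := c))
      (hA.form.mdiff hD.field.diff)).trans ?_
    rw [mvfderiv_const, smul_zero, add_zero]
  have h2 : ∀ D, IsGenSectionAt D x → mlieBracket 𝓘(ℝ, E) (c • A).1 D.1 x
      = c • mlieBracket 𝓘(ℝ, E) A.1 D.1 x := fun D hD =>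
    mlieBracket_const_smul_left hA.field.diff
  rw [courantForm, h1 B hB, h1 C hC, h2 B hB, h2 C hC]
  simp only [courantForm, hB.form.smul, hC.form.smul, Prod.smul_fst, Prod.smul_snd, Pi.smul_apply, map_smul, H.eval_smul_left, smul_apply,
    smul_eq_mul]
  ring

/-- `⟨[f (V + ξ), B]_H, C⟩` vanishes when `dξ = ι_V H`, `B` and `C` are invariant along `V` and
orthogonal to `V + ξ`. -/
lemma courantForm_eq_zero (H : ThreeForm E M) {f : M → ℝ} {V : VectorFields E M}
    {ξ : (x : M) → TangentSpace 𝓘(ℝ, E) x → ℝ} {B C : GenSection E M} {x : M}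
    (hf : MDifferentiableAt 𝓘(ℝ, E) 𝓘(ℝ, ℝ) f x) (hV : DiffFieldAt V x) (hξ : IsOneFormAt ξ x)
    (hB : IsGenSectionAt B x) (hC : IsGenSectionAt C x)
    (hd : extD1 ξ x (B.1 x) (C.1 x) = H.eval x (V x) (B.1 x) (C.1 x))
    (hVB : mlieBracket 𝓘(ℝ, E) V B.1 x = 0) (hVC : mlieBracket 𝓘(ℝ, E) V C.1 x = 0)
    (hBC : mvfderiv 𝓘(ℝ, E) (fun y => B.2 y (C.1 y)) x (V x) = 0)
    (hoB : ξ x (B.1 x) + B.2 x (V x) = 0) (hoC : ξ x (C.1 x) + C.2 x (V x) = 0) :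
    courantForm H.eval (f • V, fun y w => f y * ξ y w) B C x = 0 := by
  have : CompleteSpace E := FiniteDimensional.complete ℝ E
  rw [hξ.extD1_eq hB.field.diff hC.field.diff] at hd
  have h1 : ∀ D, IsGenSectionAt D x → mvfderiv 𝓘(ℝ, E) (fun y => f y * ξ y (D.1 y)) x
      = f x • mvfderiv 𝓘(ℝ, E) (fun y => ξ y (D.1 y)) x
        + ξ x (D.1 x) • mvfderiv 𝓘(ℝ, E) f x := fun D hD =>
    mvfderiv_fun_mul hf (hξ.mdiff hD.field.diff)
  rw [courantForm]
  dsimp only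
  rw [h1 B hB, h1 C hC, mlieBracket_smul_left hf hV, mlieBracket_smul_left hf hV, hVB, hVC]
  simp only [smul_zero, add_zero, hB.form.smul, hC.form.smul, hB.form.neg, hC.form.neg, neg_smul,
    Pi.smul_apply', map_smul, H.eval_smul_left, smul_apply, smul_eq_mul, hBC, add_apply]
  -- The part of order zero in `f` is `f (ι_V H - dξ)` on the two fields. The derivatives of `f`
  -- come multiplied by the two orthogonality relations.
  linear_combination (-f x) * hd + mvfderiv 𝓘(ℝ, E) f x (C.1 x) * hoB
    - mvfderiv 𝓘(ℝ, E) f x (B.1 x) * hoC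

end Courant


/-! ### Fundamental fields, invariant fields and infinitesimal freeness. -/

section Action

open VectorField Topology Filter

variable {EG : Type*} [NormedAddCommGroup EG] [NormedSpace ℝ EG] [FiniteDimensional ℝ EG]
  {E : Type*} [NormedAddCommGroup E] [NormedSpace ℝ E] [FiniteDimensional ℝ E]
  {G : Type*} [TopologicalSpace G] [ChartedSpace EG G] [Group G] [LieGroup 𝓘(ℝ, EG) ∞ G]
  {M : Type*} [TopologicalSpace M] [ChartedSpace E M] [IsManifold 𝓘(ℝ, E) ∞ M]
  [MulAction G M] [ContMDiffSMul 𝓘(ℝ, EG) 𝓘(ℝ, E) ∞ G M]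

omit [FiniteDimensional ℝ EG] [FiniteDimensional ℝ E] [LieGroup 𝓘(ℝ, EG) ∞ G]
  [IsManifold 𝓘(ℝ, E) ∞ M] in
variable (EG) in
include EG in
lemma contMDiff_action (a : G) : ContMDiff 𝓘(ℝ, E) 𝓘(ℝ, E) ∞ (fun y : M => a • y) :=
  (contMDiff_smul (I := 𝓘(ℝ, EG)) (I' := 𝓘(ℝ, E)) (n := ∞) (G := G) (M := M)).comp
    (contMDiff_const.prodMk contMDiff_id)

omit [FiniteDimensional ℝ EG] [FiniteDimensional ℝ E] [LieGroup 𝓘(ℝ, EG) ∞ G]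
  [IsManifold 𝓘(ℝ, E) ∞ M] in
lemma contMDiff_orbit (x : M) : ContMDiff 𝓘(ℝ, EG) 𝓘(ℝ, E) ∞ (fun a : G => a • x) :=
  (contMDiff_smul (I := 𝓘(ℝ, EG)) (I' := 𝓘(ℝ, E)) (n := ∞) (G := G) (M := M)).comp
    (contMDiff_id.prodMk contMDiff_const)

omit [FiniteDimensional ℝ EG] [FiniteDimensional ℝ E] in
-- The field is the derivative, in the group variable at `1`, of the jointly smooth family `a • y`,
-- hence smooth in the parameter `y`.
lemma isSmoothField_fund (v : GroupLieAlgebra 𝓘(ℝ, EG) G) :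
    IsSmoothField (fund v : VectorFields E M) := by
  intro x
  rw [Bundle.contMDiffAt_section]
  have hone : ∀ y : M, (1 : G) • y = y := one_smul G
  have h := ContMDiffAt.mfderiv (I := 𝓘(ℝ, EG)) (J := 𝓘(ℝ, E)) (I' := 𝓘(ℝ, E)) (m := ∞) (n := ∞)
    (x₀ := x) (fun (y : M) (a : G) => a • y) (fun _ => (1 : G))
    ((contMDiff_smul (I := 𝓘(ℝ, EG)) (I' := 𝓘(ℝ, E)) (n := ∞)).comp
      (contMDiff_snd.prodMk contMDiff_fst)).contMDiffAt contMDiffAt_const le_rfl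
  set t := trivializationAt EG (TangentSpace 𝓘(ℝ, EG) : G → Type _) (1 : G)
  have h2 := h.clm_apply (contMDiffAt_const (c := (t ⟨1, v⟩).2))
  refine h2.congr_of_eventuallyEq ?_
  filter_upwards [(trivializationAt E (TangentSpace 𝓘(ℝ, E) : M → Type _) x).open_baseSet.mem_nhds
    (FiberBundle.mem_baseSet_trivializationAt' x)] with y hy
  have hb : (1 : G) ∈ t.baseSet := FiberBundle.mem_baseSet_trivializationAt' _
  change _ = (trivializationAt E (TangentSpace 𝓘(ℝ, E)) ((1 : G) • x)).continuousLinearMapAt ℝ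
    ((1 : G) • y) (mfderiv 𝓘(ℝ, EG) 𝓘(ℝ, E) (fun a : G => a • y) 1
      (t.symmL ℝ 1 (t ⟨1, v⟩).2))
  rw [Bundle.Trivialization.symmL_apply _ hb, Bundle.Trivialization.symm_apply_apply_mk _ hb]
  have key : ∀ z w : M, z = y → w = x → ∀ u : E,
      (trivializationAt E (TangentSpace 𝓘(ℝ, E) : M → Type _) x ⟨y, u⟩).2
      = (trivializationAt E (TangentSpace 𝓘(ℝ, E) : M → Type _) w).continuousLinearMapAt ℝ z u := by
    rintro z w rfl rfl u
    exact (congrFun (Bundle.Trivialization.coe_linearMapAt_of_mem _ hy) u).symm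
  exact key _ _ (hone y) (hone x) _

omit [FiniteDimensional ℝ EG] [FiniteDimensional ℝ E] [IsManifold 𝓘(ℝ, E) ∞ M]
  [LieGroup 𝓘(ℝ, EG) ∞ G] in
/-- The derivative of a function along a fundamental vector field. -/
lemma mvfderiv_fund {V : Type*} [NormedAddCommGroup V] [NormedSpace ℝ V] {f : M → V} {x : M}
    (hf : MDifferentiableAt 𝓘(ℝ, E) 𝓘(ℝ, V) f x) (v : GroupLieAlgebra 𝓘(ℝ, EG) G) :
    mvfderiv 𝓘(ℝ, E) f x (fund v x) = mvfderiv 𝓘(ℝ, EG) (fun a : G => f (a • x)) 1 v :=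
  (mfderiv_comp_apply_of_eq (f := fun a : G => a • x) (y := x) 1 hf
    ((contMDiff_orbit x).mdifferentiable (by simp) 1) (one_smul G x) v).symm

omit [FiniteDimensional ℝ EG] [FiniteDimensional ℝ E] [IsManifold 𝓘(ℝ, E) ∞ M]
  [LieGroup 𝓘(ℝ, EG) ∞ G] in
lemma mvfderiv_fund_eq_zero {V : Type*} [NormedAddCommGroup V] [NormedSpace ℝ V] {f : M → V} {x : M}
    (hf : MDifferentiableAt 𝓘(ℝ, E) 𝓘(ℝ, V) f x) (hinv : ∀ (a : G) (y : M), f (a • y) = f y)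
    (v : GroupLieAlgebra 𝓘(ℝ, EG) G) : mvfderiv 𝓘(ℝ, E) f x (fund v x) = 0 := by
  rw [mvfderiv_fund hf]
  simp only [hinv]
  rw [mvfderiv_const]
  rfl

omit [FiniteDimensional ℝ EG] in
lemma adj_adj_inv (a : G) (v : GroupLieAlgebra 𝓘(ℝ, EG) G) : adj a (adj a⁻¹ v) = v := by
  have hd : ∀ a : G, MDifferentiable 𝓘(ℝ, EG) 𝓘(ℝ, EG) (fun b : G => a * b * a⁻¹) := fun a =>
    ((contMDiff_mul_right (I := 𝓘(ℝ, EG)) (n := ∞)).comp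
      (contMDiff_mul_left (I := 𝓘(ℝ, EG)) (n := ∞) (a := a))).mdifferentiable (by simp)
  have h := mfderiv_comp_apply_of_eq (f := fun b : G => a⁻¹ * b * a⁻¹⁻¹)
    (g := fun b : G => a * b * a⁻¹) (y := (1 : G)) 1 (hd a 1) (hd a⁻¹ 1) (by simp) v
  have h2 : ((fun b : G => a * b * a⁻¹) ∘ fun b : G => a⁻¹ * b * a⁻¹⁻¹) = id := by
    funext b
    simp [mul_assoc]
  rw [h2, mfderiv_id] at h
  exact h.symm

omit [FiniteDimensional ℝ EG] [FiniteDimensional ℝ E] [IsManifold 𝓘(ℝ, E) ∞ M] in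
-- Differentiate `b • a • x = a • (a⁻¹ b a) • x` in `b` at `1`.
lemma fund_smul (a : G) (x : M) (v : GroupLieAlgebra 𝓘(ℝ, EG) G) :
    fund (E := E) v (a • x) = actD a x (fund (adj a⁻¹ v) x) := by
  have hd : MDifferentiable 𝓘(ℝ, EG) 𝓘(ℝ, EG) (fun b : G => a⁻¹ * b * a⁻¹⁻¹) :=
    ((contMDiff_mul_right (I := 𝓘(ℝ, EG)) (n := ∞)).comp
      (contMDiff_mul_left (I := 𝓘(ℝ, EG)) (n := ∞) (a := a⁻¹))).mdifferentiable (by simp)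
  have hox : MDifferentiable 𝓘(ℝ, EG) 𝓘(ℝ, E) (fun a : G => a • x) :=
    (contMDiff_orbit x).mdifferentiable (by simp)
  have hda : MDifferentiable 𝓘(ℝ, E) 𝓘(ℝ, E) (fun y : M => a • y) :=
    (contMDiff_action EG a).mdifferentiable (by simp)
  have h1 := mfderiv_comp_apply_of_eq (I'' := 𝓘(ℝ, E)) (f := fun b : G => a⁻¹ * b * a⁻¹⁻¹)
    (g := fun b : G => b • x) (y := (1 : G)) 1 (hox 1) (hd 1) (by simp) v
  have h2 := mfderiv_comp_apply_of_eq (I := 𝓘(ℝ, EG)) (I' := 𝓘(ℝ, E)) (I'' := 𝓘(ℝ, E)) (f := (fun b : G => b • x) ∘ fun b : G => a⁻¹ * b * a⁻¹⁻¹)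
    (g := fun y : M => a • y) (y := x) 1 (hda x) ((hox _).comp 1 (hd 1)) (by simp) v
  rw [h1] at h2
  have h3 : (fun y : M => a • y) ∘ (fun b : G => b • x) ∘ (fun b : G => a⁻¹ * b * a⁻¹⁻¹)
      = fun b : G => b • a • x := by
    funext b
    simp [smul_smul, mul_assoc]
  rw [h3] at h2
  exact h2

/-- Invariance of a vector field. -/
def IsInvariantField (G : Type*) [Group G] [MulAction G M] (X : VectorFields E M) : Prop :=
  ∀ (a : G) (x : M), X (a • x) = actD a x (X x)

omit [FiniteDimensional ℝ EG] [LieGroup 𝓘(ℝ, EG) ∞ G] in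
variable (EG) in
include EG in
lemma IsInvariantField.mlieBracket {X Y : VectorFields E M} (hX : IsInvariantField G X)
    (hY : IsInvariantField G Y) {a : G} {x : M} (hdX : DiffFieldAt X x) (hdY : DiffFieldAt Y x)
    (hdX' : DiffFieldAt X (a • x)) (hdY' : DiffFieldAt Y (a • x)) :
    mlieBracket 𝓘(ℝ, E) X Y (a • x) = actD a x (mlieBracket 𝓘(ℝ, E) X Y x) :=
  (mlieBracket_related ((contMDiff_action EG a x).of_le ENat.LEInfty.out) hdX hdY hdX' hdY'
    (Eventually.of_forall fun y => (hX a y).symm)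
    (Eventually.of_forall fun y => (hY a y).symm)).symm

omit [FiniteDimensional ℝ EG] in
/-- Fundamental vector fields commute with invariant fields. -/
lemma mlieBracket_fund {X : VectorFields E M} (hX : IsInvariantField G X) {x : M}
    (hdX : DiffFieldAt X x) (v : GroupLieAlgebra 𝓘(ℝ, EG) G) :
    mlieBracket 𝓘(ℝ, E) (fund v) X x = 0 := by
  have : CompleteSpace E := FiniteDimensional.complete ℝ E
  set φ := extChartAt 𝓘(ℝ, E) x with hφ
  have hφs : ContMDiffAt 𝓘(ℝ, E) 𝓘(ℝ, E) 2 φ x := contMDiffAt_extChartAt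
  have hφd : ∀ᶠ y in 𝓝 x, MDifferentiableAt 𝓘(ℝ, E) 𝓘(ℝ, E) φ y := by
    filter_upwards [(contMDiffAt_iff_contMDiffAt_nhds (by simp)).1 hφs] with y hy
    exact ContMDiffAt.mdifferentiableAt hy (by simp)
  have h1 := mvfderiv_mlieBracket hφs ((isSmoothField_fund v).at x).diff hdX
  rw [mvfderiv_chart] at h1
  refine h1.trans (sub_eq_zero.2 ?_)
  rw [mvfderiv_fund (mdifferentiableAt_mvfderiv_apply hφs hdX).1]
  -- Invariance of `X` and the definition of the fundamental field turn the two iterated derivatives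
  -- into the two mixed partials of `(a, y) ↦ φ (a • y)` at `(1, x)`. No flow is needed.
  have hact : ContMDiffAt (𝓘(ℝ, EG).prod 𝓘(ℝ, E)) 𝓘(ℝ, E) 2
      (fun p : G × M => φ (p.1 • p.2)) (1, x) := by
    have h2 : ContMDiffAt (𝓘(ℝ, EG).prod 𝓘(ℝ, E)) 𝓘(ℝ, E) 2 (fun p : G × M => p.1 • p.2) (1, x) :=
      (contMDiff_smul (I := 𝓘(ℝ, EG)) (I' := 𝓘(ℝ, E)) (n := ∞)).contMDiffAt.of_le ENat.LEInfty.out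
    exact ContMDiffAt.comp_of_eq (g := φ) hφs h2 (one_smul G x)
  have hc := mvfderiv_mvfderiv_comm hact v (X x)
  have e1 : (fun a : G => mvfderiv 𝓘(ℝ, E) φ (a • x) (X (a • x)))
      =ᶠ[𝓝 1] fun a => mvfderiv 𝓘(ℝ, E) (fun y => φ (a • y)) x (X x) := by
    have hcont : Tendsto (fun a : G => a • x) (𝓝 1) (𝓝 x) := by
      have := (contMDiff_orbit (EG := EG) (E := E) (G := G) x).continuous.tendsto 1
      rwa [one_smul] at this
    filter_upwards [hcont.eventually hφd] with a ha
    rw [hX]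
    exact (mvfderiv_comp_vector (f := fun y : M => a • y) ha
      ((contMDiff_action EG a).mdifferentiable (by simp) x) (X x)).symm
  have e2 : (fun y => mvfderiv 𝓘(ℝ, E) φ y (fund v y))
      =ᶠ[𝓝 x] fun y => mvfderiv 𝓘(ℝ, EG) (fun a : G => φ (a • y)) 1 v := by
    filter_upwards [hφd] with y hy
    exact mvfderiv_fund hy v
  rw [mvfderiv_congr e1, mvfderiv_congr e2]
  exact hc

omit [FiniteDimensional ℝ E] in
/-- A free action is infinitesimally free. -/
lemma eq_zero_of_fund_eq_zero (hfree : ∀ (a : G) (x : M), a • x = x → a = 1) {x : M}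
    {v : GroupLieAlgebra 𝓘(ℝ, EG) G} (hv : fund v x = (0 : TangentSpace 𝓘(ℝ, E) x)) : v = 0 := by
  have : CompleteSpace EG := FiniteDimensional.complete ℝ EG
  have hL : LieGroup 𝓘(ℝ, EG) (minSmoothness ℝ 3) G := by
    simp only [minSmoothness_of_isRCLikeNormedField]
    exact LieGroup.of_le (n := ∞) ENat.LEInfty.out
  have hM1 : IsManifold 𝓘(ℝ, EG) 1 G := IsManifold.of_le (n := minSmoothness ℝ 3) (by simp)
  -- `γ` is an integral curve through `1` of the left-invariant field of `v`. The orbit map has zero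
  -- derivative along that field, so `γ t • x` is locally constant; freeness makes `γ` constant, and
  -- its velocity `v` vanishes.
  obtain ⟨γ, hγ0, hγ⟩ := exists_isMIntegralCurveAt_of_contMDiffAt_boundaryless 
    (I := 𝓘(ℝ, EG)) 0
    ((contMDiffAt_mulInvariantVectorField v (g := (1 : G))).of_le (by simp))
  have hox : MDifferentiable 𝓘(ℝ, EG) 𝓘(ℝ, E) (fun a : G => a • x) :=
    (contMDiff_orbit x).mdifferentiable (by simp)
  have hzero : ∀ a : G, mfderiv 𝓘(ℝ, EG) 𝓘(ℝ, E) (fun b : G => b • x) a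
      (mulInvariantVectorField v a) = 0 := by
    intro a
    have h1 := mfderiv_comp_apply_of_eq (f := fun b : G => a * b)
      (g := fun b : G => b • x) (y := a) 1 (hox a)
      ((contMDiff_mul_left (I := 𝓘(ℝ, EG)) (n := ∞) (a := a)).mdifferentiable (by simp) 1)
      (by simp) v
    have h2 := mfderiv_comp_apply_of_eq (f := fun b : G => b • x)
      (g := fun y : M => a • y) (y := x) 1
      ((contMDiff_action EG a).mdifferentiable (by simp) x) (hox 1)
      (by simp) v
    have h3 : (fun b : G => b • x) ∘ (fun b : G => a * b)
       = (fun y : M => a • y) ∘ (fun b : G => b • x) := by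
      funext b
      simp [smul_smul]
    have h4 : mfderiv 𝓘(ℝ, E) 𝓘(ℝ, E) (fun y : M => a • y) x
      (fund v x) = 0 := by rw [hv, map_zero]
    rw [h3] at h1
    exact h1.symm.trans (h2.trans h4)
  have hc0 : γ 0 • x = x := by rw [hγ0, one_smul]
  set φ := extChartAt 𝓘(ℝ, E) x
  have hγd := hγ.self_of_nhds
  have hcc : ContinuousAt (fun t => γ t • x) 0 := by
    have := (contMDiff_orbit (EG := EG) (E := E) (G := G) x).continuous
    exact this.continuousAt.comp hγd.continuousAt
  have hsrc : ∀ᶠ t in 𝓝 (0 : ℝ), γ t • x ∈ φ.source := by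
    refine hcc ?_
    change φ.source ∈ 𝓝 (γ 0 • x)
    rw [hc0]
    exact extChartAt_source_mem_nhds x
  -- The orbit curve is read in a chart in order to use the vector-valued criterion that a zero
  -- derivative forces constancy.
  have hder : ∀ᶠ t in 𝓝 (0 : ℝ), HasFDerivAt (fun t => φ (γ t • x)) (0 : ℝ →L[ℝ] E) t := by
    filter_upwards [hγ, hsrc] with t ht hts
    refine HasMFDerivAt.hasFDerivAt ?_
    have h1 := (hox (γ t)).hasMFDerivAt.comp t ht
    have h3 : (mfderiv 𝓘(ℝ, EG) 𝓘(ℝ, E) (fun b : G => b • x) (γ t)).comp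
        ((1 : ℝ →L[ℝ] ℝ).smulRight (mulInvariantVectorField v (γ t))) = 0 := by
      refine ContinuousLinearMap.ext fun r => ?_
      change mfderiv 𝓘(ℝ, EG) 𝓘(ℝ, E) (fun b : G => b • x) (γ t)
        ((r : ℝ) • mulInvariantVectorField v (γ t)) = 0
      rw [map_smul, hzero, smul_zero]
    have h1' := h1.congr_mfderiv h3
    have h2 := (mdifferentiableAt_extChartAt (I := 𝓘(ℝ, E))
      (by simpa [φ] using hts)).hasMFDerivAt.comp t h1'
    exact h2.congr_mfderiv (ContinuousLinearMap.comp_zero _)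
  obtain ⟨ε, hε, hball⟩ := Metric.eventually_nhds_iff_ball.1 (hder.and hsrc)
  have hconst : ∀ t ∈ Metric.ball (0 : ℝ) ε, γ t = 1 := by
    intro t ht
    have h1 := Metric.isOpen_ball.is_const_of_fderiv_eq_zero
      (convex_ball (0 : ℝ) ε).isPreconnected
      (fun t ht => (hball t ht).1.differentiableAt.differentiableWithinAt)
      (fun t ht => (hball t ht).1.fderiv) ht (Metric.mem_ball_self hε)
    refine hfree _ x ?_
    have h2 := φ.injOn (hball t ht).2 (hball 0 (Metric.mem_ball_self hε)).2 h1
    exact h2.trans hc0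
  have hγc : γ =ᶠ[𝓝 0] fun _ => 1 := by
    filter_upwards [Metric.ball_mem_nhds 0 hε] with t ht using hconst t ht
  have h5 := hγd.mfderiv
  rw [hγc.mfderiv_eq, mfderiv_const] at h5
  have h6 := DFunLike.congr_fun h5 (1 : ℝ)
  have h7 : mulInvariantVectorField v (1 : G) = v := by
    have : (fun b : G => 1 * b) = id := by funext b; simp
    rw [mulInvariantVectorField, this, mfderiv_id]
    rfl
  have key : ∀ a : G, a = 1 → (mulInvariantVectorField v a : EG) = v := by
    rintro a rfl; exact h7
  refine (key _ hγ0).symm.trans ?_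
  have h8 : (1 : ℝ) • (mulInvariantVectorField v (γ 0) : EG) = 0 := h6.symm
  rwa [one_smul] at h8

end Action


/-! ### Local sections of submersions. -/

section Submersion

open Topology Filter

variable {E : Type*} [NormedAddCommGroup E] [NormedSpace ℝ E]
  {M : Type*} [TopologicalSpace M] [ChartedSpace E M] [IsManifold 𝓘(ℝ, E) ∞ M]
  {F : Type*} [NormedAddCommGroup F] [NormedSpace ℝ F]
  {B : Type*} [TopologicalSpace B] [ChartedSpace F B] [IsManifold 𝓘(ℝ, F) ∞ B]
  {C : Type*} [NormedAddCommGroup C] [NormedSpace ℝ C]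

omit [IsManifold 𝓘(ℝ, E) ∞ M] [IsManifold 𝓘(ℝ, F) ∞ B] in
/-- Submersions have smooth local sections. -/
lemma exists_local_section {f : M → B} {x : M}
    (h : Manifold.IsSubmersionAtOfComplement C 𝓘(ℝ, E) 𝓘(ℝ, F) ∞ f x) :
    ∃ σ : B → M, ContMDiffAt 𝓘(ℝ, F) 𝓘(ℝ, E) ∞ σ (f x) ∧ σ (f x) = x ∧
      ∀ᶠ b in 𝓝 (f x), f (σ b) = b := by
  set φ := h.domChart
  set ψ := h.codChart
  set e := h.equiv
  have hx : x ∈ φ.source := h.mem_domChart_source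
  have hfx : f x ∈ ψ.source := h.mem_codChart_source
  have hw : ∀ u ∈ φ.target, ψ (f (φ.symm u)) = (e u).1 := fun u hu =>
    h.writtenInCharts (by simpa using hu)
  have he0 : ψ (f x) = (e (φ x)).1 := by
    simpa [φ.left_inv hx] using hw (φ x) (φ.map_source hx)
  have hp : e.symm (ψ (f x), (e (φ x)).2) = φ x := by
    rw [he0]
    simp
  have hψ : ContMDiffAt 𝓘(ℝ, F) 𝓘(ℝ, F) ∞ ψ (f x) :=
    (contMDiffOn_of_mem_maximalAtlas h.codChart_mem_maximalAtlas).contMDiffAt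
      (ψ.open_source.mem_nhds hfx)
  have hφ : ContMDiffAt 𝓘(ℝ, E) 𝓘(ℝ, E) ∞ φ.symm (φ x) :=
    (contMDiffOn_symm_of_mem_maximalAtlas h.domChart_mem_maximalAtlas).contMDiffAt
      (φ.open_target.mem_nhds (φ.map_source hx))
  have hin : ContMDiffAt 𝓘(ℝ, F) 𝓘(ℝ, E) ∞ (fun b => e.symm (ψ b, (e (φ x)).2)) (f x) :=
    (show ContDiff ℝ ∞ fun z : F => e.symm (z, (e (φ x)).2) by fun_prop).contMDiff.contMDiffAt.comp
      (f x) hψ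
  have hσ0 : φ.symm (e.symm (ψ (f x), (e (φ x)).2)) = x := by rw [hp, φ.left_inv hx]
  -- In adapted charts `f` is the projection of `F × C` to `F`; the section moves the first
  -- coordinate and freezes the second at its value at `x`.
  refine ⟨fun b => φ.symm (e.symm (ψ b, (e (φ x)).2)),
    ContMDiffAt.comp_of_eq (g := φ.symm) hφ hin hp, hσ0, ?_⟩
  have h1 : ∀ᶠ b in 𝓝 (f x), e.symm (ψ b, (e (φ x)).2) ∈ φ.target :=
    hin.continuousAt (φ.open_target.mem_nhds (by rw [hp]; exact φ.map_source hx))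
  filter_upwards [h1, ψ.open_source.mem_nhds hfx] with b hb hbs
  refine ψ.injOn (h.source_subset_preimage_source (φ.map_target hb)) hbs ?_
  rw [hw _ hb]
  simp

end Submersion

/-! ### Dimension of the fibres of the orbit projection. -/

section Fibre

open Topology Filter

variable {EG : Type*} [NormedAddCommGroup EG] [NormedSpace ℝ EG] [FiniteDimensional ℝ EG]
  {E : Type*} [NormedAddCommGroup E] [NormedSpace ℝ E] [FiniteDimensional ℝ E]
  {F : Type*} [NormedAddCommGroup F] [NormedSpace ℝ F]
  {G : Type*} [TopologicalSpace G] [ChartedSpace EG G] [Group G] [LieGroup 𝓘(ℝ, EG) ∞ G]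
  [CompactSpace G]
  {M : Type*} [TopologicalSpace M] [ChartedSpace E M] [IsManifold 𝓘(ℝ, E) ∞ M]
  [MulAction G M] [ContMDiffSMul 𝓘(ℝ, EG) 𝓘(ℝ, E) ∞ G M]
  [ChartedSpace F (Orb G M)] [IsManifold 𝓘(ℝ, F) ∞ (Orb G M)]
  {C : Type*} [NormedAddCommGroup C] [NormedSpace ℝ C]

variable (EG) in
include EG in
/-- The fibres of the projection to the orbit space have at most the dimension of the group. -/
lemma finrank_complement_le {x : M}
    (h : Manifold.IsSubmersionAtOfComplement C 𝓘(ℝ, E) 𝓘(ℝ, F) ∞ (proj G : M → Orb G M) x) :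
    Module.finrank ℝ C ≤ Module.finrank ℝ EG := by
  set φ := h.domChart
  set ψ := h.codChart
  set e := h.equiv
  have : FiniteDimensional ℝ C := by
    have : FiniteDimensional ℝ (F × C) := e.toLinearEquiv.finiteDimensional
    exact FiniteDimensional.of_surjective (LinearMap.snd ℝ F C) LinearMap.snd_surjective
  have hx : x ∈ φ.source := h.mem_domChart_source
  have hfx : proj G x ∈ ψ.source := h.mem_codChart_source
  have hw : ∀ u ∈ φ.target, ψ (proj G (φ.symm u)) = (e u).1 := fun u hu =>
    h.writtenInCharts (by simpa using hu)
  have he0 : ψ (proj G x) = (e (φ x)).1 := by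
    simpa [φ.left_inv hx] using hw (φ x) (φ.map_source hx)
  -- These are the fibre coordinates over the orbit of `x` that the chart sees. They fill a
  -- neighbourhood in `C`, and each of them is attained on the orbit, because the fibre is the
  -- orbit.
  let slice : Set C := {n | e.symm (ψ (proj G x), n) ∈ φ.target}
  have hslice : slice ∈ 𝓝 (e (φ x)).2 := by
    have hc : Continuous fun n : C => e.symm (ψ (proj G x), n) := by fun_prop
    refine (φ.open_target.preimage hc).mem_nhds ?_
    change e.symm (ψ (proj G x), (e (φ x)).2) ∈ φ.target
    rw [he0]
    simpa using φ.map_source hx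
  have hfib : ∀ n ∈ slice, ∃ a : G, a • x ∈ φ.source ∧ (e (φ (a • x))).2 = n := by
    intro n hn
    have h1 : proj G (φ.symm (e.symm (ψ (proj G x), n))) = proj G x := by
      refine ψ.injOn (h.source_subset_preimage_source (φ.map_target hn)) hfx ?_
      rw [hw _ hn]
      simp
    obtain ⟨a, ha⟩ := MulAction.orbitRel_apply.1 (Quotient.exact h1)
    have ha' : a • x = φ.symm (e.symm (ψ (proj G x), n)) := ha
    refine ⟨a, ?_, ?_⟩
    · rw [ha']
      exact φ.map_target hn
    · rw [ha', φ.right_inv hn]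
      simp
  -- Compactness of `G` enters here: countably many local pieces cover the relevant part of the
  -- group.
  have : SecondCountableTopology G := ChartedSpace.secondCountable_of_sigmaCompact EG G
  let q : G → C := fun a => (e (φ (a • x))).2
  let S : Set G := {a | a • x ∈ φ.source}
  -- Dimensions are compared through Hausdorff dimension. A `C¹` map does not raise it on a ball in
  -- a chart of `G`, and a countable union does not exceed the supremum. The rank of the orbit map
  -- is not needed.
  have hpiece : ∀ a ∈ S, ∃ U ∈ 𝓝 a, dimH (q '' U) ≤ Module.finrank ℝ EG := by
    intro a ha
    set χ := extChartAt 𝓘(ℝ, EG) a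
    have hq : ContMDiffAt 𝓘(ℝ, EG) 𝓘(ℝ, C) ∞ q a := by
      have hφ : ContMDiffAt 𝓘(ℝ, E) 𝓘(ℝ, E) ∞ φ (a • x) :=
        (contMDiffOn_of_mem_maximalAtlas h.domChart_mem_maximalAtlas).contMDiffAt
          (φ.open_source.mem_nhds ha)
      exact (show ContDiff ℝ ∞ fun z : E => (e z).2 by fun_prop).contMDiff.contMDiffAt.comp a
        (hφ.comp a (contMDiff_orbit x a))
    have hcd : ContDiffAt ℝ 1 (q ∘ χ.symm) (χ a) :=
      (contDiffAt_comp_chart (n := ⊤) hq).of_le (by simp)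
    obtain ⟨u, hu, hcu⟩ := hcd.contDiffOn (m := 1) le_rfl (by simp)
    obtain ⟨ε, hε, hball⟩ := Metric.mem_nhds_iff.1 hu
    refine ⟨χ.source ∩ χ ⁻¹' Metric.ball (χ a) ε, Filter.inter_mem (extChartAt_source_mem_nhds a)
      ((continuousAt_extChartAt a).preimage_mem_nhds (Metric.ball_mem_nhds _ hε)), ?_⟩
    have hsub : q '' (χ.source ∩ χ ⁻¹' Metric.ball (χ a) ε)
        ⊆ (q ∘ χ.symm) '' Metric.ball (χ a) ε := by
      rintro _ ⟨b, ⟨hb, hb'⟩, rfl⟩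
      exact ⟨χ b, hb', congrArg q (χ.left_inv hb)⟩
    refine (dimH_mono hsub).trans (((hcu.mono hball).dimH_image_le (convex_ball _ _)
      subset_rfl).trans ((dimH_mono (Set.subset_univ _)).trans ?_))
    rw [Real.dimH_univ_eq_finrank]
  choose! U hU hUd using hpiece
  obtain ⟨t, ht, htc, htS⟩ := TopologicalSpace.countable_cover_nhdsWithin
    (fun a ha => mem_nhdsWithin_of_mem_nhds (hU a ha) : ∀ a ∈ S, U a ∈ 𝓝[S] a)
  have hsub : slice ⊆ ⋃ a ∈ t, q '' U a := by
    intro n hn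
    obtain ⟨a, ha, han⟩ := hfib n hn
    obtain ⟨b, hb, hab⟩ := Set.mem_iUnion₂.1 (htS ha)
    exact Set.mem_iUnion₂.2 ⟨b, hb, a, hab, han⟩
  have h2 := dimH_mono hsub
  rw [Real.dimH_of_mem_nhds hslice, dimH_bUnion htc] at h2
  exact_mod_cast h2.trans (iSup₂_le fun a ha => hUd a (ht ha))

end Fibre

/-! ### The data of a reduction and the differential of the projection. -/

section Lift

open Topology Filter VectorField

variable {EG : Type*} [NormedAddCommGroup EG] [NormedSpace ℝ EG] [FiniteDimensional ℝ EG]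
  {E : Type*} [NormedAddCommGroup E] [NormedSpace ℝ E] [FiniteDimensional ℝ E]
  {F : Type*} [NormedAddCommGroup F] [NormedSpace ℝ F] [FiniteDimensional ℝ F]
  {G : Type*} [TopologicalSpace G] [ChartedSpace EG G] [Group G] [LieGroup 𝓘(ℝ, EG) ∞ G]
  {M : Type*} [TopologicalSpace M] [ChartedSpace E M] [IsManifold 𝓘(ℝ, E) ∞ M]
  [MulAction G M] [ContMDiffSMul 𝓘(ℝ, EG) 𝓘(ℝ, E) ∞ G M]
  [ChartedSpace F (Orb G M)] [IsManifold 𝓘(ℝ, F) ∞ (Orb G M)]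
  {g : Metric E M} {H : ThreeForm E M} {ξ : EquivariantOneForm EG G E M}

variable (F) in
/-- The data of a reduction by a free action with an equivariantly closed extension. -/
structure IsReduction (F : Type*) [NormedAddCommGroup F] [NormedSpace ℝ F]
    [ChartedSpace F (Orb G M)] [IsManifold 𝓘(ℝ, F) ∞ (Orb G M)]
    (g : Metric E M) (H : ThreeForm E M) (ξ : EquivariantOneForm EG G E M) : Prop where
  free (a : G) (x : M) (h : a • x = x) : a = 1
  submersion : Manifold.IsSubmersion 𝓘(ℝ, E) 𝓘(ℝ, F) ∞ (proj G : M → Orb G M)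
  metric : InvariantMetric G g
  flux : InvariantThreeForm G H
  closed : EquivariantlyClosed H ξ

variable (G F) in
/-- The differential of the projection to the orbit space. -/
noncomputable abbrev projD (x : M) :
    TangentSpace 𝓘(ℝ, E) x →L[ℝ] TangentSpace 𝓘(ℝ, F) (proj G x : Orb G M) :=
  mfderiv 𝓘(ℝ, E) 𝓘(ℝ, F) (proj G : M → Orb G M) x

omit [TopologicalSpace M] in
lemma proj_smul (a : G) (x : M) : proj G (a • x) = proj G x :=
  Quotient.sound (MulAction.orbitRel_apply.2 ⟨a, rfl⟩)

omit [TopologicalSpace M] in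
lemma proj_out (b : Orb G M) : proj G b.out = b := Quotient.out_eq b

omit [TopologicalSpace M] in
lemma exists_smul_eq_of_proj_eq {x y : M} (h : proj G x = proj G y) : ∃ a : G, a • y = x :=
  MulAction.orbitRel_apply.1 (Quotient.exact h)

namespace IsReduction

variable [CompactSpace G] (D : IsReduction F g H ξ)
include D

lemma contMDiff_proj : ContMDiff 𝓘(ℝ, E) 𝓘(ℝ, F) ∞ (proj G : M → Orb G M) := D.submersion.contMDiff

lemma exists_local_section (x : M) : ∃ σ : Orb G M → M,
    ContMDiffAt 𝓘(ℝ, F) 𝓘(ℝ, E) ∞ σ (proj G x) ∧ σ (proj G x) = x ∧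
      ∀ᶠ b in 𝓝 (proj G x), proj G (σ b) = b :=
  BismutReduction.exists_local_section
    (D.submersion.isSubmersionAt x).isSubmersionAtOfComplement_complement

/-- Functions on the orbit space are smooth when their pull-backs are. -/
lemma contMDiffAt_of_comp_proj {V : Type*} [NormedAddCommGroup V] [NormedSpace ℝ V]
    {f : Orb G M → V} {x : M}
    (hf : ContMDiffAt 𝓘(ℝ, E) 𝓘(ℝ, V) ∞ (fun y => f (proj G y)) x) :
    ContMDiffAt 𝓘(ℝ, F) 𝓘(ℝ, V) ∞ f (proj G x) := by
  obtain ⟨σ, hσ, hσx, hs⟩ := D.exists_local_section x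
  refine (ContMDiffAt.comp_of_eq hf hσ hσx).congr_of_eventuallyEq ?_
  filter_upwards [hs] with b hb
  change f b = f (proj G (σ b))
  rw [hb]

lemma projD_surjective (x : M) : Function.Surjective (projD (E := E) F G x) := by
  obtain ⟨σ, hσ, hσx, hs⟩ := D.exists_local_section x
  intro u
  refine ⟨mfderiv 𝓘(ℝ, F) 𝓘(ℝ, E) σ (proj G x) u, ?_⟩
  have h := mfderiv_comp_apply_of_eq (proj G x)
    (D.contMDiff_proj.mdifferentiable (by simp) x) (hσ.mdifferentiableAt (by simp)) hσx u
  have h2 : (proj G : M → Orb G M) ∘ σ =ᶠ[𝓝 (proj G x)] id := hs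
  rw [h2.mfderiv_eq, mfderiv_id] at h
  exact h.symm

lemma projD_actD (a : G) (x : M) (w : TangentSpace 𝓘(ℝ, E) x) :
    (projD (E := E) F G (a • x) (actD a x w) : F) = projD (E := E) F G x w := by
  have h := mfderiv_comp_apply x (D.contMDiff_proj.mdifferentiable (by simp) (a • x))
    ((contMDiff_action (E := E) (M := M) EG a).mdifferentiable (by simp) x) w
  have h2 : (proj G : M → Orb G M) ∘ (fun y => a • y) = proj G := funext fun y => proj_smul a y
  rw [h2] at h
  exact h.symm

lemma projD_fund (v : GroupLieAlgebra 𝓘(ℝ, EG) G) (x : M) : projD (E := E) F G x (fund v x) = 0 := by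
  have h := mfderiv_comp_apply_of_eq (1 : G) (D.contMDiff_proj.mdifferentiable (by simp) x)
    ((contMDiff_orbit (EG := EG) (E := E) x).mdifferentiable (by simp) 1) (one_smul G x) v
  have h2 : (proj G : M → Orb G M) ∘ (fun a : G => a • x) = fun _ => proj G x :=
    funext fun a => proj_smul a x
  rw [h2, mfderiv_const] at h
  exact h.symm

/-- This inequality is enough: the vertical vectors provide the opposite bound inside the kernel of
the projection. -/
lemma finrank_eq (x : M) : Module.finrank ℝ E ≤ Module.finrank ℝ F + Module.finrank ℝ EG := by
  have h := (D.submersion.isSubmersionAt x).isSubmersionAtOfComplement_complement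
  have h1 := finrank_complement_le EG h
  have h2 := h.equiv.toLinearEquiv.finrank_eq
  have : FiniteDimensional ℝ (D.submersion.isSubmersionAt x).complement := by
    have : FiniteDimensional ℝ (F × (D.submersion.isSubmersionAt x).complement) :=
      h.equiv.toLinearEquiv.finiteDimensional
    exact FiniteDimensional.of_surjective (LinearMap.snd ℝ F _) LinearMap.snd_surjective
  rw [Module.finrank_prod] at h2
  omega

end IsReduction

end Lift


/-! ### Horizontal lifts to `τ_±`: existence, uniqueness, invariance, smoothness. -/

section Lift

open Topology Filter VectorField

variable {EG : Type*} [NormedAddCommGroup EG] [NormedSpace ℝ EG] [FiniteDimensional ℝ EG]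
  {E : Type*} [NormedAddCommGroup E] [NormedSpace ℝ E] [FiniteDimensional ℝ E]
  {F : Type*} [NormedAddCommGroup F] [NormedSpace ℝ F] [FiniteDimensional ℝ F]
  {G : Type*} [TopologicalSpace G] [ChartedSpace EG G] [Group G] [LieGroup 𝓘(ℝ, EG) ∞ G]
  {M : Type*} [TopologicalSpace M] [ChartedSpace E M] [IsManifold 𝓘(ℝ, E) ∞ M]
  [MulAction G M] [ContMDiffSMul 𝓘(ℝ, EG) 𝓘(ℝ, E) ∞ G M]
  [ChartedSpace F (Orb G M)] [IsManifold 𝓘(ℝ, F) ∞ (Orb G M)]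
  {g : Metric E M} {H : ThreeForm E M} {ξ : EquivariantOneForm EG G E M}

lemma isOneFormAt_eval (ξ : EquivariantOneForm EG G E M) (v : GroupLieAlgebra 𝓘(ℝ, EG) G) (x : M) :
    IsOneFormAt (ξ.eval v) x where
  add y := map_add (ξ.toLin v y)
  smul y := map_smul (ξ.toLin v y)
  smooth U hU := ξ.smooth v x U hU

lemma pair_fundPM (s : ℝ) (v : GroupLieAlgebra 𝓘(ℝ, EG) G) (x : M)
    (w : TangentSpace 𝓘(ℝ, E) x) :
    pair g x (fundPM s g ξ v x) w = pair g x (fund v x) w + s * ξ.eval v x w := by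
  rw [fundPM, (isRiem_pair g).add_left, (isRiem_pair g).smul_left]
  congr 2
  exact (isRiem_pair g).sharp_spec ((isOneFormAt_eval ξ v x).toLin x) w

lemma isSmoothField_fundPM (s : ℝ) (v : GroupLieAlgebra 𝓘(ℝ, EG) G) :
    IsSmoothField (fundPM s g ξ v) := fun x =>
  ((isSmoothField_fund v).at x).add
    (((isRiem_pair g).isSmoothFieldAt_sharp (isOneFormAt_eval ξ v x)).const_smul s)

/-- The metric dual absorbs the `ξ`-term into `V_v^±`, so the distribution is an orthogonal
complement. In this form it can be combined with orthogonal projection and with metric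
compatibility. -/
lemma mem_tau_iff {s : ℝ} {x : M} {w : TangentSpace 𝓘(ℝ, E) x} :
    w ∈ tau s g ξ x ↔ ∀ v, pair g x (fundPM s g ξ v x) w = 0 := by
  simp only [pair_fundPM, (isRiem_pair g).symm x (fund _ x) w]
  rfl

variable (EG E G) in
/-- The infinitesimal action at a point, as a linear map. -/
noncomputable def fundL (x : M) : GroupLieAlgebra 𝓘(ℝ, EG) G →ₗ[ℝ] TangentSpace 𝓘(ℝ, E) x :=
  ((mfderiv 𝓘(ℝ, EG) 𝓘(ℝ, E) (fun a : G => a • x) (1 : G)).toLinearMap : EG →ₗ[ℝ] E)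

lemma fundL_apply (x : M) (v : GroupLieAlgebra 𝓘(ℝ, EG) G) : fundL EG E G x v = fund v x := rfl

/-- The linear equations of the distributions `τ_±`. -/
noncomputable def tauForm (s : ℝ) (g : Metric E M) (ξ : EquivariantOneForm EG G E M) (x : M) :
    TangentSpace 𝓘(ℝ, E) x →ₗ[ℝ] Module.Dual ℝ (GroupLieAlgebra 𝓘(ℝ, EG) G) :=
  LinearMap.mk₂ ℝ (fun w v => pair g x w (fund v x) + s * ξ.eval v x w)
    (fun w w' v => by
      simp only [(isRiem_pair g).add_left, (isOneFormAt_eval ξ v x).add]; ring)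
    (fun c w v => by
      simp only [(isRiem_pair g).smul_left, (isOneFormAt_eval ξ v x).smul, smul_eq_mul]; ring)
    (fun w v v' => by
      have h1 : ξ.eval (v + v') x w = ξ.eval v x w + ξ.eval v' x w :=
        DFunLike.congr_fun (congrFun (map_add ξ.toLin v v') x) w
      simp only [← fundL_apply, map_add, (isRiem_pair g).add_right, h1]; ring)
    (fun c w v => by
      have h1 : ξ.eval (c • v) x w = c * ξ.eval v x w :=
        DFunLike.congr_fun (congrFun (map_smul ξ.toLin c v) x) w
      simp only [← fundL_apply, map_smul, (isRiem_pair g).smul_right, h1, smul_eq_mul]; ring)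

lemma mem_tau_iff_tauForm {s : ℝ} {x : M} {w : TangentSpace 𝓘(ℝ, E) x} :
    w ∈ tau s g ξ x ↔ tauForm s g ξ x w = 0 :=
  ⟨fun h => LinearMap.ext h, fun h v => LinearMap.congr_fun h v⟩

namespace IsReduction

variable [CompactSpace G] (D : IsReduction F g H ξ)
include D

lemma fundL_injective (x : M) : Function.Injective (fundL EG E G x) :=
  (injective_iff_map_eq_zero _).2 fun _ hv => eq_zero_of_fund_eq_zero D.free hv

/-- The kernel of the projection to the orbit space consists of the vertical vectors. -/
lemma exists_fund_of_projD_eq_zero {x : M} {w : TangentSpace 𝓘(ℝ, E) x}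
    (hw : projD (E := E) F G x w = 0) : ∃ v : GroupLieAlgebra 𝓘(ℝ, EG) G, w = fund v x := by
  have : FiniteDimensional ℝ (TangentSpace 𝓘(ℝ, E) x) := inferInstanceAs (FiniteDimensional ℝ E)
  have h1 := LinearMap.finrank_range_of_inj (D.fundL_injective x)
  have h2 := (projD (E := E) F G x).toLinearMap.finrank_range_add_finrank_ker
  rw [LinearMap.range_eq_top.2 (D.projD_surjective x), finrank_top] at h2
  have h3 := D.finrank_eq x
  -- Vertical vectors lie in the kernel and form a space of the dimension of `G`; the bound on the
  -- fibres leaves no room for more.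
  have hle : LinearMap.range (fundL EG E G x)
      ≤ LinearMap.ker (projD (E := E) F G x).toLinearMap := by
    rintro _ ⟨v, rfl⟩
    exact D.projD_fund v x
  have h4 : Module.finrank ℝ (LinearMap.ker (projD (E := E) F G x).toLinearMap)
      ≤ Module.finrank ℝ (LinearMap.range (fundL EG E G x)) := by
    rw [h1]
    change Module.finrank ℝ F + _ = Module.finrank ℝ E at h2
    change _ ≤ Module.finrank ℝ EG
    omega
  have h5 : w ∈ LinearMap.range (fundL EG E G x) := by
    rw [Submodule.eq_of_le_of_finrank_le hle h4]
    exact hw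
  obtain ⟨v, hv⟩ := h5
  exact ⟨v, hv.symm⟩

omit [CompactSpace G] [FiniteDimensional ℝ F] in
-- Testing the equation of `τ_±` on the same `v`, isotropy removes `ξ_v(V_v)` and leaves `|V_v|² =
-- 0`. Thus `τ_±` meets the vertical space trivially.
lemma fund_eq_zero_of_mem_tau {s : ℝ} {x : M} {v : GroupLieAlgebra 𝓘(ℝ, EG) G}
    (h : fund v x ∈ tau s g ξ x) : fund v x = (0 : TangentSpace 𝓘(ℝ, E) x) := by
  have h1 := h v
  rw [D.closed.isotropic, mul_zero, add_zero] at h1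
  exact (isRiem_pair g).eq_zero_of_self h1

lemma eq_zero_of_mem_tau {s : ℝ} {x : M} {w : TangentSpace 𝓘(ℝ, E) x}
    (h : w ∈ tau s g ξ x) (hw : projD (E := E) F G x w = 0) : w = 0 := by
  obtain ⟨v, rfl⟩ := D.exists_fund_of_projD_eq_zero hw
  exact D.fund_eq_zero_of_mem_tau h

/-- Any preimage is corrected by a vertical vector. The equations of `τ_±` restricted to vertical
vectors form a square system from `𝔤` to its dual, and it is injective by isotropy and freeness. -/
lemma exists_mem_tau (s : ℝ) (x : M) (u : TangentSpace 𝓘(ℝ, F) (proj G x : Orb G M)) :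
    ∃ w ∈ tau s g ξ x, projD (E := E) F G x w = u := by
  have : FiniteDimensional ℝ (GroupLieAlgebra 𝓘(ℝ, EG) G) :=
    inferInstanceAs (FiniteDimensional ℝ EG)
  obtain ⟨w, hw⟩ := D.projD_surjective x u
  have hinj : Function.Injective (tauForm s g ξ x ∘ₗ fundL EG E G x) := by
    refine (injective_iff_map_eq_zero _).2 fun v hv => ?_
    exact eq_zero_of_fund_eq_zero D.free
      (D.fund_eq_zero_of_mem_tau (s := s) (mem_tau_iff_tauForm.2 hv))
  have hdim : Module.finrank ℝ (GroupLieAlgebra 𝓘(ℝ, EG) G)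
      = Module.finrank ℝ (Module.Dual ℝ (GroupLieAlgebra 𝓘(ℝ, EG) G)) :=
    (Subspace.dual_finrank_eq).symm
  obtain ⟨v, hv⟩ := (LinearMap.injective_iff_surjective_of_finrank_eq_finrank hdim).1 hinj
    (tauForm s g ξ x w)
  refine ⟨w - fund v x, mem_tau_iff_tauForm.2 ?_, ?_⟩
  · rw [map_sub, ← hv]
    exact sub_self _
  · rw [map_sub, D.projD_fund, hw, sub_zero]

lemma hlift_spec (s : ℝ) (X : VectorFields F (Orb G M)) (x : M) :
    hlift s g ξ X x ∈ tau s g ξ x ∧ projD (E := E) F G x (hlift s g ξ X x) = X (proj G x) := by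
  obtain ⟨w, hw⟩ := D.exists_mem_tau s x (X (proj G x))
  exact Classical.epsilon_spec (p := fun w : TangentSpace 𝓘(ℝ, E) x =>
    w ∈ tau s g ξ x ∧ mfderiv 𝓘(ℝ, E) 𝓘(ℝ, F) (proj G : M → Orb G M) x w = X (proj G x)) ⟨w, hw⟩

lemma hlift_mem (s : ℝ) (X : VectorFields F (Orb G M)) (x : M) :
    hlift s g ξ X x ∈ tau s g ξ x := (D.hlift_spec s X x).1

lemma projD_hlift (s : ℝ) (X : VectorFields F (Orb G M)) (x : M) :
    projD (E := E) F G x (hlift s g ξ X x) = X (proj G x) := (D.hlift_spec s X x).2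

lemma eq_of_mem_tau {s : ℝ} {x : M} {w w' : TangentSpace 𝓘(ℝ, E) x} (hw : w ∈ tau s g ξ x)
    (hw' : w' ∈ tau s g ξ x) (h : projD (E := E) F G x w = projD (E := E) F G x w') : w = w' := by
  refine sub_eq_zero.1 (D.eq_zero_of_mem_tau (s := s) ?_ ?_)
  · rw [mem_tau_iff_tauForm] at hw hw' ⊢
    rw [map_sub, hw, hw', sub_zero]
  · rw [map_sub, h, sub_self]

lemma eq_hlift {s : ℝ} {X : VectorFields F (Orb G M)} {x : M} {w : TangentSpace 𝓘(ℝ, E) x}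
    (hw : w ∈ tau s g ξ x) (h : projD (E := E) F G x w = X (proj G x)) : w = hlift s g ξ X x :=
  D.eq_of_mem_tau hw (D.hlift_mem s X x) (h.trans (D.projD_hlift s X x).symm)

lemma hlift_congr (s : ℝ) {X Y : VectorFields F (Orb G M)} {x : M}
    (h : X (proj G x) = Y (proj G x)) : hlift s g ξ X x = hlift s g ξ Y x :=
  D.eq_hlift (D.hlift_mem s X x) ((D.projD_hlift s X x).trans h)

lemma hlift_add (s : ℝ) (X Y : VectorFields F (Orb G M)) (x : M) :
    hlift s g ξ (X + Y) x = hlift s g ξ X x + hlift s g ξ Y x := by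
  refine (D.eq_hlift ?_ ?_).symm
  · have h1 := mem_tau_iff_tauForm.1 (D.hlift_mem s X x)
    have h2 := mem_tau_iff_tauForm.1 (D.hlift_mem s Y x)
    rw [mem_tau_iff_tauForm, map_add, h1, h2, add_zero]
  · rw [map_add, D.projD_hlift, D.projD_hlift]
    rfl

lemma hlift_smul (s c : ℝ) (X : VectorFields F (Orb G M)) (x : M) :
    hlift s g ξ (c • X) x = c • hlift s g ξ X x := by
  refine (D.eq_hlift ?_ ?_).symm
  · have h1 := mem_tau_iff_tauForm.1 (D.hlift_mem s X x)
    rw [mem_tau_iff_tauForm, map_smul, h1, smul_zero]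
  · rw [map_smul, D.projD_hlift]
    rfl

/-- By equivariance, testing against `v` at `a • x` is the same as testing against `Ad_{a⁻¹} v` at
`x`, for the metric term and for `ξ` alike. -/
lemma actD_mem_tau {s : ℝ} {x : M} {w : TangentSpace 𝓘(ℝ, E) x} (hw : w ∈ tau s g ξ x) (a : G) :
    actD a x w ∈ tau s g ξ (a • x) := by
  intro v
  have h1 := hw (adj a⁻¹ v)
  have h2 : ξ.eval v (a • x) (actD a x w) = ξ.eval (adj a⁻¹ v) x w := by
    have := ξ.equivariant a (adj a⁻¹ v) x w
    rwa [adj_adj_inv] at this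
  rw [fund_smul, h2, D.metric]
  exact h1

lemma isInvariantField_hlift (s : ℝ) (X : VectorFields F (Orb G M)) :
    IsInvariantField G (hlift s g ξ X) := by
  intro a x
  refine (D.eq_hlift (D.actD_mem_tau (D.hlift_mem s X x) a) ?_).symm
  have key : ∀ b b' : Orb G M, b = b' → (X b : F) = X b' := by rintro b _ rfl; rfl
  refine (D.projD_actD a x _).trans ?_
  rw [D.projD_hlift]
  exact key _ _ (proj_smul a x).symm

/-- The lift is chosen pointwise, but it solves a linear system with smooth coefficients: a
prescribed projection, read in a chart of the orbit space, and the equations of `τ_±`. The system is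
injective because `τ_±` contains no nonzero vertical vector. -/
lemma isSmoothFieldAt_hlift (s : ℝ) {X : VectorFields F (Orb G M)} {x : M}
    (hX : IsSmoothFieldAt X (proj G x)) : IsSmoothFieldAt (hlift s g ξ X) x := by
  have : FiniteDimensional ℝ (GroupLieAlgebra 𝓘(ℝ, EG) G) :=
    inferInstanceAs (FiniteDimensional ℝ EG)
  let e := Module.finBasis ℝ (GroupLieAlgebra 𝓘(ℝ, EG) G)
  set ψ := extChartAt 𝓘(ℝ, F) (proj G x : Orb G M)
  have hψ : ContMDiffAt 𝓘(ℝ, F) 𝓘(ℝ, F) ∞ ψ (proj G x) := contMDiffAt_extChartAt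
  have hψπ : ContMDiffAt 𝓘(ℝ, E) 𝓘(ℝ, F) ∞ (fun y : M => ψ (proj G y)) x :=
    hψ.comp x (D.contMDiff_proj x)
  have hψd : ∀ᶠ y in 𝓝 x, MDifferentiableAt 𝓘(ℝ, F) 𝓘(ℝ, F) ψ (proj G y : Orb G M) := by
    have h1 : ∀ᶠ b in 𝓝 (proj G x : Orb G M), MDifferentiableAt 𝓘(ℝ, F) 𝓘(ℝ, F) ψ b := by
      filter_upwards [(contMDiffAt_iff_contMDiffAt_nhds (by simp)).1
        (hψ.of_le (m := 1) (by simp))] with b hb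
      exact ContMDiffAt.mdifferentiableAt hb (by simp)
    exact D.contMDiff_proj.continuous.continuousAt.eventually h1
  have hchain : ∀ᶠ y in 𝓝 x, ∀ w : TangentSpace 𝓘(ℝ, E) y,
      mvfderiv 𝓘(ℝ, E) (fun y : M => ψ (proj G y)) y w
        = mvfderiv 𝓘(ℝ, F) ψ (proj G y) (projD (E := E) F G y w) := by
    filter_upwards [hψd] with y hy w
    exact mvfderiv_comp_vector hy (D.contMDiff_proj.mdifferentiable (by simp) y) w
  have hcoord : ∀ {W : VectorFields E M}, IsSmoothFieldAt W x → ∀ i,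
      ContMDiffAt 𝓘(ℝ, E) 𝓘(ℝ, ℝ) ∞ (fun y => tauForm s g ξ y (W y) (e i)) x := fun hW i =>
    ((isRiem_pair g).smooth x _ _ hW ((isSmoothField_fund (e i)).at x)).add
      (contMDiffAt_const.mul (ξ.smooth (e i) x _ hW))
  refine isSmoothFieldAt_of_injective
    (V := F × (Fin (Module.finrank ℝ (GroupLieAlgebra 𝓘(ℝ, EG) G)) → ℝ))
    (fun y => (mvfderiv 𝓘(ℝ, E) (fun y : M => ψ (proj G y)) y).toLinearMap.prod
      (LinearMap.pi fun i => LinearMap.applyₗ (e i) ∘ₗ tauForm s g ξ y)) ?_ ?_ ?_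
  · intro w
    refine (contMDiffAt_mvfderiv_apply hψπ (isSmoothFieldAt_ext w)).prodMk_space ?_
    rw [contMDiffAt_pi_space]
    exact hcoord (isSmoothFieldAt_ext w)
  · refine (injective_iff_map_eq_zero _).2 fun w hw => ?_
    obtain ⟨h1, h2⟩ := Prod.ext_iff.1 hw
    refine D.eq_zero_of_mem_tau (s := s) (mem_tau_iff_tauForm.2 (e.ext fun i => ?_)) ?_
    · exact congrFun h2 i
    · have h3 := hchain.self_of_nhds w
      rw [mvfderiv_chart] at h3
      exact h3.symm.trans h1
  · refine ContMDiffAt.prodMk_space ?_ ?_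
    · refine ((contMDiffAt_mvfderiv_apply hψ hX).comp x (D.contMDiff_proj x)).congr_of_eventuallyEq ?_
      filter_upwards [hchain] with y hy
      refine (hy _).trans ?_
      rw [D.projD_hlift]
      rfl
    · rw [contMDiffAt_pi_space]
      intro i
      refine (contMDiffAt_const (c := (0 : ℝ))).congr_of_eventuallyEq (Eventually.of_forall fun y => ?_)
      exact LinearMap.congr_fun (mem_tau_iff_tauForm.1 (D.hlift_mem s X y)) (e i)

end IsReduction

end Lift


/-! ### Additivity of the Courant expression and its values on pure one-forms. -/

section CourantForm

open Topology Filter VectorField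

variable {E : Type*} [NormedAddCommGroup E] [NormedSpace ℝ E] [FiniteDimensional ℝ E]
  {M : Type*} [TopologicalSpace M] [ChartedSpace E M] [IsManifold 𝓘(ℝ, E) ∞ M]

lemma mvfderiv_const_mul_apply {f : M → ℝ} {x : M} (c : ℝ)
    (hf : MDifferentiableAt 𝓘(ℝ, E) 𝓘(ℝ, ℝ) f x) (u : TangentSpace 𝓘(ℝ, E) x) :
    mvfderiv 𝓘(ℝ, E) (fun y => c * f y) x u = c * mvfderiv 𝓘(ℝ, E) f x u := by
  rw [mvfderiv_fun_mul (mdifferentiableAt_const (c := c)) hf, mvfderiv_const, smul_zero, add_zero]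
  rfl

lemma courantForm_add_middle (H : ThreeForm E M) {A B B' C : GenSection E M} {x : M}
    (hA : IsGenSectionAt A x) (hB : IsGenSectionAt B x) (hB' : IsGenSectionAt B' x)
    (hC : IsGenSectionAt C x) :
    courantForm H.eval A (B + B') C x = courantForm H.eval A B C x + courantForm H.eval A B' C x := by
  have h1 := courantForm_swap_left H hA (hB.add hB') hC
  have h2 := courantForm_swap_left H hA hB hC
  have h3 := courantForm_swap_left H hA hB' hC
  have h4 : mvfderiv 𝓘(ℝ, E) (genPairing A (B + B')) x (C.1 x)
      = mvfderiv 𝓘(ℝ, E) (genPairing A B) x (C.1 x)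
        + mvfderiv 𝓘(ℝ, E) (genPairing A B') x (C.1 x) := by
    refine Eq.trans ?_ (mvfderiv_add_apply'
      ((hA.form.mdiff hB.field.diff).add (hB.form.mdiff hA.field.diff))
      ((hA.form.mdiff hB'.field.diff).add (hB'.form.mdiff hA.field.diff)) _)
    congr 2
    funext y
    simp only [genPairing, Prod.fst_add, Prod.snd_add, Pi.add_apply, hA.form.add]
    change _ = A.2 y (B.1 y) + B.2 y (A.1 y) + (A.2 y (B'.1 y) + B'.2 y (A.1 y))
    ring
  rw [courantForm_add_left H hB hB' hA hC] at h1
  linarith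

lemma courantForm_add_right (H : ThreeForm E M) {A B C C' : GenSection E M} {x : M}
    (hA : IsGenSectionAt A x) (hB : IsGenSectionAt B x) (hC : IsGenSectionAt C x)
    (hC' : IsGenSectionAt C' x) :
    courantForm H.eval A B (C + C') x = courantForm H.eval A B C x + courantForm H.eval A B C' x := by
  have h1 := courantForm_swap_right H hA hB (hC.add hC')
  have h2 := courantForm_swap_right H hA hB hC
  have h3 := courantForm_swap_right H hA hB hC'
  have h4 : mvfderiv 𝓘(ℝ, E) (genPairing B (C + C')) x (A.1 x)
      = mvfderiv 𝓘(ℝ, E) (genPairing B C) x (A.1 x)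
        + mvfderiv 𝓘(ℝ, E) (genPairing B C') x (A.1 x) := by
    refine Eq.trans ?_ (mvfderiv_add_apply'
      ((hB.form.mdiff hC.field.diff).add (hC.form.mdiff hB.field.diff))
      ((hB.form.mdiff hC'.field.diff).add (hC'.form.mdiff hB.field.diff)) _)
    congr 2
    funext y
    simp only [genPairing, Prod.fst_add, Prod.snd_add, Pi.add_apply, hB.form.add]
    change _ = B.2 y (C.1 y) + C.2 y (B.1 y) + (B.2 y (C'.1 y) + C'.2 y (B.1 y))
    ring
  rw [courantForm_add_middle H hA hC hC' hB] at h1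
  linarith

lemma isGenSectionAt_zero (x : M) : IsGenSectionAt (0 : GenSection E M) x where
  field := ContMDiffAt.congr_of_eventuallyEq
    (IsSmoothFieldAt.const_smul 0 (isSmoothFieldAt_ext (0 : TangentSpace 𝓘(ℝ, E) x)))
    (Eventually.of_forall fun y => by simp)
  form := ⟨fun y u v => by simp, fun y c u => by simp, fun U hU => contMDiffAt_const⟩

lemma IsGenSectionAt.sum {ι : Type*} {s : Finset ι} {A : ι → GenSection E M} {x : M}
    (hA : ∀ i, IsGenSectionAt (A i) x) : IsGenSectionAt (∑ i ∈ s, A i) x :=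
  Finset.sum_induction _ (fun A => IsGenSectionAt A x) (fun _ _ => IsGenSectionAt.add)
    (isGenSectionAt_zero x) (fun i _ => hA i)

lemma courantForm_sum_left_eq_zero (H : ThreeForm E M) {ι : Type*} {s : Finset ι}
    {A : ι → GenSection E M} {B C : GenSection E M} {x : M} (hA : ∀ i, IsGenSectionAt (A i) x)
    (hB : IsGenSectionAt B x) (hC : IsGenSectionAt C x)
    (h : ∀ i, courantForm H.eval (A i) B C x = 0) :
    courantForm H.eval (∑ i ∈ s, A i) B C x = 0 := by
  classical
  induction s using Finset.induction_on with
  | empty =>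
    have := courantForm_smul_left H 0 (isGenSectionAt_zero x) hB hC
    simpa using this
  | insert i s hi ih =>
    rw [Finset.sum_insert hi, courantForm_add_left H (hA i) (IsGenSectionAt.sum hA) hB hC, h, ih,
      add_zero]

/-- The result is `-dα(B, C)`: a section without vector part does not meet the flux. In the middle
slot a form contributes its Lie derivative, and in the right slot its value on the bracket of the
vector parts. -/
lemma courantForm_form_left (H : ThreeForm E M) (α : (x : M) → TangentSpace 𝓘(ℝ, E) x → ℝ)
    {B C : GenSection E M} {x : M} (hB : IsGenSectionAt B x) (hC : IsGenSectionAt C x) :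
    courantForm H.eval (0, α) B C x
      = - mvfderiv 𝓘(ℝ, E) (fun y => α y (C.1 y)) x (B.1 x)
        + mvfderiv 𝓘(ℝ, E) (fun y => α y (B.1 y)) x (C.1 x)
        + α x (mlieBracket 𝓘(ℝ, E) B.1 C.1 x) := by
  have h0 : H.eval x 0 (B.1 x) (C.1 x) = 0 := by simpa using H.eval_smul_left x 0 0 (B.1 x) (C.1 x)
  have h1 : ∀ W : VectorFields E M, mlieBracket 𝓘(ℝ, E) (0 : VectorFields E M) W x = 0 :=
    fun W => by rw [mlieBracket_zero_left]; rfl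
  simp only [courantForm, h1, Pi.zero_apply, map_zero, h0, hB.form.zero, hC.form.zero]
  ring

lemma courantForm_form_middle (H : ThreeForm E M) (β : (x : M) → TangentSpace 𝓘(ℝ, E) x → ℝ)
    {A C : GenSection E M} {x : M} (hA : IsGenSectionAt A x) (hC : IsGenSectionAt C x) :
    courantForm H.eval A (0, β) C x
      = mvfderiv 𝓘(ℝ, E) (fun y => β y (C.1 y)) x (A.1 x)
        - β x (mlieBracket 𝓘(ℝ, E) A.1 C.1 x) := by
  have h0 : H.eval x (A.1 x) 0 (C.1 x) = 0 := by
    have h : H.eval x (A.1 x) 0 (C.1 x) = - H.eval x 0 (A.1 x) (C.1 x) := H.skew_left x _ _ _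
    rw [h]
    simpa using H.eval_smul_left x 0 0 (A.1 x) (C.1 x)
  have h1 : ∀ W : VectorFields E M, mlieBracket 𝓘(ℝ, E) (0 : VectorFields E M) W x = 0 :=
    fun W => by rw [mlieBracket_zero_left]; rfl
  have h2 : ∀ W : VectorFields E M, mlieBracket 𝓘(ℝ, E) W (0 : VectorFields E M) x = 0 :=
    fun W => by rw [mlieBracket_zero_right]; rfl
  have h3 : (fun y => A.2 y ((0 : VectorFields E M) y)) = fun _ => 0 :=
    funext fun y => hA.form.zero y
  rw [courantForm]
  dsimp only
  rw [h3]
  simp only [h1, h2, mvfderiv_const, Pi.zero_apply, map_zero, h0, hA.form.zero,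
    hC.form.zero]
  simp

lemma courantForm_form_right (H : ThreeForm E M) (γ : (x : M) → TangentSpace 𝓘(ℝ, E) x → ℝ)
    {A B : GenSection E M} {x : M} (hA : IsGenSectionAt A x) (hB : IsGenSectionAt B x) :
    courantForm H.eval A B (0, γ) x = γ x (mlieBracket 𝓘(ℝ, E) A.1 B.1 x) := by
  have h0 : H.eval x (A.1 x) (B.1 x) 0 = 0 := (H.isLinearMap_eval x _ _).map_zero
  have h2 : ∀ W : VectorFields E M, mlieBracket 𝓘(ℝ, E) W (0 : VectorFields E M) x = 0 :=
    fun W => by rw [mlieBracket_zero_right]; rfl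
  have h3 : (fun y => A.2 y ((0 : VectorFields E M) y)) = fun _ => 0 :=
    funext fun y => hA.form.zero y
  have h4 : (fun y => B.2 y ((0 : VectorFields E M) y)) = fun _ => 0 :=
    funext fun y => hB.form.zero y
  rw [courantForm]
  dsimp only
  rw [h3, h4]
  simp only [h2, mvfderiv_const, Pi.zero_apply, map_zero, h0, hA.form.zero,
    hB.form.zero]
  simp

end CourantForm

/-! ### Basic sections and insensitivity to the sections `V_v + ξ_v`. -/

section Basic

open Topology Filter VectorField

variable {EG : Type*} [NormedAddCommGroup EG] [NormedSpace ℝ EG] [FiniteDimensional ℝ EG]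
  {E : Type*} [NormedAddCommGroup E] [NormedSpace ℝ E] [FiniteDimensional ℝ E]
  {G : Type*} [TopologicalSpace G] [ChartedSpace EG G] [Group G] [LieGroup 𝓘(ℝ, EG) ∞ G]
  {M : Type*} [TopologicalSpace M] [ChartedSpace E M] [IsManifold 𝓘(ℝ, E) ∞ M]
  [MulAction G M] [ContMDiffSMul 𝓘(ℝ, EG) 𝓘(ℝ, E) ∞ G M]
  {H : ThreeForm E M} {ξ : EquivariantOneForm EG G E M}

variable (EG) in
include EG in
/-- Derivatives of invariant functions are invariant. -/
lemma mvfderiv_actD {f : M → ℝ} {a : G} {x : M} (hinv : ∀ y, f (a • y) = f y)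
    (hf : MDifferentiableAt 𝓘(ℝ, E) 𝓘(ℝ, ℝ) f (a • x)) (w : TangentSpace 𝓘(ℝ, E) x) :
    mvfderiv 𝓘(ℝ, E) f (a • x) (actD a x w) = mvfderiv 𝓘(ℝ, E) f x w := by
  have h := mvfderiv_comp_vector (f := fun y : M => a • y) hf
    ((contMDiff_action EG a).mdifferentiable (by simp) x) w
  simp only [hinv] at h
  exact h.symm

/-- Invariant sections of `TM ⊕ T*M` that are orthogonal to the sections `V_v + ξ_v`. -/
structure IsBasic (ξ : EquivariantOneForm EG G E M) (A : GenSection E M) : Prop where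
  field : IsInvariantField G A.1
  form (a : G) (x : M) (w : TangentSpace 𝓘(ℝ, E) x) : A.2 (a • x) (actD a x w) = A.2 x w
  ortho (v : GroupLieAlgebra 𝓘(ℝ, EG) G) (x : M) : A.2 x (fund v x) + ξ.eval v x (A.1 x) = 0

lemma IsBasic.add {A B : GenSection E M} (hA : IsBasic ξ A) (hB : IsBasic ξ B) :
    IsBasic ξ (A + B) where
  field a x := by
    simp only [Prod.fst_add, Pi.add_apply, map_add, hA.field a x, hB.field a x]
  form a x w := by simp only [Prod.snd_add, Pi.add_apply, hA.form, hB.form]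
  ortho v x := by
    simp only [Prod.snd_add, Prod.fst_add, Pi.add_apply, (isOneFormAt_eval ξ v x).add]
    linarith [hA.ortho v x, hB.ortho v x]

lemma IsBasic.const_smul {A : GenSection E M} (c : ℝ) (hA : IsBasic ξ A) : IsBasic ξ (c • A) where
  field a x := by simp only [Prod.smul_fst, Pi.smul_apply, map_smul, hA.field a x]
  form a x w := by simp only [Prod.smul_snd, Pi.smul_apply, hA.form]
  ortho v x := by
    simp only [Prod.smul_snd, Prod.smul_fst, Pi.smul_apply, (isOneFormAt_eval ξ v x).smul,
      smul_eq_mul]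
    linear_combination c * hA.ortho v x

/-- The function `⟨[A, B]_H, C⟩` is invariant for basic sections. -/
lemma courantForm_smul_point (hH : InvariantThreeForm G H) {A B C : GenSection E M} {a : G} {x : M}
    (hA : IsBasic ξ A) (hB : IsBasic ξ B) (hC : IsBasic ξ C)
    (hA1 : IsGenSectionAt A x) (hB1 : IsGenSectionAt B x) (hC1 : IsGenSectionAt C x)
    (hA2 : IsGenSectionAt A (a • x)) (hB2 : IsGenSectionAt B (a • x))
    (hC2 : IsGenSectionAt C (a • x)) :
    courantForm H.eval A B C (a • x) = courantForm H.eval A B C x := by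
  have h1 : ∀ {A B : GenSection E M}, IsBasic ξ A → IsBasic ξ B → IsGenSectionAt A (a • x) →
      IsGenSectionAt B (a • x) → ∀ w : TangentSpace 𝓘(ℝ, E) x,
      mvfderiv 𝓘(ℝ, E) (fun y => A.2 y (B.1 y)) (a • x) (actD a x w)
        = mvfderiv 𝓘(ℝ, E) (fun y => A.2 y (B.1 y)) x w := fun hA hB hA2 hB2 w =>
    mvfderiv_actD EG (fun y => by rw [hB.field, hA.form]) (hA2.form.mdiff hB2.field.diff) w
  have h2 : ∀ {A B : GenSection E M}, IsBasic ξ A → IsBasic ξ B → IsGenSectionAt A x →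
      IsGenSectionAt B x → IsGenSectionAt A (a • x) → IsGenSectionAt B (a • x) →
      mlieBracket 𝓘(ℝ, E) A.1 B.1 (a • x) = actD a x (mlieBracket 𝓘(ℝ, E) A.1 B.1 x) :=
    fun hA hB hA1 hB1 hA2 hB2 => hA.field.mlieBracket EG hB.field hA1.field.diff hB1.field.diff
      hA2.field.diff hB2.field.diff
  simp only [courantForm]
  rw [h2 hA hC hA1 hC1 hA2 hC2, h2 hB hC hB1 hC1 hB2 hC2, h2 hA hB hA1 hB1 hA2 hB2,
    hA.field, hB.field, hC.field, h1 hB hC hB2 hC2, h1 hA hC hA2 hC2, h1 hA hB hA2 hB2,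
    hA.form, hB.form, hC.form, hH]

/-- The combination `∑ u_i (V_i + ξ_i)`. -/
noncomputable def verticalSection (ξ : EquivariantOneForm EG G E M) {ι : Type*} [Fintype ι]
    (e : ι → GroupLieAlgebra 𝓘(ℝ, EG) G) (u : ι → M → ℝ) : GenSection E M :=
  ∑ i, (u i • fund (e i), fun y w => u i y * ξ.eval (e i) y w)

section Vertical

variable {ι : Type*} [Fintype ι] {e : ι → GroupLieAlgebra 𝓘(ℝ, EG) G} {u : ι → M → ℝ}

lemma verticalSection_fst (y : M) :
    (verticalSection ξ e u).1 y = ∑ i, u i y • fund (e i) y := by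
  simp [verticalSection, Prod.fst_sum]

lemma verticalSection_snd (y : M) (w : TangentSpace 𝓘(ℝ, E) y) :
    (verticalSection ξ e u).2 y w = ∑ i, u i y * ξ.eval (e i) y w := by
  simp [verticalSection, Prod.snd_sum]

lemma isGenSectionAt_vertical_aux {x : M} {f : M → ℝ} (v : GroupLieAlgebra 𝓘(ℝ, EG) G)
    (hf : ContMDiffAt 𝓘(ℝ, E) 𝓘(ℝ, ℝ) ∞ f x) :
    IsGenSectionAt ((f • fund v, fun y w => f y * ξ.eval v y w) : GenSection E M) x :=
  ⟨((isSmoothField_fund v).at x).smul hf, (isOneFormAt_eval ξ v x).smul_form hf⟩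

lemma isGenSectionAt_verticalSection {x : M} (hu : ∀ i, ContMDiffAt 𝓘(ℝ, E) 𝓘(ℝ, ℝ) ∞ (u i) x) :
    IsGenSectionAt (verticalSection ξ e u) x :=
  IsGenSectionAt.sum fun i => isGenSectionAt_vertical_aux (e i) (hu i)

lemma IsBasic.genPairing_verticalSection {A : GenSection E M} (hA : IsBasic ξ A)
    (hlin : ∀ y, IsLinearMap ℝ (A.2 y)) : genPairing A (verticalSection ξ e u) = fun _ => 0 := by
  funext y
  rw [genPairing, verticalSection_fst, verticalSection_snd]
  have h1 : A.2 y (∑ i, u i y • fund (e i) y) = ∑ i, u i y * A.2 y (fund (e i) y) := by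
    have := map_sum (IsLinearMap.mk' _ (hlin y)) (fun i => u i y • fund (e i) y) Finset.univ
    refine this.trans (Finset.sum_congr rfl fun i _ => ?_)
    exact (IsLinearMap.mk' _ (hlin y)).map_smul _ _
  rw [h1, ← Finset.sum_add_distrib]
  refine Finset.sum_eq_zero fun i _ => ?_
  linear_combination u i y * hA.ortho (e i) y

variable (hξ : EquivariantlyClosed H ξ)
include hξ

/-- Basic sections commute with each `V_i`, have `V_i`-invariant contraction, and are orthogonal to
`V_i + ξ_i`. Together with `dξ_i = ι_{V_i} H` this kills every summand, whatever the coefficient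
functions. -/
lemma courantForm_vertical_left {x : M} {B C : GenSection E M} (hB : IsBasic ξ B)
    (hC : IsBasic ξ C) (hB1 : IsGenSectionAt B x) (hC1 : IsGenSectionAt C x)
    (hu : ∀ i, ContMDiffAt 𝓘(ℝ, E) 𝓘(ℝ, ℝ) ∞ (u i) x) :
    courantForm H.eval (verticalSection ξ e u) B C x = 0 := by
  refine courantForm_sum_left_eq_zero H (fun i => isGenSectionAt_vertical_aux (e i) (hu i))
    hB1 hC1 fun i => ?_
  have h1 := hB.ortho (e i) x
  have h2 := hC.ortho (e i) x
  exact courantForm_eq_zero H ((hu i).mdifferentiableAt (by simp))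
    ((isSmoothField_fund (e i)).at x).diff (isOneFormAt_eval ξ (e i) x) hB1 hC1
    (hξ.moment _ _ _ _) (mlieBracket_fund hB.field hB1.field.diff _)
    (mlieBracket_fund hC.field hC1.field.diff _)
    (mvfderiv_fund_eq_zero (hB1.form.mdiff hC1.field.diff)
      (fun a y => by rw [hC.field, hB.form]) _) (by linarith) (by linarith)

/-- The swap costs only the derivative of the pairing of a basic with a vertical section, and that
pairing vanishes identically. -/
lemma courantForm_vertical_middle {x : M} {A C : GenSection E M} (hA : IsBasic ξ A)
    (hC : IsBasic ξ C) (hA1 : IsGenSectionAt A x) (hC1 : IsGenSectionAt C x)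
    (hu : ∀ i, ContMDiffAt 𝓘(ℝ, E) 𝓘(ℝ, ℝ) ∞ (u i) x) :
    courantForm H.eval A (verticalSection ξ e u) C x = 0 := by
  have h := courantForm_swap_left H hA1 (isGenSectionAt_verticalSection (ξ := ξ) (e := e) hu) hC1
  rw [hA.genPairing_verticalSection fun y => ⟨hA1.form.add y, hA1.form.smul y⟩, mvfderiv_const,
    courantForm_vertical_left hξ hA hC hA1 hC1 hu, add_zero] at h
  exact h

lemma courantForm_vertical_right {x : M} {A B : GenSection E M} (hA : IsBasic ξ A)
    (hB : IsBasic ξ B) (hA1 : IsGenSectionAt A x) (hB1 : IsGenSectionAt B x)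
    (hu : ∀ i, ContMDiffAt 𝓘(ℝ, E) 𝓘(ℝ, ℝ) ∞ (u i) x) :
    courantForm H.eval A B (verticalSection ξ e u) x = 0 := by
  have h := courantForm_swap_right H hA1 hB1 (isGenSectionAt_verticalSection (ξ := ξ) (e := e) hu)
  rw [hB.genPairing_verticalSection fun y => ⟨hB1.form.add y, hB1.form.smul y⟩, mvfderiv_const,
    courantForm_vertical_middle hξ hA hB hA1 hB1 hu, add_zero] at h
  exact h

/-- `⟨[A, B]_H, C⟩` on basic sections depends only on the classes modulo the `V_v + ξ_v`. -/
lemma courantForm_add_vertical {x : M} {A B C A' B' C' : GenSection E M} {u₁ u₂ u₃ : ι → M → ℝ}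
    (hA : IsBasic ξ A) (hB : IsBasic ξ B) (hB' : IsBasic ξ B') (hC' : IsBasic ξ C')
    (hA1 : IsGenSectionAt A x) (hB1 : IsGenSectionAt B x) (hC1 : IsGenSectionAt C x)
    (hB1' : IsGenSectionAt B' x) (hC1' : IsGenSectionAt C' x)
    (hu₁ : ∀ i, ContMDiffAt 𝓘(ℝ, E) 𝓘(ℝ, ℝ) ∞ (u₁ i) x)
    (hu₂ : ∀ i, ContMDiffAt 𝓘(ℝ, E) 𝓘(ℝ, ℝ) ∞ (u₂ i) x)
    (hu₃ : ∀ i, ContMDiffAt 𝓘(ℝ, E) 𝓘(ℝ, ℝ) ∞ (u₃ i) x)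
    (hAA' : A' = A + verticalSection ξ e u₁) (hBB' : B' = B + verticalSection ξ e u₂)
    (hCC' : C' = C + verticalSection ξ e u₃) :
    courantForm H.eval A' B' C' x = courantForm H.eval A B C x := by
  -- The slots are cleaned from left to right, so that each removed vertical section faces two basic
  -- ones: already cleaned to its left, still uncleaned to its right.
  rw [hAA', courantForm_add_left H hA1 (isGenSectionAt_verticalSection hu₁) hB1' hC1',
    courantForm_vertical_left hξ hB' hC' hB1' hC1' hu₁, hBB',
    courantForm_add_middle H hA1 hB1 (isGenSectionAt_verticalSection hu₂) hC1',
    courantForm_vertical_middle hξ hA hC' hA1 hC1' hu₂, hCC',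
    courantForm_add_right H hA1 hB1 hC1 (isGenSectionAt_verticalSection hu₃),
    courantForm_vertical_right hξ hA hB hA1 hB1 hu₃]
  simp

end Vertical

end Basic


/-! ### The reduced metric and the pulled-back dual forms. -/

section ReducedMetric

open Topology Filter VectorField

variable {EG : Type*} [NormedAddCommGroup EG] [NormedSpace ℝ EG] [FiniteDimensional ℝ EG]
  {E : Type*} [NormedAddCommGroup E] [NormedSpace ℝ E] [FiniteDimensional ℝ E]
  {F : Type*} [NormedAddCommGroup F] [NormedSpace ℝ F] [FiniteDimensional ℝ F]
  {G : Type*} [TopologicalSpace G] [ChartedSpace EG G] [Group G] [LieGroup 𝓘(ℝ, EG) ∞ G]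
  {M : Type*} [TopologicalSpace M] [ChartedSpace E M] [IsManifold 𝓘(ℝ, E) ∞ M]
  [MulAction G M] [ContMDiffSMul 𝓘(ℝ, EG) 𝓘(ℝ, E) ∞ G M]
  [ChartedSpace F (Orb G M)] [IsManifold 𝓘(ℝ, F) ∞ (Orb G M)]
  {g : Metric E M} {H : ThreeForm E M} {ξ : EquivariantOneForm EG G E M}

lemma exists_proj_eq (b : Orb G M) : ∃ x : M, proj G x = b := ⟨b.out, proj_out b⟩

lemma EquivariantlyClosed.polarized (hξ : EquivariantlyClosed H ξ)
    (v w : GroupLieAlgebra 𝓘(ℝ, EG) G) (x : M) :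
    ξ.eval v x (fund w x) + ξ.eval w x (fund v x) = 0 := by
  have h1 : ∀ u, ξ.eval (v + w) x u = ξ.eval v x u + ξ.eval w x u := fun u =>
    DFunLike.congr_fun (congrFun (map_add ξ.toLin v w) x) u
  have h := hξ.isotropic (v + w) x
  have h2 : (fund (v + w) x : TangentSpace 𝓘(ℝ, E) x) = fund v x + fund w x :=
    map_add (fundL EG E G x) v w
  rw [h1, h2, (isOneFormAt_eval ξ v x).add, (isOneFormAt_eval ξ w x).add, hξ.isotropic,
    hξ.isotropic] at h
  linarith

/-- The sections `X^± ± g(X^±)` of the generalized tangent bundle. -/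
noncomputable def genLift (s : ℝ) (g : Metric E M) (ξ : EquivariantOneForm EG G E M)
    (X : VectorFields F (Orb G M)) : GenSection E M :=
  (hlift s g ξ X, fun y w => s * pair g y (hlift s g ξ X y) w)

lemma redSplitting_eq (X : VectorFields F (Orb G M)) :
    redSplitting g ξ X = (1 / 2 : ℝ) • (genLift 1 g ξ X + genLift (-1) g ξ X) := by
  refine Prod.ext rfl ?_
  funext y w
  simp only [redSplitting, genLift, Prod.smul_snd, Prod.snd_add, Pi.smul_apply, Pi.add_apply,
    smul_eq_mul]
  ring

namespace IsReduction

variable [CompactSpace G] (D : IsReduction F g H ξ)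
include D

/-- Two fields over the same field on the orbit space differ by a vertical field. -/
lemma exists_sub_eq_fund {x : M} {w w' : TangentSpace 𝓘(ℝ, E) x}
    (h : projD (E := E) F G x w = projD (E := E) F G x w') :
    ∃ v : GroupLieAlgebra 𝓘(ℝ, EG) G, w = w' + fund v x := by
  obtain ⟨v, hv⟩ := D.exists_fund_of_projD_eq_zero (w := w - w') (by rw [map_sub, h, sub_self])
  exact ⟨v, by rw [← hv]; abel⟩

lemma pair_fund_hlift (s : ℝ) (X : VectorFields F (Orb G M)) (v : GroupLieAlgebra 𝓘(ℝ, EG) G)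
    (x : M) : pair g x (fund v x) (hlift s g ξ X x) = - (s * ξ.eval v x (hlift s g ξ X x)) := by
  have h := D.hlift_mem s X x v
  rw [(isRiem_pair g).symm]
  linarith

lemma pair_hlift_fund (s : ℝ) (X : VectorFields F (Orb G M)) (v : GroupLieAlgebra 𝓘(ℝ, EG) G)
    (x : M) : pair g x (hlift s g ξ X x) (fund v x) = - (s * ξ.eval v x (hlift s g ξ X x)) := by
  have h := D.hlift_mem s X x v
  linarith

/-- The lifts differ by vertical vectors `V_v` and `V_w`. The equations of `τ_±` evaluate all
products with these, and the results cancel by `ξ_v(V_w) + ξ_w(V_v) = 0`. So the reduced metric may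
be read in either distribution. -/
lemma pair_hlift_neg (X Y : VectorFields F (Orb G M)) (x : M) :
    pair g x (hlift (-1) g ξ X x) (hlift (-1) g ξ Y x)
      = pair g x (hlift 1 g ξ X x) (hlift 1 g ξ Y x) := by
  have hr := isRiem_pair g
  obtain ⟨v, hv⟩ := D.exists_sub_eq_fund
    ((D.projD_hlift 1 X x).trans (D.projD_hlift (-1) X x).symm)
  obtain ⟨w, hw⟩ := D.exists_sub_eq_fund
    ((D.projD_hlift 1 Y x).trans (D.projD_hlift (-1) Y x).symm)
  have h1 := D.pair_hlift_fund 1 X w x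
  have h2 := D.pair_fund_hlift 1 Y v x
  have h3 := D.pair_hlift_fund (-1) X w x
  have h4 := D.pair_fund_hlift (-1) Y v x
  have h5 := D.closed.polarized v w x
  rw [hv, hr.add_left, (isOneFormAt_eval ξ w x).add] at h1
  rw [hw, hr.add_right, (isOneFormAt_eval ξ v x).add] at h2
  rw [hv, hw, hr.add_left, hr.add_right, hr.add_right]
  linarith

lemma pair_hlift_smul (s : ℝ) (X Y : VectorFields F (Orb G M)) (a : G) (x : M) :
    pair g (a • x) (hlift s g ξ X (a • x)) (hlift s g ξ Y (a • x))
      = pair g x (hlift s g ξ X x) (hlift s g ξ Y x) := by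
  rw [D.isInvariantField_hlift s X a x, D.isInvariantField_hlift s Y a x, D.metric]

/-- The definition uses a chosen representative of the orbit and extensions of tangent vectors.
Invariance moves the representative to `x`, and a lift at a point sees only the value of the field.
-/
lemma redMetric_proj (X Y : VectorFields F (Orb G M)) (x : M) :
    redMetric g ξ (proj G x) (X (proj G x)) (Y (proj G x))
      = pair g x (hlift 1 g ξ X x) (hlift 1 g ξ Y x) := by
  obtain ⟨a, ha⟩ := exists_smul_eq_of_proj_eq (proj_out (proj G x)).symm
  have key : ∀ (Z : VectorFields F (Orb G M)) (b b' : Orb G M), b' = b →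
      ext (Z b) b' = Z b' := by rintro Z b _ rfl; simp
  rw [redMetric, D.hlift_congr 1 (key X _ _ (proj_out (proj G x))),
    D.hlift_congr 1 (key Y _ _ (proj_out (proj G x)))]
  have h := D.pair_hlift_smul 1 X Y a (proj G x).out
  have key2 : ∀ z z' : M, z = z' → pair g z (hlift 1 g ξ X z) (hlift 1 g ξ Y z)
      = pair g z' (hlift 1 g ξ X z') (hlift 1 g ξ Y z') := by rintro z _ rfl; rfl
  rw [← h]
  exact key2 _ _ ha

lemma redMetric_proj_neg (X Y : VectorFields F (Orb G M)) (x : M) :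
    redMetric g ξ (proj G x) (X (proj G x)) (Y (proj G x))
      = pair g x (hlift (-1) g ξ X x) (hlift (-1) g ξ Y x) := by
  rw [D.redMetric_proj, D.pair_hlift_neg]

/-- The reduced metric is a Riemannian metric. -/
lemma isRiem_redMetric : IsRiem (redMetric (F := F) g ξ) := by
  have hr := isRiem_pair g
  have h0 : ∀ (x : M) (u v : TangentSpace 𝓘(ℝ, F) (proj G x : Orb G M)),
      redMetric g ξ (proj G x) u v
        = pair g x (hlift 1 g ξ (ext u) x) (hlift 1 g ξ (ext v) x) := fun x u v => by
    rw [← D.redMetric_proj, ext_self, ext_self]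
  refine ⟨?_, ?_, ?_, ?_, ?_⟩
  · intro b u v w
    obtain ⟨x, rfl⟩ := exists_proj_eq b
    have h1 : hlift 1 g ξ (ext (u + v)) x = hlift 1 g ξ (ext u) x + hlift 1 g ξ (ext v) x := by
      rw [← D.hlift_add]
      exact D.hlift_congr 1 (by simp)
    rw [h0, h0, h0, h1, hr.add_left]
  · intro b c u w
    obtain ⟨x, rfl⟩ := exists_proj_eq b
    have h1 : hlift 1 g ξ (ext (c • u)) x = c • hlift 1 g ξ (ext u) x := by
      rw [← D.hlift_smul]
      exact D.hlift_congr 1 (by simp)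
    rw [h0, h0, h1, hr.smul_left]
  · intro b u v
    obtain ⟨x, rfl⟩ := exists_proj_eq b
    rw [h0, h0, hr.symm]
  · intro b u hu
    obtain ⟨x, rfl⟩ := exists_proj_eq b
    rw [h0]
    refine hr.pos x _ fun h => hu ?_
    have h1 := D.projD_hlift 1 (ext u) x
    rw [h, map_zero, ext_self] at h1
    exact h1.symm
  · intro b U V hU hV
    obtain ⟨x, rfl⟩ := exists_proj_eq b
    refine D.contMDiffAt_of_comp_proj ?_
    simp only [D.redMetric_proj]
    exact hr.smooth x _ _ (D.isSmoothFieldAt_hlift 1 hU) (D.isSmoothFieldAt_hlift 1 hV)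

lemma isGenSectionAt_genLift (s : ℝ) {X : VectorFields F (Orb G M)} {x : M}
    (hX : IsSmoothFieldAt X (proj G x)) : IsGenSectionAt (genLift s g ξ X) x :=
  ⟨D.isSmoothFieldAt_hlift s hX,
    ((isRiem_pair g).isOneFormAt (D.isSmoothFieldAt_hlift s hX)).smul_form contMDiffAt_const⟩

/-- The equation of `τ_s` turns orthogonality to `V_v + ξ_v` into `(1 - s²) ξ_v(X^s) = 0`; this is
why `s² = 1` is required. -/
lemma isBasic_genLift {s : ℝ} (hs : s * s = 1) (X : VectorFields F (Orb G M)) :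
    IsBasic ξ (genLift s g ξ X) where
  field := D.isInvariantField_hlift s X
  form a x w := by
    simp only [genLift]
    rw [D.isInvariantField_hlift s X a x, D.metric]
  ortho v x := by
    simp only [genLift, D.pair_hlift_fund]
    linear_combination (- ξ.eval v x (hlift s g ξ X x)) * hs

lemma isGenSectionAt_redSplitting {X : VectorFields F (Orb G M)} {x : M}
    (hX : IsSmoothFieldAt X (proj G x)) : IsGenSectionAt (redSplitting g ξ X) x := by
  rw [redSplitting_eq]
  exact ((D.isGenSectionAt_genLift 1 hX).add (D.isGenSectionAt_genLift (-1) hX)).const_smul _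

lemma isBasic_redSplitting (X : VectorFields F (Orb G M)) : IsBasic ξ (redSplitting g ξ X) := by
  rw [redSplitting_eq]
  exact ((D.isBasic_genLift (by norm_num) X).add (D.isBasic_genLift (by norm_num) X)).const_smul _

lemma projD_redSplitting (X : VectorFields F (Orb G M)) (x : M) :
    projD (E := E) F G x ((redSplitting g ξ X).1 x) = X (proj G x) := by
  simp only [redSplitting]
  rw [map_smul, map_add, D.projD_hlift, D.projD_hlift, ← two_smul ℝ, smul_smul]
  norm_num

omit D in
variable (g ξ) in
/-- The pull-back of the one-form dual to a vector field on the orbit space. -/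
noncomputable def pullbackDual (X : VectorFields F (Orb G M)) (x : M)
    (w : TangentSpace 𝓘(ℝ, E) x) : ℝ :=
  redMetric g ξ (proj G x) (X (proj G x)) (projD (E := E) F G x w)

lemma isBasic_pullbackDual (c : ℝ) (X : VectorFields F (Orb G M)) :
    IsBasic ξ ((0, c • pullbackDual g ξ X) : GenSection E M) where
  field a x := (map_zero (actD a x)).symm
  form a x w := by
    have key : ∀ (b b' : Orb G M) (u : F), b = b' →
      redMetric g ξ b (X b) u = redMetric g ξ b' (X b') u := by rintro b _ u rfl; rfl
    have h := D.projD_actD a x w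
    simp only [Pi.smul_apply]
    congr 1
    exact (key _ _ _ (proj_smul a x)).trans (congrArg (redMetric g ξ (proj G x) (X (proj G x))) h)
  ortho v x := by
    simp only [Pi.smul_apply, pullbackDual, D.projD_fund, D.isRiem_redMetric.zero_right, Pi.zero_apply,
      (isOneFormAt_eval ξ v x).zero, smul_zero, add_zero]

/-- The lifts `X^±` differ by a vertical field with smooth coefficients. -/
lemma exists_coeff {ι : Type*} [Fintype ι] (e : Module.Basis ι ℝ (GroupLieAlgebra 𝓘(ℝ, EG) G))
    {X : VectorFields F (Orb G M)} {x : M} (hX : IsSmoothFieldAt X (proj G x)) :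
    ∃ u : ι → M → ℝ, (∀ i, ContMDiffAt 𝓘(ℝ, E) 𝓘(ℝ, ℝ) ∞ (u i) x) ∧
      ∀ y, hlift 1 g ξ X y = hlift (-1) g ξ X y + (2 : ℝ) • ∑ i, u i y • fund (e i) y := by
  have hr := isRiem_pair g
  choose v hv using fun y => D.exists_sub_eq_fund
    ((D.projD_hlift 1 X y).trans (D.projD_hlift (-1) X y).symm)
  have hsum : ∀ (c : ι → ℝ) (y : M), (fund (∑ i, c i • e i) y : TangentSpace 𝓘(ℝ, E) y)
      = ∑ i, c i • fund (e i) y := fun c y => by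
    have := map_sum (fundL EG E G y) (fun i => c i • e i) Finset.univ
    refine this.trans (Finset.sum_congr rfl fun i _ => ?_)
    exact map_smul (fundL EG E G y) _ _
  -- With half of the coordinates, `X⁺` and `X⁻` are the vector part of `X̂` plus and minus `∑ u_i
  -- V_i`.
  let u : M → ι → ℝ := fun y i => (1 / 2) * e.repr (v y) i
  have hu : ∀ y, (fund (v y) y : TangentSpace 𝓘(ℝ, E) y)
      = (2 : ℝ) • ∑ i, u y i • fund (e i) y := fun y => by
    conv_lhs => rw [← e.sum_repr (v y), hsum]
    rw [Finset.smul_sum]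
    refine Finset.sum_congr rfl fun i _ => ?_
    rw [smul_smul]
    congr 1
    simp only [u]
    ring
  have huy : ∀ y, hlift 1 g ξ X y = hlift (-1) g ξ X y + (2 : ℝ) • ∑ i, u y i • fund (e i) y :=
    fun y => by rw [← hu, ← hv]
  refine ⟨fun i y => u y i, ?_, huy⟩
  let A : M → (ι → ℝ) →L[ℝ] (ι → ℝ) := fun y => LinearMap.toContinuousLinearMap
    (LinearMap.pi fun j => ∑ i, pair g y (fund (e i) y) (fund (e j) y) • LinearMap.proj i)
  have hAapp : ∀ y c j, A y c j = pair g y (∑ i, c i • fund (e i) y) (fund (e j) y) := by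
    intro y c j
    rw [hr.sum_left]
    simp only [A, LinearMap.coe_toContinuousLinearMap', LinearMap.pi_apply, LinearMap.sum_apply,
      LinearMap.smul_apply, LinearMap.proj_apply, smul_eq_mul, hr.smul_left]
    exact Finset.sum_congr rfl fun i _ => mul_comm _ _
  -- The vectors `v y` are chosen pointwise, so smoothness cannot be read off from them. The
  -- coefficients solve a linear system whose matrix is the Gram matrix of the `V_i`, invertible by
  -- freeness.
  have hsm : ContMDiffAt 𝓘(ℝ, E) 𝓘(ℝ, ι → ℝ) ∞ u x := by
    refine contMDiffAt_of_clm_apply (A := A) (r := fun y j =>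
      (1 / 2) * (pair g y (hlift 1 g ξ X y) (fund (e j) y)
        - pair g y (hlift (-1) g ξ X y) (fund (e j) y))) ?_ ?_ ?_ ?_
    · intro c
      rw [contMDiffAt_pi_space]
      intro j
      simp only [hAapp]
      exact hr.smooth x _ _ (IsSmoothFieldAt.sum fun i _ =>
        ((isSmoothField_fund (e i)).at x).const_smul (c i)) ((isSmoothField_fund (e j)).at x)
    · refine (injective_iff_map_eq_zero _).2 fun c hc => ?_
      have h1 : pair g x (fund (∑ i, c i • e i) x) (fund (∑ i, c i • e i) x) = 0 := by
        conv_lhs => arg 4; rw [hsum]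
        rw [hr.symm, hr.sum_left]
        refine Finset.sum_eq_zero fun j _ => ?_
        rw [hr.smul_left, hr.symm, hsum, ← hAapp, hc]
        simp
      have h2 := eq_zero_of_fund_eq_zero D.free (hr.eq_zero_of_self h1)
      exact (Fintype.linearIndependent_iff.1 e.linearIndependent c h2 |> funext)
    · rw [contMDiffAt_pi_space]
      intro j
      exact contMDiffAt_const.mul
        ((hr.smooth x _ _ (D.isSmoothFieldAt_hlift 1 hX) ((isSmoothField_fund (e j)).at x)).sub
          (hr.smooth x _ _ (D.isSmoothFieldAt_hlift (-1) hX) ((isSmoothField_fund (e j)).at x)))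
    · refine Eventually.of_forall fun y => ?_
      funext j
      rw [hAapp, huy, hr.add_left, hr.smul_left]
      ring
  exact fun i => (contMDiffAt_pi_space.1 hsm) i

/-- The pull-back of the dual of `X`, in terms of the lifts `X^±`. -/
lemma pullbackDual_eq {ι : Type*} [Fintype ι] {e : ι → GroupLieAlgebra 𝓘(ℝ, EG) G}
    {u : ι → ℝ} {X : VectorFields F (Orb G M)} {x : M}
    (hu : hlift 1 g ξ X x = hlift (-1) g ξ X x + (2 : ℝ) • ∑ i, u i • fund (e i) x)
    (w : TangentSpace 𝓘(ℝ, E) x) :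
    pullbackDual g ξ X x w = (1 / 2) * (pair g x (hlift 1 g ξ X x) w
      + pair g x (hlift (-1) g ξ X x) w) - ∑ i, u i * ξ.eval (e i) x w := by
  have hr := isRiem_pair g
  -- Decompose `w = W + V_v` with `W` in `τ_+`. The form sees only `W`, and polarized isotropy shows
  -- that the `ξ`-sum cancels the contribution of `V_v` on the other side.
  obtain ⟨v, hv⟩ := D.exists_sub_eq_fund (w := w)
    (w' := hlift 1 g ξ (ext (projD (E := E) F G x w)) x)
    (by rw [D.projD_hlift, ext_self])
  set W := hlift 1 g ξ (ext (projD (E := E) F G x w)) x with hW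
  have h1 : pullbackDual g ξ X x w = pair g x (hlift 1 g ξ X x) W := by
    rw [pullbackDual, hW, ← D.redMetric_proj, ext_self]
  have hsum : ∀ z : TangentSpace 𝓘(ℝ, E) x, pair g x (hlift 1 g ξ X x) z
      = pair g x (hlift (-1) g ξ X x) z + 2 * ∑ i, u i * pair g x (fund (e i) x) z := fun z => by
    rw [hu, hr.add_left, hr.smul_left, hr.sum_left]
    simp only [hr.smul_left]
  have hW1 : ∑ i, u i * pair g x (fund (e i) x) W = - ∑ i, u i * ξ.eval (e i) x W := by
    rw [← Finset.sum_neg_distrib]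
    refine Finset.sum_congr rfl fun i _ => ?_
    rw [hW, D.pair_fund_hlift]
    ring
  have hV1 : ξ.eval v x (hlift 1 g ξ X x) = ξ.eval v x (hlift (-1) g ξ X x)
      - 2 * ∑ i, u i * ξ.eval (e i) x (fund v x) := by
    have h2 := map_sum ((isOneFormAt_eval ξ v x).toLin x) (fun i => u i • fund (e i) x) Finset.univ
    have h3 : ξ.eval v x (∑ i, u i • fund (e i) x) = - ∑ i, u i * ξ.eval (e i) x (fund v x) := by
      refine h2.trans ?_
      rw [← Finset.sum_neg_distrib]
      refine Finset.sum_congr rfl fun i _ => ?_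
      refine ((isOneFormAt_eval ξ v x).smul x _ _).trans ?_
      linear_combination u i * D.closed.polarized v (e i) x
    rw [hu, (isOneFormAt_eval ξ v x).add, (isOneFormAt_eval ξ v x).smul, h3]
    ring
  have h4 : ∑ i, u i * ξ.eval (e i) x w
      = ∑ i, u i * ξ.eval (e i) x W + ∑ i, u i * ξ.eval (e i) x (fund v x) := by
    rw [← Finset.sum_add_distrib]
    refine Finset.sum_congr rfl fun i _ => ?_
    rw [hv, (isOneFormAt_eval ξ (e i) x).add]
    ring
  rw [h1, h4, hv, hr.add_right, hr.add_right, D.pair_hlift_fund, D.pair_hlift_fund, hV1]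
  linarith [hsum W]

end IsReduction

end ReducedMetric


/-! ### The reduced flux and the reduced Bismut connection in terms of lifts. -/

section ReducedFlux

open Topology Filter VectorField

variable {EG : Type*} [NormedAddCommGroup EG] [NormedSpace ℝ EG] [FiniteDimensional ℝ EG]
  {E : Type*} [NormedAddCommGroup E] [NormedSpace ℝ E] [FiniteDimensional ℝ E]
  {F : Type*} [NormedAddCommGroup F] [NormedSpace ℝ F] [FiniteDimensional ℝ F]
  {G : Type*} [TopologicalSpace G] [ChartedSpace EG G] [Group G] [LieGroup 𝓘(ℝ, EG) ∞ G]
  {M : Type*} [TopologicalSpace M] [ChartedSpace E M] [IsManifold 𝓘(ℝ, E) ∞ M]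
  [MulAction G M] [ContMDiffSMul 𝓘(ℝ, EG) 𝓘(ℝ, E) ∞ G M]
  [ChartedSpace F (Orb G M)] [IsManifold 𝓘(ℝ, F) ∞ (Orb G M)]
  {g : Metric E M} {H : ThreeForm E M} {ξ : EquivariantOneForm EG G E M}

namespace IsReduction

variable [CompactSpace G] (D : IsReduction F g H ξ)
include D

section Decomposition

variable {ι : Type*} [Fintype ι] {e : ι → GroupLieAlgebra 𝓘(ℝ, EG) G} {u : ι → M → ℝ}
  {X : VectorFields F (Orb G M)}
  (hu : ∀ y, hlift 1 g ξ X y = hlift (-1) g ξ X y + (2 : ℝ) • ∑ i, u i y • fund (e i) y)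
include hu

/-- Modulo the `V_i + ξ_i`, the section `X⁺ + g(X⁺)` is the splitting plus the pulled-back dual
form. The same coefficients correct the vector part and the form part, which is the content of
`pullbackDual_eq`. -/
lemma genLift_one_eq : genLift 1 g ξ X = redSplitting g ξ X + (0, (1 : ℝ) • pullbackDual g ξ X)
    + verticalSection ξ e u := by
  refine Prod.ext ?_ ?_
  · funext y
    simp only [Prod.fst_add, Pi.add_apply, verticalSection_fst, add_zero]
    simp only [genLift, redSplitting]
    rw [hu]
    module
  · funext y w
    simp only [Prod.snd_add, Pi.add_apply, verticalSection_snd, Pi.smul_apply,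
      D.pullbackDual_eq (hu y)]
    simp only [genLift, redSplitting, smul_eq_mul]
    ring

/-- For the other eigensection both the dual form and the vertical correction change sign. -/
lemma genLift_neg_one_eq : genLift (-1) g ξ X
    = redSplitting g ξ X + (0, (-1 : ℝ) • pullbackDual g ξ X)
      + verticalSection ξ e (fun i y => - u i y) := by
  refine Prod.ext ?_ ?_
  · funext y
    simp only [Prod.fst_add, Pi.add_apply, verticalSection_fst, add_zero, neg_smul,
      Finset.sum_neg_distrib]
    simp only [genLift, redSplitting]
    rw [hu]
    module
  · funext y w
    simp only [Prod.snd_add, Pi.add_apply, verticalSection_snd, Pi.smul_apply,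
      D.pullbackDual_eq (hu y), neg_mul, Finset.sum_neg_distrib]
    simp only [genLift, redSplitting, smul_eq_mul]
    ring

end Decomposition

lemma isGenSectionAt_pullbackDual (c : ℝ) {X : VectorFields F (Orb G M)} {x : M}
    (hX : IsSmoothFieldAt X (proj G x)) :
    IsGenSectionAt ((0, c • pullbackDual g ξ X) : GenSection E M) x := by
  have : FiniteDimensional ℝ (GroupLieAlgebra 𝓘(ℝ, EG) G) :=
    inferInstanceAs (FiniteDimensional ℝ EG)
  refine ⟨(isGenSectionAt_zero x).field, IsOneFormAt.const_smul c ⟨fun y w w' => ?_, fun y r w => ?_,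
    fun U hU => ?_⟩⟩
  · rw [pullbackDual, map_add, D.isRiem_redMetric.add_right]
    rfl
  · rw [pullbackDual, map_smul, D.isRiem_redMetric.smul_right]
    rfl
  · obtain ⟨u, hus, hu⟩ := D.exists_coeff (Module.finBasis ℝ (GroupLieAlgebra 𝓘(ℝ, EG) G)) hX
    simp only [fun y => D.pullbackDual_eq (hu y)]
    have hr := isRiem_pair g
    refine (contMDiffAt_const.mul ((hr.smooth x _ _ (D.isSmoothFieldAt_hlift 1 hX) hU).add
      (hr.smooth x _ _ (D.isSmoothFieldAt_hlift (-1) hX) hU))).sub (ContMDiffAt.sum fun i _ => ?_)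
    exact (hus i).mul (ξ.smooth _ x U hU)

/-- With sign `+` on the first section and `-` on the other two, the derivative and bracket terms
add up to `-2` times the Koszul expression, while the flux enters with coefficient `1`. This ratio
singles out `∇⁻`. -/
lemma courantForm_genLift {X Y Z : VectorFields F (Orb G M)} {x : M}
    (hX : IsSmoothFieldAt X (proj G x)) (hY : IsSmoothFieldAt Y (proj G x))
    (hZ : IsSmoothFieldAt Z (proj G x)) :
    courantForm H.eval (genLift 1 g ξ X) (genLift (-1) g ξ Y) (genLift (-1) g ξ Z) x
      = -2 * pair g x (bismut (-1) (pair g) H.eval (hlift 1 g ξ X) (hlift (-1) g ξ Y) x)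
          (hlift (-1) g ξ Z x) := by
  have hr := isRiem_pair g
  have hX' := (D.isSmoothFieldAt_hlift 1 hX).diff
  have hY' := (D.isSmoothFieldAt_hlift (-1) hY).diff
  have hZ' := (D.isSmoothFieldAt_hlift (-1) hZ).diff
  rw [hr.bismut_apply hX' hY' (H.isLinearMap_eval _ _ _) hZ']
  simp only [courantForm, genLift, koszul]
  rw [mvfderiv_const_mul_apply _ (hr.mdiff hY' hZ'), mvfderiv_const_mul_apply _ (hr.mdiff hX' hZ'),
    mvfderiv_const_mul_apply _ (hr.mdiff hX' hY')]
  rw [hr.symm x (hlift (-1) g ξ Y x), hr.symm x (hlift (-1) g ξ Z x), hr.symm x (hlift 1 g ξ X x)]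
  ring

lemma mvfderiv_comp_proj {f : Orb G M → ℝ} {x : M}
    (hf : MDifferentiableAt 𝓘(ℝ, F) 𝓘(ℝ, ℝ) f (proj G x)) (w : TangentSpace 𝓘(ℝ, E) x) :
    mvfderiv 𝓘(ℝ, E) (fun y => f (proj G y)) x w
      = mvfderiv 𝓘(ℝ, F) f (proj G x) (projD (E := E) F G x w) :=
  mvfderiv_comp_vector hf (D.contMDiff_proj.mdifferentiable (by simp) x) w

lemma projD_mlieBracket {X Y : VectorFields E M} {X' Y' : VectorFields F (Orb G M)} {x : M}
    (hX : DiffFieldAt X x) (hY : DiffFieldAt Y x) (hX' : DiffFieldAt X' (proj G x))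
    (hY' : DiffFieldAt Y' (proj G x)) (hXX' : ∀ y, projD (E := E) F G y (X y) = X' (proj G y))
    (hYY' : ∀ y, projD (E := E) F G y (Y y) = Y' (proj G y)) :
    projD (E := E) F G x (mlieBracket 𝓘(ℝ, E) X Y x) = mlieBracket 𝓘(ℝ, F) X' Y' (proj G x) :=
  mlieBracket_related ((D.contMDiff_proj x).of_le ENat.LEInfty.out) hX hY hX' hY'
    (Eventually.of_forall hXX') (Eventually.of_forall hYY')

/-- The flux of the metric splitting, in terms of the Bismut connection upstairs and the
Levi-Civita connection of the reduced metric. -/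
lemma courantForm_redSplitting {X Y Z : VectorFields F (Orb G M)} {x : M}
    (hX : IsSmoothFieldAt X (proj G x)) (hY : IsSmoothFieldAt Y (proj G x))
    (hZ : IsSmoothFieldAt Z (proj G x)) :
    courantForm H.eval (redSplitting g ξ X) (redSplitting g ξ Y) (redSplitting g ξ Z) x
      = 2 * koszul (redMetric g ξ) X Y Z (proj G x)
        - 2 * pair g x (bismut (-1) (pair g) H.eval (hlift 1 g ξ X) (hlift (-1) g ξ Y) x)
          (hlift (-1) g ξ Z x) := by
  have : FiniteDimensional ℝ (GroupLieAlgebra 𝓘(ℝ, EG) G) :=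
    inferInstanceAs (FiniteDimensional ℝ EG)
  have hR := D.isRiem_redMetric
  let e := Module.finBasis ℝ (GroupLieAlgebra 𝓘(ℝ, EG) G)
  obtain ⟨u₁, hus₁, hu₁⟩ := D.exists_coeff e hX
  obtain ⟨u₂, hus₂, hu₂⟩ := D.exists_coeff e hY
  obtain ⟨u₃, hus₃, hu₃⟩ := D.exists_coeff e hZ
  have sX := D.isGenSectionAt_redSplitting hX
  have sY := D.isGenSectionAt_redSplitting hY
  have sZ := D.isGenSectionAt_redSplitting hZ
  have pX := D.isGenSectionAt_pullbackDual 1 hX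
  have pY := D.isGenSectionAt_pullbackDual (-1) hY
  have pZ := D.isGenSectionAt_pullbackDual (-1) hZ
  -- Vertical parts are dropped from the three eigensections. Expanding what remains separates the
  -- flux of the splitting from terms in the dual forms, which are exactly the Koszul terms of `g̃`.
  have h1 := courantForm_add_vertical D.closed
    ((D.isBasic_redSplitting X).add (D.isBasic_pullbackDual 1 X))
    ((D.isBasic_redSplitting Y).add (D.isBasic_pullbackDual (-1) Y))
    (D.isBasic_genLift (s := -1) (by norm_num) Y) (D.isBasic_genLift (s := -1) (by norm_num) Z)
    (sX.add pX) (sY.add pY) (sZ.add pZ)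
    (D.isGenSectionAt_genLift (-1) hY) (D.isGenSectionAt_genLift (-1) hZ) hus₁
    (fun i => (hus₂ i).neg) (fun i => (hus₃ i).neg)
    (D.genLift_one_eq hu₁) (D.genLift_neg_one_eq hu₂) (D.genLift_neg_one_eq hu₃)
  rw [D.courantForm_genLift hX hY hZ,
    courantForm_add_left H sX pX (sY.add pY) (sZ.add pZ),
    courantForm_form_left H _ (sY.add pY) (sZ.add pZ),
    courantForm_add_middle H sX sY pY (sZ.add pZ),
    courantForm_form_middle H _ sX (sZ.add pZ),
    courantForm_add_right H sX sY sZ pZ, courantForm_form_right H _ sX sY] at h1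
  simp only [Prod.fst_add, add_zero] at h1
  have hval : ∀ (c : ℝ) (X Y : VectorFields F (Orb G M)),
      (fun y => (c • pullbackDual g ξ X : (x : M) → TangentSpace 𝓘(ℝ, E) x → ℝ) y
        ((redSplitting g ξ Y).1 y))
      = fun y => c * redMetric g ξ (proj G y) (X (proj G y)) (Y (proj G y)) := fun c X Y => by
    funext y
    simp only [Pi.smul_apply, pullbackDual, D.projD_redSplitting, smul_eq_mul]
  have hder : ∀ (c : ℝ) {X Y Z : VectorFields F (Orb G M)}, IsSmoothFieldAt X (proj G x) →
      IsSmoothFieldAt Y (proj G x) →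
      mvfderiv 𝓘(ℝ, E) (fun y => (c • pullbackDual g ξ X : (x : M) → TangentSpace 𝓘(ℝ, E) x → ℝ) y
        ((redSplitting g ξ Y).1 y)) x ((redSplitting g ξ Z).1 x)
      = c * mvfderiv 𝓘(ℝ, F) (fun b => redMetric g ξ b (X b) (Y b)) (proj G x)
        (Z (proj G x)) := fun c X Y Z hX hY => by
    have hd := hR.mdiff hX.diff hY.diff
    have hd' : MDifferentiableAt 𝓘(ℝ, E) 𝓘(ℝ, ℝ)
        (fun y => redMetric g ξ (proj G y) (X (proj G y)) (Y (proj G y))) x :=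
      hd.comp x (D.contMDiff_proj.mdifferentiable (by simp) x)
    rw [hval, mvfderiv_const_mul_apply c hd', D.mvfderiv_comp_proj hd, D.projD_redSplitting]
  have hbr : ∀ (c : ℝ) {X Y : VectorFields F (Orb G M)} (Z : VectorFields F (Orb G M)),
      IsSmoothFieldAt X (proj G x) → IsSmoothFieldAt Y (proj G x) →
      (c • pullbackDual g ξ Z : (x : M) → TangentSpace 𝓘(ℝ, E) x → ℝ) x
        (mlieBracket 𝓘(ℝ, E) (redSplitting g ξ X).1 (redSplitting g ξ Y).1 x)
      = c * redMetric g ξ (proj G x) (Z (proj G x)) (mlieBracket 𝓘(ℝ, F) X Y (proj G x)) :=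
    fun c X Y Z hX hY => by
    simp only [Pi.smul_apply, pullbackDual, smul_eq_mul]
    rw [D.projD_mlieBracket (D.isGenSectionAt_redSplitting hX).field.diff
      (D.isGenSectionAt_redSplitting hY).field.diff hX.diff hY.diff (D.projD_redSplitting X)
      (D.projD_redSplitting Y)]
  rw [hder _ hX hZ, hder _ hX hY, hder _ hY hZ, hbr _ _ hY hZ, hbr _ _ hX hZ, hbr _ _ hX hY] at h1
  rw [koszul, hR.symm _ _ (Z (proj G x)), hR.symm _ _ (Y (proj G x)), hR.symm _ _ (X (proj G x))]
  linarith

/-- The splitting is isotropic because both lifts induce the same metric; this makes its flux skew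
in the last two slots. -/
lemma genPairing_redSplitting (X Y : VectorFields F (Orb G M)) :
    genPairing (redSplitting g ξ X) (redSplitting g ξ Y) = fun _ => 0 := by
  funext x
  have hr := isRiem_pair g
  have h := D.pair_hlift_neg X Y x
  simp only [genPairing, redSplitting, hr.smul_right, hr.add_right]
  rw [hr.symm x (hlift _ g ξ Y x), hr.symm x (hlift _ g ξ Y x), hr.symm x (hlift (-1) g ξ Y x),
    hr.symm x (hlift (-1) g ξ Y x)]
  linarith

lemma courantForm_redSplitting_swap {X Y Z : VectorFields F (Orb G M)} {x : M}
    (hX : IsSmoothFieldAt X (proj G x)) (hY : IsSmoothFieldAt Y (proj G x))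
    (hZ : IsSmoothFieldAt Z (proj G x)) :
    courantForm H.eval (redSplitting g ξ X) (redSplitting g ξ Y) (redSplitting g ξ Z) x
      = - courantForm H.eval (redSplitting g ξ X) (redSplitting g ξ Z) (redSplitting g ξ Y) x := by
  have h := courantForm_swap_right H (D.isGenSectionAt_redSplitting hX)
    (D.isGenSectionAt_redSplitting hY) (D.isGenSectionAt_redSplitting hZ)
  rw [D.genPairing_redSplitting, mvfderiv_const] at h
  exact eq_neg_of_add_eq_zero_left h

lemma courantForm_redSplitting_congr_right {X Y Z Z' : VectorFields F (Orb G M)} {x : M}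
    (hX : IsSmoothFieldAt X (proj G x)) (hY : IsSmoothFieldAt Y (proj G x))
    (hZ : IsSmoothFieldAt Z (proj G x)) (hZ' : IsSmoothFieldAt Z' (proj G x))
    (h : Z (proj G x) = Z' (proj G x)) :
    courantForm H.eval (redSplitting g ξ X) (redSplitting g ξ Y) (redSplitting g ξ Z) x
      = courantForm H.eval (redSplitting g ξ X) (redSplitting g ξ Y) (redSplitting g ξ Z') x := by
  rw [D.courantForm_redSplitting hX hY hZ, D.courantForm_redSplitting hX hY hZ',
    (D.isRiem_redMetric.tensorialAt_koszul_right hX.diff hY.diff).pointwise hZ.diff hZ'.diff h,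
    D.hlift_congr (-1) h]

/-- The formula through the Koszul expression and the Bismut derivative is visibly tensorial in the
first and last slots; the middle slot is reached by exchanging it with the last. -/
lemma courantForm_redSplitting_congr {X X' Y Y' Z Z' : VectorFields F (Orb G M)} {x : M}
    (hX : IsSmoothFieldAt X (proj G x)) (hX' : IsSmoothFieldAt X' (proj G x))
    (hY : IsSmoothFieldAt Y (proj G x)) (hY' : IsSmoothFieldAt Y' (proj G x))
    (hZ : IsSmoothFieldAt Z (proj G x)) (hZ' : IsSmoothFieldAt Z' (proj G x))
    (hXX' : X (proj G x) = X' (proj G x)) (hYY' : Y (proj G x) = Y' (proj G x))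
    (hZZ' : Z (proj G x) = Z' (proj G x)) :
    courantForm H.eval (redSplitting g ξ X) (redSplitting g ξ Y) (redSplitting g ξ Z) x
      = courantForm H.eval (redSplitting g ξ X') (redSplitting g ξ Y') (redSplitting g ξ Z') x := by
  rw [D.courantForm_redSplitting_congr_right hX hY hZ hZ' hZZ',
    D.courantForm_redSplitting_swap hX hY hZ',
    D.courantForm_redSplitting_congr_right hX hZ' hY hY' hYY',
    ← D.courantForm_redSplitting_swap hX hY' hZ', D.courantForm_redSplitting hX hY' hZ',
    D.courantForm_redSplitting hX' hY' hZ',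
    (D.isRiem_redMetric.tensorialAt_koszul_left hY'.diff hZ'.diff).pointwise hX.diff hX'.diff hXX',
    (isRiem_pair g).bismut_congr_left H (D.isSmoothFieldAt_hlift 1 hX).diff
      (D.isSmoothFieldAt_hlift 1 hX').diff (D.isSmoothFieldAt_hlift (-1) hY').diff
      (D.hlift_congr 1 hXX')]

/-- The reduced flux on smooth vector fields. -/
lemma redFlux_proj {X Y Z : VectorFields F (Orb G M)} {x : M}
    (hX : IsSmoothFieldAt X (proj G x)) (hY : IsSmoothFieldAt Y (proj G x))
    (hZ : IsSmoothFieldAt Z (proj G x)) :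
    redFlux g H ξ (proj G x) (X (proj G x)) (Y (proj G x)) (Z (proj G x))
      = 2 * koszul (redMetric g ξ) X Y Z (proj G x)
        - 2 * pair g x (bismut (-1) (pair g) H.eval (hlift 1 g ξ X) (hlift (-1) g ξ Y) x)
          (hlift (-1) g ξ Z x) := by
  have hext : ∀ (b b' : Orb G M) (u : TangentSpace 𝓘(ℝ, F) b), b' = b →
      IsSmoothFieldAt (ext u) b' := by rintro b _ u rfl; exact isSmoothFieldAt_ext u
  obtain ⟨a, ha⟩ := exists_smul_eq_of_proj_eq (proj_out (proj G x)).symm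
  -- The flux is defined at `b.out`; invariance on basic sections carries it to any other point of
  -- the orbit, where the extensions can be compared with the given fields.
  have hb : ∀ (b : Orb G M) (u v w : TangentSpace 𝓘(ℝ, F) b) (a : G),
      redFlux g H ξ b u v w = courantForm H.eval (redSplitting g ξ (ext u))
        (redSplitting g ξ (ext v)) (redSplitting g ξ (ext w)) (a • b.out) := fun b u v w a => by
    have h1 : proj G b.out = b := proj_out b
    have h2 : proj G (a • b.out) = b := (proj_smul a _).trans h1
    have s1 : ∀ u : TangentSpace 𝓘(ℝ, F) b, IsGenSectionAt (redSplitting g ξ (ext u)) b.out :=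
      fun u => D.isGenSectionAt_redSplitting (hext _ _ u h1)
    have s2 : ∀ u : TangentSpace 𝓘(ℝ, F) b, IsGenSectionAt (redSplitting g ξ (ext u)) (a • b.out) :=
      fun u => D.isGenSectionAt_redSplitting (hext _ _ u h2)
    rw [courantForm_smul_point D.flux (D.isBasic_redSplitting _) (D.isBasic_redSplitting _)
      (D.isBasic_redSplitting _) (s1 u) (s1 v) (s1 w) (s2 u) (s2 v) (s2 w), redFlux,
      genPairing_courant H.eval (s1 u) (s1 v) (s1 w)]
  rw [hb _ _ _ _ a, ha, ← D.courantForm_redSplitting hX hY hZ]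
  exact D.courantForm_redSplitting_congr (isSmoothFieldAt_ext _) hX (isSmoothFieldAt_ext _) hY
    (isSmoothFieldAt_ext _) hZ (ext_self _) (ext_self _) (ext_self _)

/-- The reduced flux is given only as a function, and `bismut_apply` needs it to be a covector in
its last argument before `sharp` can be applied. -/
lemma isLinearMap_redFlux (b : Orb G M) (u v : TangentSpace 𝓘(ℝ, F) b) :
    IsLinearMap ℝ (redFlux g H ξ b u v) := by
  obtain ⟨x, rfl⟩ := exists_proj_eq b
  have hu := isSmoothFieldAt_ext u
  have hv := isSmoothFieldAt_ext v
  have ht := D.isRiem_redMetric.tensorialAt_koszul_right hu.diff hv.diff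
  have hr := isRiem_pair g
  have h : ∀ w, redFlux g H ξ (proj G x) u v w = 2 * TensorialAt.mkHom _ _ ht w
      - 2 * pair g x (bismut (-1) (pair g) H.eval (hlift 1 g ξ (ext u)) (hlift (-1) g ξ (ext v)) x)
          (hlift (-1) g ξ (ext w) x) := fun w => by
    have h1 := D.redFlux_proj hu hv (isSmoothFieldAt_ext w)
    have h2 := TensorialAt.mkHom_apply ht (isSmoothFieldAt_ext w).diff
    rw [ext_self, ext_self, ext_self] at h1
    rw [ext_self] at h2
    rw [h1, h2]
  constructor
  · intro w w'
    have h1 : hlift (-1) g ξ (ext (w + w')) x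
        = hlift (-1) g ξ (ext w) x + hlift (-1) g ξ (ext w') x := by
      rw [← D.hlift_add]
      exact D.hlift_congr (-1) (by simp)
    rw [h, h, h, h1, map_add, hr.add_right]
    ring
  · intro c w
    have h1 : hlift (-1) g ξ (ext (c • w)) x = c • hlift (-1) g ξ (ext w) x := by
      rw [← D.hlift_smul]
      exact D.hlift_congr (-1) (by simp)
    rw [h, h, h1, map_smul, hr.smul_right, smul_eq_mul, smul_eq_mul]
    ring

/-- The reduced Bismut connection is the projection of the Bismut connection upstairs. -/
lemma redMetric_redBismut {X Y Z : VectorFields F (Orb G M)} {x : M}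
    (hX : IsSmoothFieldAt X (proj G x)) (hY : IsSmoothFieldAt Y (proj G x))
    (hZ : IsSmoothFieldAt Z (proj G x)) :
    redMetric g ξ (proj G x) (redBismut g H ξ X Y (proj G x)) (Z (proj G x))
      = pair g x (bismut (-1) (pair g) H.eval (hlift 1 g ξ X) (hlift (-1) g ξ Y) x)
          (hlift (-1) g ξ Z x) := by
  rw [redBismut, D.isRiem_redMetric.bismut_apply hX.diff hY.diff (D.isLinearMap_redFlux _ _ _)
    hZ.diff, D.redFlux_proj hX hY hZ]
  ring

/-- Products with smooth fields pull back to products of smooth fields upstairs. Smoothness is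
required because the curvature differentiates this field again. -/
lemma isSmoothFieldAt_redBismut {X Y : VectorFields F (Orb G M)} (hX : IsSmoothField X)
    (hY : IsSmoothField Y) (b : Orb G M) : IsSmoothFieldAt (redBismut g H ξ X Y) b := by
  obtain ⟨x, rfl⟩ := exists_proj_eq b
  refine D.isRiem_redMetric.isSmoothFieldAt fun w => D.contMDiffAt_of_comp_proj ?_
  have hr := isRiem_pair g
  refine (hr.smooth x _ _ (hr.isSmoothFieldAt_bismut (s := -1) H (D.isSmoothFieldAt_hlift 1 (hX.at _))
    (D.isSmoothFieldAt_hlift (-1) (hY.at _)))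
    (D.isSmoothFieldAt_hlift (-1) (isSmoothFieldAt_ext w))).congr_of_eventuallyEq ?_
  filter_upwards [D.contMDiff_proj.continuous.continuousAt.eventually
    (eventually_isSmoothFieldAt_ext w)] with y hy
  exact D.redMetric_redBismut (hX.at _) (hY.at _) hy

end IsReduction

end ReducedFlux


/-! ### The matrices `T` and `K` and the curvature formula. -/

section ReducedCurvature

open Topology Filter VectorField Matrix

lemma isUnit_det_of_vecMul_eq_zero {ι : Type*} [Fintype ι] [DecidableEq ι] {A : Matrix ι ι ℝ}
    (hA : ∀ c, c ᵥ* A = 0 → c = 0) : IsUnit A.det := by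
  have hinj : Function.Injective A.vecMul :=
    (injective_iff_map_eq_zero (vecMulLinear A)).2 hA
  exact (isUnit_iff_isUnit_det A).1 (vecMul_injective_iff_isUnit.1 hinj)

variable {EG : Type*} [NormedAddCommGroup EG] [NormedSpace ℝ EG] [FiniteDimensional ℝ EG]
  {E : Type*} [NormedAddCommGroup E] [NormedSpace ℝ E] [FiniteDimensional ℝ E]
  {F : Type*} [NormedAddCommGroup F] [NormedSpace ℝ F] [FiniteDimensional ℝ F]
  {G : Type*} [TopologicalSpace G] [ChartedSpace EG G] [Group G] [LieGroup 𝓘(ℝ, EG) ∞ G]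
  {M : Type*} [TopologicalSpace M] [ChartedSpace E M] [IsManifold 𝓘(ℝ, E) ∞ M]
  [MulAction G M] [ContMDiffSMul 𝓘(ℝ, EG) 𝓘(ℝ, E) ∞ G M]
  [ChartedSpace F (Orb G M)] [IsManifold 𝓘(ℝ, F) ∞ (Orb G M)]
  {g : Metric E M} {H : ThreeForm E M} {ξ : EquivariantOneForm EG G E M}

/-- The vectors `V_v^±` at a point, linearly in `v`. -/
noncomputable def fundPML (s : ℝ) (g : Metric E M) (ξ : EquivariantOneForm EG G E M) (x : M) :
    GroupLieAlgebra 𝓘(ℝ, EG) G →ₗ[ℝ] TangentSpace 𝓘(ℝ, E) x where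
  toFun v := fundPM s g ξ v x
  map_add' v v' := (isRiem_pair g).eq_of_forall fun w => by
    have h1 : ξ.eval (v + v') x w = ξ.eval v x w + ξ.eval v' x w :=
      DFunLike.congr_fun (congrFun (map_add ξ.toLin v v') x) w
    have h2 : pair g x (fund (v + v') x) w = _ :=
      (congrArg (pair g x · w) (map_add (fundL EG E G x) v v')).trans
        ((isRiem_pair g).add_left x _ _ _)
    rw [(isRiem_pair g).add_left, pair_fundPM, pair_fundPM, pair_fundPM, h1, h2, fundL_apply,
      fundL_apply]
    ring
  map_smul' c v := (isRiem_pair g).eq_of_forall fun w => by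
    have h1 : ξ.eval (c • v) x w = c * ξ.eval v x w :=
      DFunLike.congr_fun (congrFun (map_smul ξ.toLin c v) x) w
    have h2 : pair g x (fund (c • v) x) w = _ :=
      (congrArg (pair g x · w) (map_smul (fundL EG E G x) c v)).trans
        ((isRiem_pair g).smul_left x _ _ _)
    rw [RingHom.id_apply, (isRiem_pair g).smul_left, pair_fundPM, pair_fundPM, h1, h2, fundL_apply]
    ring

lemma fundPML_apply (s : ℝ) (x : M) (v : GroupLieAlgebra 𝓘(ℝ, EG) G) :
    fundPML s g ξ x v = fundPM s g ξ v x := rfl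

lemma xiPM_eq (s : ℝ) (v : GroupLieAlgebra 𝓘(ℝ, EG) G) :
    xiPM s g ξ v = fun x w => pair g x (fundPM s g ξ v x) w := rfl

section Basis

variable {ι : Type*} [Fintype ι] {e : Module.Basis ι ℝ (GroupLieAlgebra 𝓘(ℝ, EG) G)} {x : M}

lemma pair_fundPM_sum (s : ℝ) (c : ι → ℝ) (w : TangentSpace 𝓘(ℝ, E) x) :
    pair g x (fundPM s g ξ (∑ a, c a • e a) x) w
      = ∑ a, c a * pair g x (fundPM s g ξ (e a) x) w := by
  have hr := isRiem_pair g
  rw [← fundPML_apply, map_sum, hr.sum_left]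
  refine Finset.sum_congr rfl fun a _ => ?_
  rw [map_smul, hr.smul_left, fundPML_apply]

lemma pair_fundPM_eq_zero {s : ℝ} {w : TangentSpace 𝓘(ℝ, E) x}
    (h : ∀ a, pair g x (fundPM s g ξ (e a) x) w = 0) (v : GroupLieAlgebra 𝓘(ℝ, EG) G) :
    pair g x (fundPM s g ξ v x) w = 0 := by
  rw [← e.sum_repr v, pair_fundPM_sum]
  exact Finset.sum_eq_zero fun a _ => by rw [h, mul_zero]

lemma vecMul_matT (c : ι → ℝ) (b : ι) :
    (c ᵥ* matT g ξ e x) b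
      = pair g x (fundPM (-1) g ξ (∑ a, c a • e a) x) (fundPM (-1) g ξ (e b) x) := by
  rw [pair_fundPM_sum]
  rfl

lemma vecMul_matK (c : ι → ℝ) (b : ι) :
    (c ᵥ* matK g ξ e x) b
      = pair g x (fundPM (-1) g ξ (∑ a, c a • e a) x) (fund (e b) x) := by
  rw [pair_fundPM_sum]
  refine Finset.sum_congr rfl fun a _ => ?_
  rw [pair_fundPM]
  change c a * (_ - _) = _
  ring

lemma eq_zero_of_sum_smul_basis {c : ι → ℝ} (h : ∑ a, c a • e a = 0) : c = 0 :=
  funext fun a => Fintype.linearIndependent_iff.1 e.linearIndependent c h a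

end Basis

namespace IsReduction

variable [CompactSpace G] (D : IsReduction F g H ξ)
include D

/-- Isotropy reduces the product to `|V_v|²`. Nondegeneracy of both `T` and `K` comes from this. -/
lemma eq_zero_of_pair_fundPM_fund {s : ℝ} {v : GroupLieAlgebra 𝓘(ℝ, EG) G} {x : M}
    (h : pair g x (fundPM s g ξ v x) (fund v x) = 0) : v = 0 := by
  rw [pair_fundPM, D.closed.isotropic, mul_zero, add_zero] at h
  exact eq_zero_of_fund_eq_zero D.free ((isRiem_pair g).eq_zero_of_self h)

section Basis

variable {ι : Type*} [Fintype ι] [DecidableEq ι]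
  (e : Module.Basis ι ℝ (GroupLieAlgebra 𝓘(ℝ, EG) G)) {x : M}

lemma vecMul_matT_eq_zero {c : ι → ℝ} (h : c ᵥ* matT g ξ e x = 0) : c = 0 := by
  have hr := isRiem_pair g
  refine eq_zero_of_sum_smul_basis (e := e) (D.eq_zero_of_pair_fundPM_fund (s := -1) (x := x) ?_)
  have h1 : ∀ b, pair g x (fundPM (-1) g ξ (e b) x) (fundPM (-1) g ξ (∑ a, c a • e a) x) = 0 :=
    fun b => by
      rw [hr.symm, ← vecMul_matT, h]
      rfl
  rw [hr.eq_zero_of_self (pair_fundPM_eq_zero h1 _), hr.zero_left]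

/-- `K` need not be symmetric, but its quadratic form at the coordinates of `v` is `|V_v|²`. -/
lemma vecMul_matK_eq_zero {c : ι → ℝ} (h : c ᵥ* matK g ξ e x = 0) : c = 0 := by
  have hr := isRiem_pair g
  refine eq_zero_of_sum_smul_basis (e := e) (D.eq_zero_of_pair_fundPM_fund (s := -1) (x := x) ?_)
  set v := ∑ a, c a • e a
  have h1 : ∀ b, pair g x (fundPM (-1) g ξ v x) (fund (e b) x) = 0 := fun b => by
    rw [← vecMul_matK, h]
    rfl
  have h2 : fund v x = ∑ a, c a • (fund (e a) x : TangentSpace 𝓘(ℝ, E) x) := by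
    rw [← fundL_apply, map_sum]
    simp only [map_smul, fundL_apply]
  rw [hr.symm, h2, hr.sum_left]
  exact Finset.sum_eq_zero fun a _ => by rw [hr.smul_left, hr.symm, h1, mul_zero]

/-- Vectors orthogonal to `τ_-` are combinations of the `V_a^-`. -/
lemma pair_eq_sum_matT_inv {w : TangentSpace 𝓘(ℝ, E) x}
    (hw : ∀ X : VectorFields F (Orb G M), IsSmoothFieldAt X (proj G x) →
      pair g x w (hlift (-1) g ξ X x) = 0) (u : TangentSpace 𝓘(ℝ, E) x) :
    pair g x w u = ∑ a, ∑ b, (matT g ξ e x)⁻¹ a b *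
      (pair g x w (fundPM (-1) g ξ (e a) x) * pair g x (fundPM (-1) g ξ (e b) x) u) := by
  have hr := isRiem_pair g
  set z : ι → ℝ := fun a => pair g x w (fundPM (-1) g ξ (e a) x) with hz
  have hu : IsUnit (matT g ξ e x).det :=
    isUnit_det_of_vecMul_eq_zero fun c => D.vecMul_matT_eq_zero e
  set c : ι → ℝ := z ᵥ* (matT g ξ e x)⁻¹ with hc
  have hcT : c ᵥ* matT g ξ e x = z := by rw [hc, vecMul_vecMul, nonsing_inv_mul _ hu, vecMul_one]
  set v := ∑ a, c a • e a with hv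
  -- The coefficients are chosen so that `n` is orthogonal to every `V_b⁻`, hence lies in `τ_-`.
  -- Since `w` is orthogonal to `τ_-`, `n` is orthogonal to itself.
  set n := w - fundPM (-1) g ξ v x with hn
  have hn1 : ∀ b, pair g x (fundPM (-1) g ξ (e b) x) n = 0 := fun b => by
    rw [hr.symm, hn, hr.sub_left, hv, ← vecMul_matT, hcT, hz, sub_self]
  have hn2 := pair_fundPM_eq_zero hn1
  have hn3 : n = hlift (-1) g ξ (ext (projD (E := E) F G x n)) x :=
    D.eq_hlift (mem_tau_iff.2 hn2) (ext_self _).symm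
  have hn4 : pair g x w n = 0 := by
    rw [hn3]
    exact hw _ (isSmoothFieldAt_ext _)
  have hn5 : pair g x n n = 0 := by
    have h : pair g x n n = pair g x w n - pair g x (fundPM (-1) g ξ v x) n := hr.sub_left x _ _ _
    rw [h, hn4, hn2, sub_zero]
  have hwv : pair g x w u = pair g x (fundPM (-1) g ξ v x) u :=
    congrArg (pair g x · u) (sub_eq_zero.1 (hr.eq_zero_of_self hn5))
  rw [hwv, hv, pair_fundPM_sum, Finset.sum_comm]
  refine Finset.sum_congr rfl fun b _ => ?_
  rw [hc, vecMul, dotProduct, Finset.sum_mul]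
  refine Finset.sum_congr rfl fun a _ => ?_
  ring

/-- Polarized isotropy identifies the numbers `g(V_a⁺, V_v)` with the row of coordinates of `v`
times `K`; multiplying by the inverse on the right recovers the coordinates and fixes the order of
the indices. -/
lemma eq_sum_matK_inv (L : GroupLieAlgebra 𝓘(ℝ, EG) G →ₗ[ℝ] ℝ)
    (v : GroupLieAlgebra 𝓘(ℝ, EG) G) :
    L v = ∑ a, ∑ b, (matK g ξ e x)⁻¹ a b
      * pair g x (fundPM 1 g ξ (e a) x) (fund v x) * L (e b) := by
  have hr := isRiem_pair g
  have h : (e.repr v : ι → ℝ) ᵥ* matK g ξ e x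
      = fun a => pair g x (fundPM 1 g ξ (e a) x) (fund v x) := funext fun a => by
    rw [vecMul_matK, e.sum_repr, pair_fundPM, pair_fundPM, hr.symm]
    linarith [D.closed.polarized v (e a) x]
  have hu : IsUnit (matK g ξ e x).det :=
    isUnit_det_of_vecMul_eq_zero fun c => D.vecMul_matK_eq_zero e
  have hc : (e.repr v : ι → ℝ)
      = (fun a => pair g x (fundPM 1 g ξ (e a) x) (fund v x)) ᵥ* (matK g ξ e x)⁻¹ := by
    rw [← h, vecMul_vecMul, mul_nonsing_inv _ hu, vecMul_one]
  conv_lhs => rw [← e.sum_repr v, map_sum]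
  rw [Finset.sum_comm]
  refine Finset.sum_congr rfl fun b _ => ?_
  rw [map_smul, smul_eq_mul, hc, vecMul, dotProduct, Finset.sum_mul]
  refine Finset.sum_congr rfl fun a _ => ?_
  ring

end Basis

/-- `ξ_v^±` vanishes identically on lifts to `τ_±`, so in the formula for the exterior derivative
only the bracket term remains. -/
lemma extD1_xiPM_hlift {s : ℝ} {X Y : VectorFields F (Orb G M)} {x : M}
    (hX : IsSmoothFieldAt X (proj G x)) (hY : IsSmoothFieldAt Y (proj G x))
    (v : GroupLieAlgebra 𝓘(ℝ, EG) G) :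
    extD1 (xiPM s g ξ v) x (hlift s g ξ X x) (hlift s g ξ Y x)
      = - pair g x (fundPM s g ξ v x)
          (mlieBracket 𝓘(ℝ, E) (hlift s g ξ X) (hlift s g ξ Y) x) := by
  have h0 : ∀ Z : VectorFields F (Orb G M),
      (fun y => pair g y (fundPM s g ξ v y) (hlift s g ξ Z y)) = fun _ => 0 := fun Z =>
    funext fun y => mem_tau_iff.1 (D.hlift_mem s Z y) v
  have hone := (isRiem_pair g).isOneFormAt ((isSmoothField_fundPM (g := g) (ξ := ξ) s v).at x)
  rw [xiPM_eq, hone.extD1_eq (D.isSmoothFieldAt_hlift s hX).diff (D.isSmoothFieldAt_hlift s hY).diff,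
    h0, h0, mvfderiv_const]
  change (0 : ℝ) - 0 - _ = _
  ring

/-- The Bismut derivative of a horizontal lift in a vertical direction. -/
lemma pair_bismut_fund_hlift {Z W : VectorFields F (Orb G M)} {x : M}
    (hZ : IsSmoothFieldAt Z (proj G x)) (hW : IsSmoothFieldAt W (proj G x))
    (v : GroupLieAlgebra 𝓘(ℝ, EG) G) :
    pair g x (bismut (-1) (pair g) H.eval (fund v) (hlift (-1) g ξ Z) x) (hlift (-1) g ξ W x)
      = - (1 / 2) * pair g x (fundPM (-1) g ξ v x)
          (mlieBracket 𝓘(ℝ, E) (hlift (-1) g ξ Z) (hlift (-1) g ξ W) x) := by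
  have hr := isRiem_pair g
  have hZ' := (D.isSmoothFieldAt_hlift (-1) hZ).diff
  have hW' := (D.isSmoothFieldAt_hlift (-1) hW).diff
  rw [hr.bismut_apply ((isSmoothField_fund v).at x).diff hZ' (H.isLinearMap_eval _ _ _) hW',
    koszul, mlieBracket_fund (D.isInvariantField_hlift (-1) Z) hZ',
    mlieBracket_fund (D.isInvariantField_hlift (-1) W) hW', hr.zero_left, hr.zero_left,
    mvfderiv_fund_eq_zero (hr.mdiff hZ' hW') (fun a y => D.pair_hlift_smul (-1) Z W a y),
    ← D.closed.moment, (isOneFormAt_eval ξ v x).extD1_eq hZ' hW', pair_fundPM]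
  -- On `τ_-` the forms `g(V_v)` and `ξ_v` agree. So the Koszul derivatives cancel those in `½ dξ_v
  -- = ½ ι_{V_v} H`, and the two bracket terms combine to `V_v⁻`.
  have h0 : ∀ A : VectorFields F (Orb G M), (fun y => pair g y (fund v y) (hlift (-1) g ξ A y))
      = fun y => ξ.eval v y (hlift (-1) g ξ A y) := fun A => funext fun y => by
    rw [D.pair_fund_hlift]
    ring
  rw [h0, h0, hr.symm x _ (fund v x)]
  ring

/-- The lift of `∇̃_Y Z` and `∇⁻_{Y⁺} Z⁻` have the same products with `τ_-`, so compatibility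
replaces the derivative of their difference by its product with `∇⁻_{X⁺} W⁻`. Expanding the
difference in the `V_a⁻`, and using that they are orthogonal to `Z⁻` and `W⁻`, puts both derivatives
on them. -/
lemma pair_bismut_hlift_redBismut {ι : Type*} [Fintype ι] [DecidableEq ι]
    (e : Module.Basis ι ℝ (GroupLieAlgebra 𝓘(ℝ, EG) G))
    {X Y Z W : VectorFields F (Orb G M)} (hX : IsSmoothField X) (hY : IsSmoothField Y)
    (hZ : IsSmoothField Z) (hW : IsSmoothField W) (x : M) :
    pair g x (bismut (-1) (pair g) H.eval (hlift 1 g ξ X)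
        (hlift (-1) g ξ (redBismut g H ξ Y Z)) x) (hlift (-1) g ξ W x)
      = pair g x (bismut (-1) (pair g) H.eval (hlift 1 g ξ X)
          (bismut (-1) (pair g) H.eval (hlift 1 g ξ Y) (hlift (-1) g ξ Z)) x) (hlift (-1) g ξ W x)
        + ∑ a, ∑ b, (matT g ξ e x)⁻¹ a b *
          (pair g x (hlift (-1) g ξ Z x)
              (bismut (-1) (pair g) H.eval (hlift 1 g ξ Y) (fundPM (-1) g ξ (e a)) x)
            * pair g x (hlift (-1) g ξ W x)
              (bismut (-1) (pair g) H.eval (hlift 1 g ξ X) (fundPM (-1) g ξ (e b)) x)) := by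
  have hr := isRiem_pair g
  have hX' := D.isSmoothFieldAt_hlift 1 (hX.at (proj G x))
  have hY' := D.isSmoothFieldAt_hlift 1 (hY.at (proj G x))
  have hZ' := D.isSmoothFieldAt_hlift (-1) (hZ.at (proj G x))
  have hW' := D.isSmoothFieldAt_hlift (-1) (hW.at (proj G x))
  set P := hlift (-1) g ξ (redBismut g H ξ Y Z) with hP
  set S := bismut (-1) (pair g) H.eval (hlift 1 g ξ Y) (hlift (-1) g ξ Z) with hS
  have hP' : IsSmoothFieldAt P x := D.isSmoothFieldAt_hlift (-1) (D.isSmoothFieldAt_redBismut hY hZ _)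
  have hS' : IsSmoothFieldAt S x := hr.isSmoothFieldAt_bismut (s := -1) H hY' hZ'
  have hPS : ∀ (A : VectorFields F (Orb G M)) (y : M), IsSmoothFieldAt A (proj G y) →
      pair g y (P y) (hlift (-1) g ξ A y) = pair g y (S y) (hlift (-1) g ξ A y) := fun A y hA => by
    rw [hP, ← D.redMetric_proj_neg, D.redMetric_redBismut (hY.at _) (hZ.at _) hA]
  have h1 := hr.bismut_compat (s := -1) H hX'.diff hP'.diff hW'.diff
  have h2 := hr.bismut_compat (s := -1) H hX'.diff hS'.diff hW'.diff
  have h3 : (fun y => pair g y (P y) (hlift (-1) g ξ W y))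
      = fun y => pair g y (S y) (hlift (-1) g ξ W y) := funext fun y => hPS W y (hW.at _)
  rw [h3] at h1
  have h4 := D.pair_eq_sum_matT_inv e (w := S x - P x)
    (fun A hA => by rw [hr.sub_left, hPS A x hA, sub_self])
    (bismut (-1) (pair g) H.eval (hlift 1 g ξ X) (hlift (-1) g ξ W) x)
  have horth : ∀ (A : VectorFields F (Orb G M)) (v : GroupLieAlgebra 𝓘(ℝ, EG) G) (y : M),
      pair g y (hlift (-1) g ξ A y) (fundPM (-1) g ξ v y) = 0 := fun A v y => by
    rw [hr.symm]
    exact mem_tau_iff.1 (D.hlift_mem (-1) A y) v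
  have hcompat : ∀ (A B : VectorFields F (Orb G M)) (v : GroupLieAlgebra 𝓘(ℝ, EG) G),
      IsSmoothField A → IsSmoothField B →
      pair g x (bismut (-1) (pair g) H.eval (hlift 1 g ξ A) (hlift (-1) g ξ B) x)
        (fundPM (-1) g ξ v x) = - pair g x (hlift (-1) g ξ B x)
          (bismut (-1) (pair g) H.eval (hlift 1 g ξ A) (fundPM (-1) g ξ v) x) :=
    fun A B v hA hB => by
      have h := hr.bismut_compat (s := -1) H (D.isSmoothFieldAt_hlift 1 (hA.at (proj G x))).diff
        (D.isSmoothFieldAt_hlift (-1) (hB.at (proj G x))).diff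
        ((isSmoothField_fundPM (g := g) (ξ := ξ) (-1) v).at x).diff
      simp only [horth, mvfderiv_const] at h
      exact eq_neg_of_add_eq_zero_left h
  have h5 : ∀ a b, pair g x (S x - P x) (fundPM (-1) g ξ (e a) x)
      * pair g x (fundPM (-1) g ξ (e b) x)
        (bismut (-1) (pair g) H.eval (hlift 1 g ξ X) (hlift (-1) g ξ W) x)
      = pair g x (hlift (-1) g ξ Z x)
              (bismut (-1) (pair g) H.eval (hlift 1 g ξ Y) (fundPM (-1) g ξ (e a)) x)
            * pair g x (hlift (-1) g ξ W x)
              (bismut (-1) (pair g) H.eval (hlift 1 g ξ X) (fundPM (-1) g ξ (e b)) x) :=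
    fun a b => by
      rw [hr.sub_left, hP, horth, hS, hcompat Y Z _ hY hZ, hr.symm x (fundPM _ _ _ _ _),
        hcompat X W _ hX hW]
      ring
  simp only [h5] at h4
  rw [← h4, hr.sub_left]
  linarith

/-- The correction of the bracket of horizontal lifts. -/
lemma pair_bismut_hlift_mlieBracket {ι : Type*} [Fintype ι] [DecidableEq ι]
    (e : Module.Basis ι ℝ (GroupLieAlgebra 𝓘(ℝ, EG) G))
    {X Y Z W : VectorFields F (Orb G M)} {x : M} (hX : IsSmoothFieldAt X (proj G x))
    (hY : IsSmoothFieldAt Y (proj G x)) (hZ : IsSmoothFieldAt Z (proj G x))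
    (hW : IsSmoothFieldAt W (proj G x)) :
    pair g x (bismut (-1) (pair g) H.eval (hlift 1 g ξ (mlieBracket 𝓘(ℝ, F) X Y))
        (hlift (-1) g ξ Z) x) (hlift (-1) g ξ W x)
      = pair g x (bismut (-1) (pair g) H.eval
          (mlieBracket 𝓘(ℝ, E) (hlift 1 g ξ X) (hlift 1 g ξ Y)) (hlift (-1) g ξ Z) x)
          (hlift (-1) g ξ W x)
        + (1 / 2) * ∑ a, ∑ b, (matK g ξ e x)⁻¹ a b
            * extD1 (xiPM 1 g ξ (e a)) x (hlift 1 g ξ X x) (hlift 1 g ξ Y x)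
            * extD1 (xiPM (-1) g ξ (e b)) x (hlift (-1) g ξ Z x) (hlift (-1) g ξ W x) := by
  have hr := isRiem_pair g
  have hX' := D.isSmoothFieldAt_hlift 1 hX
  have hY' := D.isSmoothFieldAt_hlift 1 hY
  have hZ' := D.isSmoothFieldAt_hlift (-1) hZ
  have hB := D.isSmoothFieldAt_hlift 1 (hX.mlieBracket hY)
  -- Both brackets have the same projection, so they differ at `x` by a vertical vector. Its
  -- fundamental field serves as the direction, since the derivative depends only on the value at
  -- `x`.
  obtain ⟨v, hv⟩ := D.exists_sub_eq_fund ((D.projD_mlieBracket hX'.diff hY'.diff hX.diff hY.diff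
    (D.projD_hlift 1 X) (D.projD_hlift 1 Y)).trans
      (D.projD_hlift 1 (mlieBracket 𝓘(ℝ, F) X Y) x).symm)
  have hfund := (isSmoothField_fund (E := E) (M := M) v).at x
  have h1 : bismut (-1) (pair g) H.eval
      (mlieBracket 𝓘(ℝ, E) (hlift 1 g ξ X) (hlift 1 g ξ Y)) (hlift (-1) g ξ Z) x
      = bismut (-1) (pair g) H.eval (hlift 1 g ξ (mlieBracket 𝓘(ℝ, F) X Y)) (hlift (-1) g ξ Z) x
        + bismut (-1) (pair g) H.eval (fund v) (hlift (-1) g ξ Z) x := by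
    rw [← hr.bismut_add_left H hB.diff hfund.diff hZ'.diff]
    exact hr.bismut_congr_left H (hX'.mlieBracket hY').diff (hB.add hfund).diff hZ'.diff hv
  set b := mlieBracket 𝓘(ℝ, E) (hlift (-1) g ξ Z) (hlift (-1) g ξ W) x with hb
  let L : GroupLieAlgebra 𝓘(ℝ, EG) G →ₗ[ℝ] ℝ := (hr.toLin x).flip b ∘ₗ fundPML (-1) g ξ x
  have hL : ∀ u, L u = pair g x (fundPM (-1) g ξ u x) b := fun u => rfl
  have h2 := D.eq_sum_matK_inv e (x := x) L v
  have h3 : ∀ a, pair g x (fundPM 1 g ξ (e a) x) (fund v x)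
      = - extD1 (xiPM 1 g ξ (e a)) x (hlift 1 g ξ X x) (hlift 1 g ξ Y x) := fun a => by
    rw [D.extD1_xiPM_hlift hX hY, hv, hr.add_right,
      mem_tau_iff.1 (D.hlift_mem 1 (mlieBracket 𝓘(ℝ, F) X Y) x)]
    ring
  have h4 : ∀ u, L u = - extD1 (xiPM (-1) g ξ u) x (hlift (-1) g ξ Z x) (hlift (-1) g ξ W x) :=
    fun u => by rw [D.extD1_xiPM_hlift hZ hW, hL, neg_neg]
  have h5 : L v = ∑ a, ∑ b, (matK g ξ e x)⁻¹ a b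
            * extD1 (xiPM 1 g ξ (e a)) x (hlift 1 g ξ X x) (hlift 1 g ξ Y x)
            * extD1 (xiPM (-1) g ξ (e b)) x (hlift (-1) g ξ Z x) (hlift (-1) g ξ W x) := by
    rw [h2]
    refine Finset.sum_congr rfl fun a _ => Finset.sum_congr rfl fun b _ => ?_
    rw [h3, h4]
    ring
  rw [h1, hr.add_left, D.pair_bismut_fund_hlift hZ hW, ← hb, ← hL, h5]
  ring

/-- The curvature of the reduced Bismut connection. -/
theorem redMetric_curvature {ι : Type*} [Fintype ι] [DecidableEq ι]
    (e : Module.Basis ι ℝ (GroupLieAlgebra 𝓘(ℝ, EG) G))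
    {X Y Z W : VectorFields F (Orb G M)} (hX : IsSmoothField X) (hY : IsSmoothField Y)
    (hZ : IsSmoothField Z) (hW : IsSmoothField W) (x : M) :
    redMetric g ξ (proj G x) (curvature (redBismut g H ξ) X Y Z (proj G x)) (W (proj G x)) =
      pair g x
          (curvature (bismut (-1) (pair g) H.eval)
            (hlift 1 g ξ X) (hlift 1 g ξ Y) (hlift (-1) g ξ Z) x)
          (hlift (-1) g ξ W x)
        - (1 / 2) * ∑ a, ∑ b, (matK g ξ e x)⁻¹ a b
            * extD1 (xiPM 1 g ξ (e a)) x (hlift 1 g ξ X x) (hlift 1 g ξ Y x)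
            * extD1 (xiPM (-1) g ξ (e b)) x (hlift (-1) g ξ Z x) (hlift (-1) g ξ W x)
        + ∑ a, ∑ b, (matT g ξ e x)⁻¹ a b *
            (pair g x (hlift (-1) g ξ Z x)
                (bismut (-1) (pair g) H.eval (hlift 1 g ξ Y) (fundPM (-1) g ξ (e a)) x)
              * pair g x (hlift (-1) g ξ W x)
                (bismut (-1) (pair g) H.eval (hlift 1 g ξ X) (fundPM (-1) g ξ (e b)) x)
              - pair g x (hlift (-1) g ξ Z x)
                (bismut (-1) (pair g) H.eval (hlift 1 g ξ X) (fundPM (-1) g ξ (e a)) x)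
              * pair g x (hlift (-1) g ξ W x)
                (bismut (-1) (pair g) H.eval (hlift 1 g ξ Y) (fundPM (-1) g ξ (e b)) x)) := by
  have hr := isRiem_pair g
  have hrr := D.isRiem_redMetric
  have hX' := hX.at (proj G x)
  have hY' := hY.at (proj G x)
  have hZ' := hZ.at (proj G x)
  have hW' := hW.at (proj G x)
  -- Every derivative downstairs is rewritten upstairs; the two iterated derivatives produce the `T`
  -- terms and the bracket produces the `K` term.
  rw [curvature, curvature, hrr.sub_left, hrr.sub_left, hr.sub_left, hr.sub_left,
    D.redMetric_redBismut hX' (D.isSmoothFieldAt_redBismut hY hZ _) hW',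
    D.redMetric_redBismut hY' (D.isSmoothFieldAt_redBismut hX hZ _) hW',
    D.redMetric_redBismut (hX'.mlieBracket hY') hZ' hW',
    D.pair_bismut_hlift_redBismut e hX hY hZ hW, D.pair_bismut_hlift_redBismut e hY hX hZ hW,
    D.pair_bismut_hlift_mlieBracket e hX' hY' hZ' hW']
  simp only [mul_sub, Finset.sum_sub_distrib]
  ring

end IsReduction

end ReducedCurvature

end BismutReduction

open BismutReduction in
theorem theorem6p2
    {EG : Type*} [NormedAddCommGroup EG] [NormedSpace ℝ EG] [FiniteDimensional ℝ EG]
    {E : Type*} [NormedAddCommGroup E] [NormedSpace ℝ E] [FiniteDimensional ℝ E]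
    {F : Type*} [NormedAddCommGroup F] [NormedSpace ℝ F] [FiniteDimensional ℝ F]
    -- a compact connected Lie group
    {G : Type*} [TopologicalSpace G] [ChartedSpace EG G] [Group G] [LieGroup 𝓘(ℝ, EG) ∞ G]
    [T2Space G] [CompactSpace G] [ConnectedSpace G]
    -- a smooth manifold with a smooth, free and proper action
    {M : Type*} [TopologicalSpace M] [ChartedSpace E M] [IsManifold 𝓘(ℝ, E) ∞ M] [T2Space M]
    [MulAction G M] [ContMDiffSMul 𝓘(ℝ, EG) 𝓘(ℝ, E) ∞ G M] [ProperSMul G M]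
    (hfree : ∀ (a : G) (x : M), a • x = x → a = 1)
    -- the smooth structure of the orbit space: the one for which the projection is a submersion
    [ChartedSpace F (Orb G M)] [IsManifold 𝓘(ℝ, F) ∞ (Orb G M)]
    (hproj : Manifold.IsSubmersion 𝓘(ℝ, E) 𝓘(ℝ, F) ∞ (proj G : M → Orb G M))
    -- invariant metric and flux, equivariantly closed isotropic extension
    (g : Metric E M) (hg : InvariantMetric G g)
    (H : ThreeForm E M) (hH : InvariantThreeForm G H)
    (ξ : EquivariantOneForm EG G E M) (hξ : EquivariantlyClosed H ξ)
    {ι : Type*} [Fintype ι] [DecidableEq ι]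
    (e : Module.Basis ι ℝ (GroupLieAlgebra 𝓘(ℝ, EG) G))
    (X Y Z W : VectorFields F (Orb G M))
    (hX : IsSmoothField X) (hY : IsSmoothField Y) (hZ : IsSmoothField Z) (hW : IsSmoothField W)
    (x : M) :
    redMetric g ξ (proj G x) (curvature (redBismut g H ξ) X Y Z (proj G x)) (W (proj G x)) =
      pair g x
          (curvature (bismut (-1) (pair g) H.eval)
            (hlift 1 g ξ X) (hlift 1 g ξ Y) (hlift (-1) g ξ Z) x)
          (hlift (-1) g ξ W x)
        - (1 / 2) * ∑ a, ∑ b, (matK g ξ e x)⁻¹ a b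
            * extD1 (xiPM 1 g ξ (e a)) x (hlift 1 g ξ X x) (hlift 1 g ξ Y x)
            * extD1 (xiPM (-1) g ξ (e b)) x (hlift (-1) g ξ Z x) (hlift (-1) g ξ W x)
        + ∑ a, ∑ b, (matT g ξ e x)⁻¹ a b *
            (pair g x (hlift (-1) g ξ Z x)
                (bismut (-1) (pair g) H.eval (hlift 1 g ξ Y) (fundPM (-1) g ξ (e a)) x)
              * pair g x (hlift (-1) g ξ W x)
                (bismut (-1) (pair g) H.eval (hlift 1 g ξ X) (fundPM (-1) g ξ (e b)) x)
              - pair g x (hlift (-1) g ξ Z x)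
                (bismut (-1) (pair g) H.eval (hlift 1 g ξ X) (fundPM (-1) g ξ (e a)) x)
              * pair g x (hlift (-1) g ξ W x)
                (bismut (-1) (pair g) H.eval (hlift 1 g ξ Y) (fundPM (-1) g ξ (e b)) x)) := by
  have D : IsReduction F g H ξ := ⟨hfree, hproj, hg, hH, hξ⟩
  exact D.redMetric_curvature e hX hY hZ hW x
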